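/- For $j\ge 1$ let $\phi_j(x)=\sqrt{2/\pi}\,\sin jx$ on $[0,\pi]$, and for $f$ on $[0,\pi]$ let $f_j=\int_0^\pi f\phi_j\,dx$. For real $r$ put $|f|_r^2=\sum_{j\ge1} j^{2r}f_j^2$, and let $H^r_*$ be the space of $f=\sum_j f_j\phi_j$ with $|f|_r<\infty$ (for $r<0$, of the formal series). For $m\ge -1/2$ let $\omega_j^2=j^4+mj^2$ and $$|f|_{\tilde H^{-1}}^2=\sum_{j\ge1}\frac{j^2}{\omega_j^2}f_j^2,\qquad |f|_{H^r_N}^2=\sum_{j\le N}j^2f_j^2+\sum_{j>N}j^{2r}f_j^2,\qquad \mu=\min\Big\{2\sqrt{1+m},\tfrac32\sqrt{4+m}\Big\}.$$ For $\varepsilon\ge 0$ set $$T_0=T_0(\varepsilon)=0.948\,\frac{1-c_\dagger c_*\varepsilon^2/\mu}{c_\dagger c_*^2},\qquad c_*=\Big(\frac{11}{10}\Big)^2\Big(\frac56-\frac1{80e}\Big)^{-2},\qquad c_\dagger=\frac{44e}{\pi}.$$ Consider the hinged-hinged beam equation $$u_{tt}+u_{xxxx}-\Big(m+\frac1{2\pi}\int_0^\pi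 u_x^2\,dx\Big)u_{xx}=0,\qquad u=u_{xx}=0\ \text{ at } x=0,\pi,\qquad u(0,\cdot)=u_0,\quad u_t(0,\cdot)=v_0 .$$ Given $s>1/2$, $u_0\in H^{s+2}_*$, $v_0\in H^s_*$ and an open interval $I\ni 0$, a weak solution on $I$ is a curve $u\in C(I;H^{s+2}_*)\cap C^1(I;H^s_*)\cap C^2(I;H^{s-2}_*)$ with these initial data such that for all $t\in I$ and all $\eta\in C^\infty_c((0,\pi))$ $$\langle u_{tt},\eta\rangle+\int_0^\pi u_{xx}\eta_{xx}\,dx+\Big(m+\frac1{2\pi}\int_0^\pi u_x^2\,dx\Big)\int_0^\pi u_x\eta_x\,dx=0 ,\qquad \langle u_{tt},\eta\rangle=\frac{d^2}{dt^2}\int_0^\pi u\,\eta\,dx .$$ Theorem. Let $m\ge-1/2$, $s>1/2$, $u_0\in H^{s+2}_*$, $v_0\in H^s_*$. On every open interval containing $0$ there is at most one weak solution. Moreover: (a) Let $\varepsilon=\max\{|u_0|_1,\ |v_0|_0/\sqrt{1+m}\}\le 0.08\sqrt\mu$. Then a weak solution exists on an open interval containing all $t$ with $|t|\,\varepsilon^4\le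 T_0\mu$, and every weak solution satisfies $$\sup_{x\in[0,\pi]}|u(t,x)|\le 2\varepsilon$$ for all $t$ in its interval with $|t|\le T_0\mu\varepsilon^{-4}$ (all $t$ if $\varepsilon=0$), where $T_0\ge 0.008\,(1-68\varepsilon^2/\mu)\ge 0.0045$. (b) Let $\varepsilon=\max\{|u_0|_1,\ |v_0|_{\tilde H^{-1}}\}\le 0.08\sqrt\mu$. Then a weak solution exists on an open interval containing all $t$ with $|t|\,\varepsilon^4\le T_0\mu$, and there is $N\ge1$ (depending on the data) such that every weak solution satisfies $$u(t,\cdot)\in H^{s+2}_*,\qquad |u(t,\cdot)|_{H^{s+2}_N}\le 1.9\,\varepsilon,\qquad \sup_{x\in[0,\pi]}|u(t,x)|\le2\varepsilon$$ for all $t$ in its interval with $|t|\le T_0\mu\varepsilon^{-4}$ (all $t$ if $\varepsilon=0$). -/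

import Mathlib

open Real Set Filter Topology

noncomputable section

/-- The eigenfunctions `φ_j(x) = √(2/π) sin (j x)`, `j ≥ 1`, orthonormal in `L²(0,π)`. -/
def phi (j : ℕ+) (x : ℝ) : ℝ := √(2 / π) * Real.sin ((j : ℝ) * x)

/-- The sine coefficients `f_j = ∫_0^π f φ_j`, `j ≥ 1`, of `f`. -/
def sineCoeff (f : ℝ → ℝ) (j : ℕ+) : ℝ := ∫ x in (0 : ℝ)..π, f x * phi j x

/-- `f ∈ H^r_*` for `r > 1/2` (only the values on `[0,π]` matter): `f = ∑ f_j φ_j` on `[0,π]`,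
and `∑ j^{2r} f_j²` converges. For such `r` the sine series converges absolutely and uniformly,
and `f` is the continuous representative. -/
def MemHstar (r : ℝ) (f : ℝ → ℝ) : Prop :=
  Summable (fun j : ℕ+ => (j : ℝ) ^ (2 * r) * sineCoeff f j ^ 2) ∧
    ∀ x ∈ Icc (0 : ℝ) π, HasSum (fun j : ℕ+ => sineCoeff f j * phi j x) (f x)

/-- The norm `|f|_r = (∑ j^{2r} f_j²)^{1/2}`. -/
def hNorm (r : ℝ) (f : ℝ → ℝ) : ℝ :=
  √(∑' j : ℕ+, (j : ℝ) ^ (2 * r) * sineCoeff f j ^ 2)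

/-- The norm `|f|_{H^r_N}`, with `|f|²_{H^r_N} = ∑_{j ≤ N} j² f_j² + ∑_{j > N} j^{2r} f_j²`. -/
def hNormN (r : ℝ) (N : ℕ) (f : ℝ → ℝ) : ℝ :=
  √(∑' j : ℕ+, (if (j : ℕ) ≤ N then (j : ℝ) ^ 2 else (j : ℝ) ^ (2 * r)) * sineCoeff f j ^ 2)

/-- The linear frequencies `ω_j = √(j⁴ + m j²)`. -/
def omegaFreq (m : ℝ) (j : ℕ+) : ℝ := √((j : ℝ) ^ 4 + m * (j : ℝ) ^ 2)

/-- The weighted `H^{-1}` norm, with square `∑ (j² / ω_j²) f_j²`. -/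
def hTildeNegOneNorm (m : ℝ) (f : ℝ → ℝ) : ℝ :=
  √(∑' j : ℕ+, (j : ℝ) ^ 2 / omegaFreq m j ^ 2 * sineCoeff f j ^ 2)

/-- `μ = min {2 √(1+m), (3/2) √(4+m)}`. -/
def mu (m : ℝ) : ℝ := min (2 * √(1 + m)) (3 / 2 * √(4 + m))

def cStar : ℝ := (11 / 10) ^ 2 * ((5 / 6 - 1 / (80 * Real.exp 1)) ^ 2)⁻¹

def cDagger : ℝ := 44 * Real.exp 1 / π

/-- The constant `T₀ = 0.948 (1 - c_† c_* ε² / μ) / (c_† c_*²)`. -/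
def T0 (m ε : ℝ) : ℝ :=
  0.948 * (1 - cDagger * cStar * ε ^ 2 / mu m) / (cDagger * cStar ^ 2)

/-- Open intervals of times containing `0`. -/
def IsTimeInterval (I : Set ℝ) : Prop := IsOpen I ∧ I.OrdConnected ∧ (0 : ℝ) ∈ I

/-- `t ↦ u(t,·)` is of class `C^k` on `I` with values in `H^r_*`, for any real `r`: the weighted
coefficients `(j^r u_j(t))_j` form a `C^k` curve in `ℓ²`. -/
def ContDiffOnH (k : ℕ) (r : ℝ) (I : Set ℝ) (u : ℝ → ℝ → ℝ) : Prop :=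
  ∃ U : ℝ → lp (fun _ : ℕ+ => ℝ) 2, ContDiffOn ℝ k U I ∧
    ∀ t ∈ I, ∀ j : ℕ+, U t j = (j : ℝ) ^ r * sineCoeff (u t) j

/-- `η ∈ C^∞_c((0,π))`. -/
def IsTestFunction (η : ℝ → ℝ) : Prop :=
  ContDiff ℝ (⊤ : ℕ∞) η ∧ HasCompactSupport η ∧ tsupport η ⊆ Ioo 0 π

/-- `u` is a weak solution on the time interval `I` of
`u_tt + u_xxxx - (m + (1/2π) ∫_0^π u_x²) u_xx = 0`, with hinged-hinged boundary conditions (they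
are part of `u(t,·) ∈ H^{s+2}_*`) and initial data `u(0,·) = u₀`, `u_t(0,·) = v₀`.
Regularity: each time derivative costs two space derivatives. The pairing of `u_tt ∈ H^{s-2}_*`
with a test function `η` is `d²/dt² ∫_0^π u η dx`. -/
structure IsWeakSolution (m s : ℝ) (I : Set ℝ) (u₀ v₀ : ℝ → ℝ) (u : ℝ → ℝ → ℝ) : Prop where
  mem : ∀ t ∈ I, MemHstar (s + 2) (u t)
  continuous : ContDiffOnH 0 (s + 2) I u
  contDiff_one : ContDiffOnH 1 s I u
  contDiff_two : ContDiffOnH 2 (s - 2) I u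
  init_pos : ∀ x ∈ Icc (0 : ℝ) π, u 0 x = u₀ x
  init_vel : ∀ x ∈ Icc (0 : ℝ) π, HasDerivAt (fun t => u t x) (v₀ x) 0
  weak_eq : ∀ t ∈ I, ∀ η : ℝ → ℝ, IsTestFunction η →
    iteratedDeriv 2 (fun τ => ∫ x in (0 : ℝ)..π, u τ x * η x) t
      + (∫ x in (0 : ℝ)..π, iteratedDeriv 2 (u t) x * iteratedDeriv 2 η x)
      + (m + 1 / (2 * π) * ∫ x in (0 : ℝ)..π, deriv (u t) x ^ 2)
          * (∫ x in (0 : ℝ)..π, deriv (u t) x * deriv η x) = 0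

end

/-! In sine coefficients the beam equation is a family of oscillators `c_j'' = -(ω_j² + (1/2π) S j²)
c_j`, coupled only through the scalar `S = ∑ k² c_k²`. With `u_j = c_j`, `p_j = c_j'/ω_j`, `r_j =
j²/ω_j`, `b_k = k²`, `σ = 1/(2π)` and weights `W_j`, the energy `∑ W_j (u_j² + p_j²)` has the
quartic derivative `-2σ ∑_{j,k} W_j r_j b_k u_j p_j u_k²`, which alone would give control only for
times of order `ε⁻²`.

Each monomial `u_j p_j u_k²` has zero mean along the linear flow, since `u_j p_j` oscillates at
frequency `2ω_j` and `u_k²` at `0` and `2ω_k`; for `j = k` the mean vanishes as well. It is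
therefore the derivative of an explicit quartic polynomial (`pairCorrection`, `selfCorrection`) up
to sextic terms, with divisors controlled by `ω_j ≥ μ/2` and `|ω_j - ω_k| ≥ μ/2`. Adding these
corrections to the energy leaves growth of order `A³/μ` per unit time while the energy is at most
`A`. With `A = 3ε²` this gives times of order `μ ε⁻⁴` (`CoupledOscillators.finite_energy_le`,
`energy_le`, and the continuity argument `energy_lt`).

The weights are those of `H^{s+2}_N`. They dominate `j²`, so the energy controls `S`; they are much
larger than `j²` at infinity, so truncation to finitely many modes costs arbitrarily little; and for
`N` large the initial energy is as close as desired to its `H¹` value, at most `2ε²`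
(`exists_modalEnergy_le`).

For well-posedness, the amplitudes `j^{s+2} (c_j + i c_j'/ω_j)` satisfy `z' = -iωz +` a cubic map
that is Lipschitz on bounded sets of `ℓ²`. A rotating frame removes the unbounded linear part, a
radial cut-off makes Picard–Lindelöf work on any time interval, and the energy bound shows that the
cut-off is never active (`exists_modal_solution`). Uniqueness is Grönwall's inequality in the same
frame (`eqOn_of_modal_ode`).

Weak solutions and solutions of the modal system correspond
(`IsWeakSolution.exists_isModalSolution`, `IsModalSolution.isWeakSolution`). Sines are not compactly
supported test functions, so passing from the weak equation to the modes needs the du Bois-Reymond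
argument of `eq_zero_of_hasSum_sineCoeff`. -/

noncomputable section

/-! ### Square-summable sequences, coordinatewise operators and curves in `ℓ²`. -/

section SequenceSpace

variable {F G : Type*} [NormedAddCommGroup F] [NormedAddCommGroup G]

theorem memℓp_two_iff {f : ℕ+ → F} : Memℓp f 2 ↔ Summable fun j => ‖f j‖ ^ 2 := by
  rw [memℓp_gen_iff (by simp)]
  simp

theorem lp_two_norm_sq (f : lp (fun _ : ℕ+ => F) 2) : ‖f‖ ^ 2 = ∑' j, ‖f j‖ ^ 2 := by
  have := lp.norm_rpow_eq_tsum (p := 2) (by simp) f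
  simpa using this

theorem lp_two_summable (f : lp (fun _ : ℕ+ => F) 2) : Summable fun j => ‖f j‖ ^ 2 :=
  memℓp_two_iff.1 (lp.memℓp f)

theorem lp_real_summable_sq (f : lp (fun _ : ℕ+ => ℝ) 2) : Summable fun j => f j ^ 2 := by
  simpa using lp_two_summable f

/-- The element of `ℓ²` with square-summable coordinates `f`. -/
def lpOfSummable (f : ℕ+ → F) (hf : Summable fun j => ‖f j‖ ^ 2) : lp (fun _ : ℕ+ => F) 2 :=
  ⟨f, memℓp_two_iff.2 hf⟩

@[simp] theorem lpOfSummable_apply (f : ℕ+ → F) (hf : Summable fun j => ‖f j‖ ^ 2) (j : ℕ+) :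
    lpOfSummable f hf j = f j := rfl

variable [NormedSpace ℝ F] [NormedSpace ℝ G]

theorem summable_sq_of_bound {T : ℕ+ → F →ₗ[ℝ] G} {C : ℝ} (h : ∀ j x, ‖T j x‖ ≤ C * ‖x‖)
    (f : lp (fun _ : ℕ+ => F) 2) : Summable fun j => ‖T j (f j)‖ ^ 2 := by
  refine Summable.of_nonneg_of_le (fun j => by positivity) (fun j => ?_)
    ((lp_two_summable f).mul_left (C ^ 2))
  rw [← mul_pow]
  exact pow_le_pow_left₀ (norm_nonneg _) (h j _) 2

/-- The coordinatewise operator `f ↦ (T_j f_j)_j` on `ℓ²`, for uniformly bounded `T_j`. -/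
def diagOp (T : ℕ+ → F →ₗ[ℝ] G) (C : ℝ) (h : ∀ j x, ‖T j x‖ ≤ C * ‖x‖) :
    lp (fun _ : ℕ+ => F) 2 →L[ℝ] lp (fun _ : ℕ+ => G) 2 :=
  LinearMap.mkContinuous
    { toFun := fun f => lpOfSummable (fun j => T j (f j)) (summable_sq_of_bound h f)
      map_add' := fun f g => by ext j; simp
      map_smul' := fun c f => by ext j; simp } |C| (fun f => by
        have h2 : ‖lpOfSummable (fun j => T j (f j)) (summable_sq_of_bound h f)‖ ^ 2
            ≤ (|C| * ‖f‖) ^ 2 := by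
          rw [lp_two_norm_sq, mul_pow, lp_two_norm_sq, ← tsum_mul_left]
          refine Summable.tsum_le_tsum (fun j => ?_) (lp_two_summable _)
            ((lp_two_summable f).mul_left _)
          rw [← mul_pow]
          refine pow_le_pow_left₀ (norm_nonneg _) ((h j _).trans ?_) 2
          exact mul_le_mul_of_nonneg_right (le_abs_self C) (norm_nonneg _)
        exact (pow_le_pow_iff_left₀ (norm_nonneg _) (by positivity) two_ne_zero).1 h2)

@[simp] theorem diagOp_apply (T : ℕ+ → F →ₗ[ℝ] G) (C : ℝ) (h : ∀ j x, ‖T j x‖ ≤ C * ‖x‖)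
    (f : lp (fun _ : ℕ+ => F) 2) (j : ℕ+) : diagOp T C h f j = T j (f j) := rfl

theorem diagOp_norm_le (T : ℕ+ → F →ₗ[ℝ] G) (C : ℝ) (hC : 0 ≤ C) (h : ∀ j x, ‖T j x‖ ≤ C * ‖x‖)
    (f : lp (fun _ : ℕ+ => F) 2) : ‖diagOp T C h f‖ ≤ C * ‖f‖ := by
  have := (diagOp T C h).le_of_opNorm_le
    (LinearMap.mkContinuous_norm_le _ (abs_nonneg C) _) f
  rwa [abs_of_nonneg hC] at this

theorem lp_coord_clm (j : ℕ+) :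
    ∃ L : lp (fun _ : ℕ+ => F) 2 →L[ℝ] F, ∀ f, L f = f j :=
  ⟨lp.evalCLM ℝ (fun _ : ℕ+ => F) 2 j, fun _ => rfl⟩

/-- A curve in `ℓ²` that is differentiable coordinate by coordinate, with coordinates of the
derivative forming a continuous curve in `ℓ²`, is differentiable. -/
theorem hasDerivAt_lp_of_coord [CompleteSpace F] {I : Set ℝ} (hI : IsOpen I) (hc : I.OrdConnected)
    {U V : ℝ → lp (fun _ : ℕ+ => F) 2} (hV : ContinuousOn V I)
    (hUV : ∀ t ∈ I, ∀ j, HasDerivAt (fun τ => U τ j) (V t j) t) {t : ℝ} (ht : t ∈ I) :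
    HasDerivAt U (V t) t := by
  have hint : ∀ τ ∈ I, IntervalIntegrable V MeasureTheory.volume t τ := fun τ hτ =>
    (hV.mono (hc.uIcc_subset ht hτ)).intervalIntegrable
  -- The Bochner primitive of `V` through `U t` is differentiable at `t`. Coordinates commute with
  -- the integral, so this primitive coincides with `U` near `t`.
  have h1 : HasDerivAt (fun τ => U t + ∫ x in t..τ, V x) (V t) t := by
    refine HasDerivAt.const_add _ ?_
    refine intervalIntegral.integral_hasDerivAt_right (hint t ht) ?_ (hV.continuousAt (hI.mem_nhds ht))
    exact hV.stronglyMeasurableAtFilter hI t ht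
  refine h1.congr_of_eventuallyEq ?_
  filter_upwards [hI.mem_nhds ht] with τ hτ
  ext j
  obtain ⟨L, hL⟩ := lp_coord_clm (F := F) j
  have h2 : ∫ x in t..τ, V x j = U τ j - U t j := by
    refine intervalIntegral.integral_eq_sub_of_hasDerivAt
      (fun x hx => hUV x (hc.uIcc_subset ht hτ hx) j) ?_
    have : ContinuousOn (fun x => L (V x)) (uIcc t τ) :=
      L.continuous.comp_continuousOn (hV.mono (hc.uIcc_subset ht hτ))
    simp only [hL] at this
    exact this.intervalIntegrable
  have h3 := L.intervalIntegral_comp_comm (hint τ hτ)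
  simp only [hL] at h3
  rw [lp.coeFn_add, Pi.add_apply, ← h3, h2]
  abel

theorem hasDerivAt_coord {U : ℝ → lp (fun _ : ℕ+ => F) 2} {V : lp (fun _ : ℕ+ => F) 2} {t : ℝ}
    (h : HasDerivAt U V t) (j : ℕ+) : HasDerivAt (fun τ => U τ j) (V j) t := by
  obtain ⟨L, hL⟩ := lp_coord_clm (F := F) j
  have := L.hasFDerivAt.comp_hasDerivAt t h
  simpa [Function.comp_def, hL] using this

/-- The functional `f ↦ ∑ a_j f_j` on `ℓ²`, for square-summable `a`. -/
theorem lp_pairing {a : ℕ+ → ℝ} (ha : Summable fun j => a j ^ 2) :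
    ∃ L : lp (fun _ : ℕ+ => ℝ) 2 →L[ℝ] ℝ, ∀ f, HasSum (fun j => a j * f j) (L f) := by
  refine ⟨innerSL ℝ (lpOfSummable a (by simpa using ha)), fun f => ?_⟩
  have := lp.hasSum_inner (𝕜 := ℝ) (lpOfSummable a (by simpa using ha)) f
  simpa [mul_comm] using this

theorem lp_pairing_summable_abs {a : ℕ+ → ℝ} (ha : Summable fun j => a j ^ 2)
    (f : lp (fun _ : ℕ+ => ℝ) 2) : Summable fun j => |a j * f j| := by
  have hf : Summable fun j => f j ^ 2 := by simpa using lp_two_summable f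
  refine Summable.of_nonneg_of_le (fun j => abs_nonneg _) (fun j => ?_) (ha.add hf)
  rw [abs_le]
  constructor <;> nlinarith [sq_nonneg (a j + f j), sq_nonneg (a j - f j), sq_nonneg (a j), sq_nonneg (f j)]

/-- Bounded multipliers act continuously on `ℓ²`, and the sum is the squared norm of such an image
of `U t`. The weighted energies and the stretch are sums of this type. -/
theorem continuousOn_tsum_sq {I : Set ℝ} {U : ℝ → lp (fun _ : ℕ+ => ℝ) 2} (hU : ContinuousOn U I)
    {c : ℕ+ → ℝ} {C : ℝ} (hc : ∀ j, |c j| ≤ C) :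
    ContinuousOn (fun t => ∑' j, (c j * U t j) ^ 2) I := by
  have hC : ∀ j x, ‖(LinearMap.mulLeft ℝ (c j)) x‖ ≤ C * ‖x‖ := fun j x => by
    simp only [LinearMap.mulLeft_apply, norm_mul, Real.norm_eq_abs]
    exact mul_le_mul_of_nonneg_right (hc j) (abs_nonneg _)
  have h : ContinuousOn (fun t => ‖diagOp (fun j => LinearMap.mulLeft ℝ (c j)) C hC (U t)‖ ^ 2) I :=
    (((diagOp _ C hC).continuous.comp_continuousOn hU).norm).pow 2
  refine h.congr fun t _ => ?_
  simp only [lp_two_norm_sq, diagOp_apply, LinearMap.mulLeft_apply, Real.norm_eq_abs, sq_abs]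

end SequenceSpace

/-! ### Trigonometric eigenfunctions and termwise calculus of sine series. -/

/-- `ψ_j(x) = √(2/π) cos (j x)`, so that `φ_j' = j ψ_j` and `ψ_j' = - j φ_j`. -/
def psi (j : ℕ+) (x : ℝ) : ℝ := √(2 / π) * Real.cos ((j : ℝ) * x)

theorem sqrt_two_div_pi_le_one : √(2 / π) ≤ 1 := by
  refine Real.sqrt_le_one.2 ?_
  rw [div_le_one pi_pos]
  exact pi_gt_three.le.trans' (by norm_num)

theorem continuous_phi (j : ℕ+) : Continuous (phi j) := by unfold phi; fun_prop

theorem continuous_psi (j : ℕ+) : Continuous (psi j) := by unfold psi; fun_prop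

theorem abs_phi_le' (j : ℕ+) (x : ℝ) : |phi j x| ≤ √(2 / π) := by
  rw [phi, abs_mul, abs_of_nonneg (sqrt_nonneg _)]
  exact mul_le_of_le_one_right (sqrt_nonneg _) (abs_sin_le_one _)

theorem abs_phi_le (j : ℕ+) (x : ℝ) : |phi j x| ≤ 1 :=
  (abs_phi_le' j x).trans sqrt_two_div_pi_le_one

theorem abs_psi_le (j : ℕ+) (x : ℝ) : |psi j x| ≤ 1 := by
  rw [psi, abs_mul, abs_of_nonneg (sqrt_nonneg _)]
  exact (mul_le_of_le_one_right (sqrt_nonneg _) (abs_cos_le_one _)).trans sqrt_two_div_pi_le_one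

theorem phi_zero (j : ℕ+) : phi j 0 = 0 := by simp [phi]

theorem phi_pi (j : ℕ+) : phi j π = 0 := by simp [phi, Real.sin_nat_mul_pi]

theorem hasDerivAt_phi (j : ℕ+) (x : ℝ) : HasDerivAt (phi j) ((j : ℝ) * psi j x) x := by
  have h := ((hasDerivAt_id x).const_mul (j : ℝ)).sin.const_mul √(2 / π)
  refine h.congr_deriv ?_
  simp only [psi, id]; ring

theorem hasDerivAt_psi (j : ℕ+) (x : ℝ) : HasDerivAt (psi j) (-((j : ℝ) * phi j x)) x := by
  have h := ((hasDerivAt_id x).const_mul (j : ℝ)).cos.const_mul √(2 / π)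
  refine h.congr_deriv ?_
  simp only [phi, id]; ring

theorem integral_cos_int_mul (n : ℤ) (hn : n ≠ 0) : ∫ x in (0 : ℝ)..π, Real.cos ((n : ℝ) * x) = 0 := by
  have hn' : (n : ℝ) ≠ 0 := by exact_mod_cast hn
  rw [intervalIntegral.integral_comp_mul_left (fun y => Real.cos y) hn', integral_cos]
  simp [Real.sin_int_mul_pi]

theorem integral_phi_mul_phi (j k : ℕ+) :
    ∫ x in (0 : ℝ)..π, phi j x * phi k x = if j = k then 1 else 0 := by
  have h1 : ∀ x, phi j x * phi k x
      = (1 / π) * (Real.cos (((j - k : ℤ) : ℝ) * x) - Real.cos (((j + k : ℤ) : ℝ) * x)) := by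
    intro x
    have h2 : √(2 / π) * √(2 / π) = 2 / π := Real.mul_self_sqrt (by positivity)
    push_cast
    rw [sub_mul, add_mul, Real.cos_sub, Real.cos_add, phi, phi]
    linear_combination (Real.sin (j * x) * Real.sin (k * x)) * h2
  have hc : ∀ n : ℤ, IntervalIntegrable (fun x => Real.cos ((n : ℝ) * x)) MeasureTheory.volume 0 π :=
    fun n => (by fun_prop : Continuous fun x => Real.cos ((n : ℝ) * x)).intervalIntegrable _ _
  simp_rw [h1]
  rw [intervalIntegral.integral_const_mul, intervalIntegral.integral_sub (hc _) (hc _),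
    integral_cos_int_mul (j + k : ℤ) (by have := j.pos; have := k.pos; positivity)]
  split_ifs with h
  · subst h
    simp [pi_ne_zero]
  · rw [integral_cos_int_mul]
    · simp
    · intro h3
      apply h
      rw [sub_eq_zero] at h3
      exact PNat.coe_injective (by exact_mod_cast h3)

/-- Termwise integration of an absolutely convergent series of bounded functions. -/
theorem hasSum_integral_mul {e : ℕ+ → ℝ → ℝ} (he : ∀ j, Continuous (e j)) (hb : ∀ j x, |e j x| ≤ 1)
    {c : ℕ+ → ℝ} (hc : Summable fun j => |c j|) {f g : ℝ → ℝ} (hg : Continuous g)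
    (hf : ∀ x ∈ Ioo 0 π, HasSum (fun j => c j * e j x) (f x)) :
    HasSum (fun j => c j * ∫ x in (0 : ℝ)..π, e j x * g x) (∫ x in (0 : ℝ)..π, f x * g x) := by
  -- The expansion is assumed on the open interval only, while the integral runs over `Ioc 0 π`; the
  -- endpoint is a null set.
  have hpi : ∀ᵐ x ∂(MeasureTheory.volume : MeasureTheory.Measure ℝ), x ≠ π := by
    simp [MeasureTheory.ae_iff]
  have h := intervalIntegral.hasSum_integral_of_dominated_convergence (a := 0) (b := π)
    (μ := MeasureTheory.volume) (F := fun j x => c j * (e j x * g x)) (f := fun x => f x * g x)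
    (fun j x => |c j| * |g x|) (fun j => ?_) (fun j => ?_) ?_ ?_ ?_
  · simpa only [intervalIntegral.integral_const_mul] using h
  · exact (((he j).mul hg).const_mul _).aestronglyMeasurable
  · refine Eventually.of_forall fun x _ => ?_
    rw [norm_mul, norm_mul, Real.norm_eq_abs, Real.norm_eq_abs, Real.norm_eq_abs]
    exact mul_le_mul_of_nonneg_left (mul_le_of_le_one_left (abs_nonneg _) (hb j x)) (abs_nonneg _)
  · exact Eventually.of_forall fun x _ => hc.mul_right _
  · simp_rw [tsum_mul_right]
    exact (by fun_prop : Continuous fun x => (∑' j, |c j|) * |g x|).intervalIntegrable _ _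
  · filter_upwards [hpi] with x hx hx2
    rw [uIoc_of_le pi_pos.le] at hx2
    have := (hf x ⟨hx2.1, lt_of_le_of_ne hx2.2 hx⟩).mul_right (g x)
    simpa only [mul_assoc] using this

theorem sineCoeff_of_hasSum {c : ℕ+ → ℝ} (hc : Summable fun j => |c j|) {f : ℝ → ℝ}
    (hf : ∀ x ∈ Ioo 0 π, HasSum (fun j => c j * phi j x) (f x)) (j : ℕ+) : sineCoeff f j = c j := by
  have h := hasSum_integral_mul continuous_phi abs_phi_le hc (continuous_phi j) hf
  simp_rw [integral_phi_mul_phi, mul_ite, mul_one, mul_zero] at h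
  refine h.unique ?_
  convert hasSum_ite_eq j (c j) using 3 with k hk
  rw [hk]

theorem summable_pnat_rpow {r : ℝ} (hr : r < -1) : Summable fun j : ℕ+ => (j : ℝ) ^ r :=
  (Real.summable_nat_rpow.2 hr).comp_injective PNat.coe_injective

theorem pnat_cast_pos (j : ℕ+) : (0 : ℝ) < j := by exact_mod_cast j.pos

theorem one_le_pnat_cast (j : ℕ+) : (1 : ℝ) ≤ j := Nat.one_le_cast.2 j.pos

/-- `∑ j^k |c_j| < ∞` if `∑ j^{2r} c_j² < ∞` and `r > k + 1/2`. -/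
theorem summable_rpow_mul_abs {r k : ℝ} (hr : k + 1 / 2 < r) {c : ℕ+ → ℝ}
    (hc : Summable fun j : ℕ+ => (j : ℝ) ^ (2 * r) * c j ^ 2) :
    Summable fun j : ℕ+ => (j : ℝ) ^ k * |c j| := by
  -- Write `j^k |c_j| = j^{k-r} · j^r |c_j|` and bound the product by the sum of the squares; the
  -- first square is summable because `2(k-r) < -1`.
  have h1 : Summable fun j : ℕ+ => (j : ℝ) ^ (2 * (k - r)) := summable_pnat_rpow (by linarith)
  refine Summable.of_nonneg_of_le (fun j => by positivity) (fun j => ?_) (h1.add hc)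
  have hj := pnat_cast_pos j
  have h2 : (j : ℝ) ^ k = (j : ℝ) ^ (k - r) * (j : ℝ) ^ r := by rw [← rpow_add hj]; ring_nf
  have h3 : (j : ℝ) ^ (2 * (k - r)) = ((j : ℝ) ^ (k - r)) ^ 2 := by
    rw [← rpow_natCast, ← rpow_mul hj.le]; push_cast; ring_nf
  have h4 : (j : ℝ) ^ (2 * r) = ((j : ℝ) ^ r) ^ 2 := by
    rw [← rpow_natCast, ← rpow_mul hj.le]; push_cast; ring_nf
  rw [h2, h3, h4, ← sq_abs (c j)]
  nlinarith [sq_nonneg ((j : ℝ) ^ (k - r) - (j : ℝ) ^ r * |c j|), rpow_pos_of_pos hj (k - r),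
    mul_pos (rpow_pos_of_pos hj (k - r)) (rpow_pos_of_pos hj r), abs_nonneg (c j),
    mul_nonneg (mul_pos (rpow_pos_of_pos hj (k - r)) (rpow_pos_of_pos hj r)).le (abs_nonneg (c j))]

/-- The sine series with coefficients `c`. -/
def sineSeries (c : ℕ+ → ℝ) (x : ℝ) : ℝ := ∑' j, c j * phi j x

theorem summable_mul_of_bounded {c e : ℕ+ → ℝ} (hc : Summable fun j => |c j|) (he : ∀ j, |e j| ≤ 1) :
    Summable fun j => c j * e j := by
  refine Summable.of_norm_bounded hc fun j => ?_
  rw [norm_mul, Real.norm_eq_abs, Real.norm_eq_abs]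
  exact mul_le_of_le_one_right (abs_nonneg _) (he j)

theorem hasSum_sineSeries {c : ℕ+ → ℝ} (hc : Summable fun j => |c j|) (x : ℝ) :
    HasSum (fun j => c j * phi j x) (sineSeries c x) :=
  (summable_mul_of_bounded hc fun j => abs_phi_le j x).hasSum

theorem sineCoeff_sineSeries {c : ℕ+ → ℝ} (hc : Summable fun j => |c j|) (j : ℕ+) :
    sineCoeff (sineSeries c) j = c j :=
  sineCoeff_of_hasSum hc (fun x _ => hasSum_sineSeries hc x) j

theorem continuous_series {e : ℕ+ → ℝ → ℝ} (he : ∀ j, Continuous (e j)) (hb : ∀ j x, |e j x| ≤ 1)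
    {c : ℕ+ → ℝ} (hc : Summable fun j => |c j|) : Continuous fun x => ∑' j, c j * e j x := by
  refine continuous_tsum (fun j => (he j).const_mul _) hc fun j x => ?_
  rw [norm_mul, Real.norm_eq_abs, Real.norm_eq_abs]
  exact mul_le_of_le_one_right (abs_nonneg _) (hb j x)

theorem hasDerivAt_series {e e' : ℕ+ → ℝ → ℝ} (he : ∀ j x, HasDerivAt (e j) ((j : ℝ) * e' j x) x)
    (hb : ∀ j x, |e j x| ≤ 1) (hb' : ∀ j x, |e' j x| ≤ 1)
    {c : ℕ+ → ℝ} (hc : Summable fun j => |c j|) (hc' : Summable fun j : ℕ+ => (j : ℝ) * |c j|) (x : ℝ) :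
    HasDerivAt (fun x => ∑' j, c j * e j x) (∑' j : ℕ+, (j : ℝ) * c j * e' j x) x := by
  refine hasDerivAt_tsum (g := fun j x => c j * e j x) (g' := fun j x => (j : ℝ) * c j * e' j x)
    hc' (fun j y => ?_) (fun j y => ?_) (y₀ := 0)
    (summable_mul_of_bounded hc fun j => hb j 0) x
  · exact ((he j y).const_mul (c j)).congr_deriv (by ring)
  · rw [norm_mul, norm_mul, Real.norm_eq_abs, Real.norm_eq_abs, Real.norm_eq_abs,
      abs_of_pos (pnat_cast_pos j)]
    exact mul_le_of_le_one_right (by positivity) (hb' j y)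

theorem hasDerivAt_sineSeries {c : ℕ+ → ℝ} (hc : Summable fun j => |c j|)
    (hc' : Summable fun j : ℕ+ => (j : ℝ) * |c j|) (x : ℝ) :
    HasDerivAt (sineSeries c) (∑' j : ℕ+, (j : ℝ) * c j * psi j x) x :=
  hasDerivAt_series hasDerivAt_phi abs_phi_le abs_psi_le hc hc' x

theorem hasDerivAt_deriv_sineSeries {c : ℕ+ → ℝ} (hc' : Summable fun j : ℕ+ => (j : ℝ) * |c j|)
    (hc'' : Summable fun j : ℕ+ => (j : ℝ) ^ 2 * |c j|) (x : ℝ) :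
    HasDerivAt (fun x => ∑' j : ℕ+, (j : ℝ) * c j * psi j x)
      (sineSeries (fun j => -((j : ℝ) ^ 2 * c j)) x) x := by
  have h := hasDerivAt_series (e := psi) (e' := fun j x => -phi j x) (c := fun j : ℕ+ => (j : ℝ) * c j)
    (fun j x => (hasDerivAt_psi j x).congr_deriv (by ring)) abs_psi_le
    (fun j x => by rw [abs_neg]; exact abs_phi_le j x)
    (by simpa [abs_mul] using hc') (by simpa [abs_mul, pow_two, mul_assoc] using hc'') x
  refine h.congr_deriv ?_
  unfold sineSeries
  exact tsum_congr fun j => by ring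

/-! ### Functions with twice differentiable sine series: derivatives and pairings. -/

/-- `f` is represented on `[0,π]` by a sine series whose coefficients satisfy `∑ j² |f_j| < ∞`. -/
structure IsSineRegular (f : ℝ → ℝ) : Prop where
  summable_zero : Summable fun j => |sineCoeff f j|
  summable_one : Summable fun j : ℕ+ => (j : ℝ) * |sineCoeff f j|
  summable_two : Summable fun j : ℕ+ => (j : ℝ) ^ 2 * |sineCoeff f j|
  eq_series : ∀ x ∈ Icc 0 π, f x = sineSeries (sineCoeff f) x

theorem MemHstar.summable_abs {r : ℝ} (hr : 1 / 2 < r) {f : ℝ → ℝ} (hf : MemHstar r f) :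
    Summable fun j => |sineCoeff f j| := by
  simpa using summable_rpow_mul_abs (k := 0) (by linarith) hf.1

theorem MemHstar.eq_sineSeries {r : ℝ} {f : ℝ → ℝ} (hf : MemHstar r f) {x : ℝ} (hx : x ∈ Icc 0 π) :
    f x = sineSeries (sineCoeff f) x := (hf.2 x hx).tsum_eq.symm

theorem MemHstar.isSineRegular {s : ℝ} (hs : 1 / 2 < s) {f : ℝ → ℝ} (hf : MemHstar (s + 2) f) :
    IsSineRegular f where
  summable_zero := hf.summable_abs (by linarith)
  summable_one := by simpa using summable_rpow_mul_abs (k := 1) (by linarith) hf.1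
  summable_two := by simpa using summable_rpow_mul_abs (k := 2) (by linarith) hf.1
  eq_series := fun _ hx => hf.eq_sineSeries hx

namespace IsSineRegular

variable {f : ℝ → ℝ}

theorem eventuallyEq (hf : IsSineRegular f) {x : ℝ} (hx : x ∈ Ioo 0 π) :
    f =ᶠ[𝓝 x] sineSeries (sineCoeff f) := by
  filter_upwards [Ioo_mem_nhds hx.1 hx.2] with y hy using hf.eq_series y (Ioo_subset_Icc_self hy)

theorem deriv_eq (hf : IsSineRegular f) {x : ℝ} (hx : x ∈ Ioo 0 π) :
    deriv f x = ∑' j : ℕ+, (j : ℝ) * sineCoeff f j * psi j x := by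
  rw [(hf.eventuallyEq hx).deriv_eq]
  exact (hasDerivAt_sineSeries hf.summable_zero hf.summable_one x).deriv

theorem iteratedDeriv_two_eq (hf : IsSineRegular f) {x : ℝ} (hx : x ∈ Ioo 0 π) :
    iteratedDeriv 2 f x = sineSeries (fun j => -((j : ℝ) ^ 2 * sineCoeff f j)) x := by
  rw [iteratedDeriv_succ, iteratedDeriv_one]
  have : deriv f =ᶠ[𝓝 x] fun x => ∑' j : ℕ+, (j : ℝ) * sineCoeff f j * psi j x := by
    filter_upwards [Ioo_mem_nhds hx.1 hx.2] with y hy using hf.deriv_eq hy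
  rw [this.deriv_eq]
  exact (hasDerivAt_deriv_sineSeries hf.summable_one hf.summable_two x).deriv

theorem hasSum_integral_mul (hf : IsSineRegular f) {g : ℝ → ℝ} (hg : Continuous g) :
    HasSum (fun j => sineCoeff f j * sineCoeff g j) (∫ x in (0 : ℝ)..π, f x * g x) := by
  have h := _root_.hasSum_integral_mul continuous_phi abs_phi_le hf.summable_zero hg
    (f := f) (fun x hx => by
      rw [hf.eq_series x (Ioo_subset_Icc_self hx)]; exact hasSum_sineSeries hf.summable_zero x)
  simpa only [sineCoeff, mul_comm] using h

theorem hasSum_integral_deriv_mul (hf : IsSineRegular f) {g : ℝ → ℝ} (hg : Continuous g) :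
    HasSum (fun j : ℕ+ => (j : ℝ) * sineCoeff f j * ∫ x in (0 : ℝ)..π, psi j x * g x)
      (∫ x in (0 : ℝ)..π, deriv f x * g x) := by
  have hc : Summable fun j : ℕ+ => |(j : ℝ) * sineCoeff f j| := by
    simpa [abs_mul] using hf.summable_one
  refine _root_.hasSum_integral_mul continuous_psi abs_psi_le hc hg fun x hx => ?_
  rw [hf.deriv_eq hx]
  exact (summable_mul_of_bounded hc fun j => abs_psi_le j x).hasSum

theorem hasSum_integral_iteratedDeriv_two_mul (hf : IsSineRegular f) {g : ℝ → ℝ} (hg : Continuous g) :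
    HasSum (fun j : ℕ+ => -((j : ℝ) ^ 2 * sineCoeff f j) * sineCoeff g j)
      (∫ x in (0 : ℝ)..π, iteratedDeriv 2 f x * g x) := by
  have hc : Summable fun j : ℕ+ => |-((j : ℝ) ^ 2 * sineCoeff f j)| := by
    simpa [abs_mul] using hf.summable_two
  have h := _root_.hasSum_integral_mul continuous_phi abs_phi_le hc hg
    (f := iteratedDeriv 2 f) (fun x hx => by
      rw [hf.iteratedDeriv_two_eq hx]; exact hasSum_sineSeries hc x)
  simpa only [sineCoeff, mul_comm] using h

end IsSineRegular

theorem integral_psi_mul_deriv {g g' : ℝ → ℝ} (hg : ∀ x, HasDerivAt g (g' x) x) (hg' : Continuous g')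
    (h0 : g 0 = 0) (hpi : g π = 0) (j : ℕ+) :
    ∫ x in (0 : ℝ)..π, psi j x * g' x = (j : ℝ) * sineCoeff g j := by
  have h := intervalIntegral.integral_mul_deriv_eq_deriv_mul (a := 0) (b := π) (u := psi j)
    (v := g) (u' := fun x => -((j : ℝ) * phi j x)) (v' := g')
    (fun x _ => hasDerivAt_psi j x) (fun x _ => hg x)
    ((by have := continuous_phi j; fun_prop : Continuous fun x => -((j : ℝ) * phi j x)).intervalIntegrable _ _)
    (hg'.intervalIntegrable _ _)
  rw [h, h0, hpi, sineCoeff, ← intervalIntegral.integral_const_mul]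
  simp only [mul_zero, sub_zero, zero_sub, ← intervalIntegral.integral_neg]
  exact intervalIntegral.integral_congr fun x _ => by ring

/-- Integration by parts with the boundary terms killed by `φ_j`, so `g` itself needs no boundary
condition. This is applied to first derivatives, whose natural expansion is in cosines. -/
theorem sineCoeff_deriv {g g' : ℝ → ℝ} (hg : ∀ x, HasDerivAt g (g' x) x) (hg' : Continuous g')
    (j : ℕ+) : sineCoeff g' j = -((j : ℝ) * ∫ x in (0 : ℝ)..π, psi j x * g x) := by
  have h := intervalIntegral.integral_mul_deriv_eq_deriv_mul (a := 0) (b := π) (u := phi j)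
    (v := g) (u' := fun x => (j : ℝ) * psi j x) (v' := g')
    (fun x _ => hasDerivAt_phi j x) (fun x _ => hg x)
    ((by have := continuous_psi j; fun_prop : Continuous fun x => (j : ℝ) * psi j x).intervalIntegrable _ _)
    (hg'.intervalIntegrable _ _)
  rw [phi_zero, phi_pi] at h
  simp only [zero_mul, sub_zero, zero_sub, mul_assoc, intervalIntegral.integral_const_mul] at h
  rw [← h, sineCoeff]
  simp only [mul_comm]

/-- This is Parseval for the cosine series of `f'` without orthogonality of cosines. One factor is
expanded termwise, the other is kept as a continuous function, and integrating by parts turns its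
cosine coefficients into `j f_j`. -/
theorem IsSineRegular.hasSum_integral_deriv_sq {f : ℝ → ℝ} (hf : IsSineRegular f) :
    HasSum (fun j : ℕ+ => (j : ℝ) ^ 2 * sineCoeff f j ^ 2) (∫ x in (0 : ℝ)..π, deriv f x ^ 2) := by
  have hcont : Continuous fun x => ∑' j : ℕ+, (j : ℝ) * sineCoeff f j * psi j x :=
    continuous_series continuous_psi abs_psi_le (by simpa [abs_mul] using hf.summable_one)
  have h := hf.hasSum_integral_deriv_mul hcont
  have h0 : sineSeries (sineCoeff f) 0 = 0 := by simp [sineSeries, phi_zero]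
  have hp : sineSeries (sineCoeff f) π = 0 := by simp [sineSeries, phi_pi]
  have h1 : ∀ j, ∫ x in (0 : ℝ)..π, psi j x * (∑' j : ℕ+, (j : ℝ) * sineCoeff f j * psi j x)
      = (j : ℝ) * sineCoeff f j := fun j => by
    rw [integral_psi_mul_deriv (hasDerivAt_sineSeries hf.summable_zero hf.summable_one) hcont h0 hp,
      sineCoeff_sineSeries hf.summable_zero]
  simp_rw [h1] at h
  convert h using 1
  · ext j; ring
  · refine intervalIntegral.integral_congr_ae ?_
    have hpi : ∀ᵐ x ∂(MeasureTheory.volume : MeasureTheory.Measure ℝ), x ≠ π := by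
      simp [MeasureTheory.ae_iff]
    filter_upwards [hpi] with x hx hx2
    rw [uIoc_of_le pi_pos.le] at hx2
    rw [hf.deriv_eq ⟨hx2.1, lt_of_le_of_ne hx2.2 hx⟩]
    ring

/-! ### Test functions and the du Bois-Reymond argument. -/

namespace IsTestFunction

variable {η : ℝ → ℝ}

theorem differentiable (hη : IsTestFunction η) : Differentiable ℝ η :=
  hη.1.differentiable (by simp)

theorem continuous (hη : IsTestFunction η) : Continuous η := hη.1.continuous

theorem deriv (hη : IsTestFunction η) : IsTestFunction (deriv η) := by
  refine ⟨?_, hη.2.1.deriv, tsupport_deriv_subset.trans hη.2.2⟩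
  exact ((contDiff_infty_iff_deriv).1 hη.1).2

theorem hasDerivAt (hη : IsTestFunction η) (x : ℝ) : HasDerivAt η (_root_.deriv η x) x :=
  (hη.differentiable x).hasDerivAt

theorem apply_zero (hη : IsTestFunction η) : η 0 = 0 :=
  image_eq_zero_of_notMem_tsupport fun h => lt_irrefl _ (hη.2.2 h).1

theorem apply_pi (hη : IsTestFunction η) : η π = 0 :=
  image_eq_zero_of_notMem_tsupport fun h => lt_irrefl _ (hη.2.2 h).2

theorem sineCoeff_iteratedDeriv_two (hη : IsTestFunction η) (j : ℕ+) :
    sineCoeff (iteratedDeriv 2 η) j = -((j : ℝ) ^ 2 * sineCoeff η j) := by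
  rw [iteratedDeriv_succ, iteratedDeriv_one, sineCoeff_deriv hη.deriv.hasDerivAt
    hη.deriv.deriv.continuous, integral_psi_mul_deriv hη.hasDerivAt hη.deriv.continuous
    hη.apply_zero hη.apply_pi]
  ring

theorem continuous_iteratedDeriv_two (hη : IsTestFunction η) : Continuous (iteratedDeriv 2 η) := by
  rw [iteratedDeriv_succ, iteratedDeriv_one]
  exact hη.deriv.deriv.continuous

end IsTestFunction

theorem exists_abs_sineCoeff_le {g : ℝ → ℝ} (hg : Continuous g) : ∃ C, ∀ j, |sineCoeff g j| ≤ C := by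
  refine ⟨|∫ x in (0 : ℝ)..π, ‖g x‖|, fun j => ?_⟩
  refine intervalIntegral.norm_integral_le_abs_of_norm_le (f := fun x => g x * phi j x)
    (Eventually.of_forall fun x => ?_) (hg.norm.intervalIntegrable _ _)
  rw [norm_mul]
  exact mul_le_of_le_one_right (norm_nonneg _) (abs_phi_le j x)

/-- Decay `j⁻²` is what a pairing with `H^{s-2}` needs: against coefficients weighted by `j^{s-2}`
there remains `j^{-s}`, square-summable for `s > 1/2`. -/
theorem IsTestFunction.exists_sq_mul_abs_sineCoeff_le {η : ℝ → ℝ} (hη : IsTestFunction η) :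
    ∃ C, ∀ j : ℕ+, (j : ℝ) ^ 2 * |sineCoeff η j| ≤ C := by
  obtain ⟨C, hC⟩ := exists_abs_sineCoeff_le hη.continuous_iteratedDeriv_two
  refine ⟨C, fun j => ?_⟩
  have := hC j
  rwa [hη.sineCoeff_iteratedDeriv_two, abs_neg, abs_mul, abs_of_pos (by have := pnat_cast_pos j; positivity)] at this

/-- A test function on `(0,π)` with zero mean has a primitive that is a test function. -/
theorem IsTestFunction.exists_primitive {ξ : ℝ → ℝ} (hξ : IsTestFunction ξ)
    (h0 : ∫ x in (0 : ℝ)..π, ξ x = 0) :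
    ∃ η, IsTestFunction η ∧ ∀ x, HasDerivAt η (ξ x) x := by
  have hd : ∀ x, HasDerivAt (fun x => ∫ y in (0 : ℝ)..x, ξ y) (ξ x) x := fun x =>
    intervalIntegral.integral_hasDerivAt_right (hξ.continuous.intervalIntegrable _ _)
      hξ.continuous.stronglyMeasurable.stronglyMeasurableAtFilter hξ.continuous.continuousAt
  have hsm : ContDiff ℝ (⊤ : ℕ∞) (fun x => ∫ y in (0 : ℝ)..x, ξ y) := by
    rw [contDiff_infty_iff_deriv]
    refine ⟨fun x => (hd x).differentiableAt, ?_⟩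
    have : _root_.deriv (fun x => ∫ y in (0 : ℝ)..x, ξ y) = ξ := funext fun x => (hd x).deriv
    rw [this]
    exact hξ.1
  obtain ⟨a, b, ha, hb, hab⟩ : ∃ a b : ℝ, 0 < a ∧ b < π ∧ tsupport ξ ⊆ Icc a b := by
    rcases (tsupport ξ).eq_empty_or_nonempty with he | hne
    · exact ⟨1, 1, one_pos, by linarith [pi_gt_three], by simp [he]⟩
    · obtain ⟨a, ha⟩ := hξ.2.1.isCompact.exists_isLeast hne
      obtain ⟨b, hb⟩ := hξ.2.1.isCompact.exists_isGreatest hne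
      exact ⟨a, b, (hξ.2.2 ha.1).1, (hξ.2.2 hb.1).2, fun x hx => ⟨ha.2 hx, hb.2 hx⟩⟩
  have hzero : ∀ x, x ∉ Icc a b → ξ x = 0 := fun x hx =>
    image_eq_zero_of_notMem_tsupport fun h => hx (hab h)
  -- To the left of `a` the integrand vanishes; to the right of `b` the primitive is the total
  -- integral minus a vanishing tail, and the total integral is zero.
  have hsupp : Function.support (fun x => ∫ y in (0 : ℝ)..x, ξ y) ⊆ Icc a b := by
    intro x hx
    by_contra hx2
    apply hx
    rw [mem_Icc, not_and_or, not_le, not_le] at hx2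
    rcases hx2 with h | h
    · have : ∀ y ∈ uIcc 0 x, ξ y = 0 := fun y hy => hzero y fun hy2 => by
        have := hy.2.trans (sup_le ha.le h.le)
        rcases hy.2.lt_or_eq with h3 | h3
        · exact absurd hy2.1 (not_le.2 (h3.trans_le (sup_le ha.le h.le)))
        · rw [h3] at hy2
          exact absurd hy2.1 (not_le.2 (sup_lt_iff.2 ⟨ha, h⟩))
      simp only
      rw [intervalIntegral.integral_congr this]
      simp
    · have : ∀ y ∈ uIcc x π, ξ y = 0 := fun y hy => hzero y fun hy2 =>
        absurd hy2.2 (not_le.2 ((lt_inf_iff.2 ⟨h, hb⟩).trans_le hy.1))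
      have h3 : ∫ y in x..π, ξ y = 0 := by
        rw [intervalIntegral.integral_congr this]; simp
      have h4 := intervalIntegral.integral_add_adjacent_intervals
        (hξ.continuous.intervalIntegrable (μ := MeasureTheory.volume) 0 x)
        (hξ.continuous.intervalIntegrable x π)
      simpa [h3, h0] using h4
  have hts : tsupport (fun x => ∫ y in (0 : ℝ)..x, ξ y) ⊆ Icc a b :=
    closure_minimal hsupp isClosed_Icc
  exact ⟨_, ⟨hsm, HasCompactSupport.of_support_subset_isCompact isCompact_Icc hsupp,
    hts.trans fun x hx => ⟨ha.trans_le hx.1, hx.2.trans_lt hb⟩⟩, hd⟩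

theorem exists_testFunction_integral_eq_one :
    ∃ ρ, IsTestFunction ρ ∧ ∫ x in (0 : ℝ)..π, ρ x = 1 := by
  have hpi := pi_gt_three
  let f : ContDiffBump (1 : ℝ) := ⟨1 / 4, 1 / 2, by norm_num, by norm_num⟩
  have hts : tsupport (f.normed MeasureTheory.volume) ⊆ Ioo 0 π := by
    rw [f.tsupport_normed_eq, Real.closedBall_eq_Icc]
    intro x hx
    have h1 : (1 : ℝ) - 1 / 2 ≤ x := hx.1
    have h2 : x ≤ (1 : ℝ) + 1 / 2 := hx.2
    constructor <;> linarith
  refine ⟨f.normed MeasureTheory.volume, ⟨f.contDiff_normed, f.hasCompactSupport_normed, hts⟩, ?_⟩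
  refine (intervalIntegral.integral_eq_integral_of_support_subset ?_).trans
    (f.integral_normed (μ := MeasureTheory.volume))
  exact (subset_tsupport _).trans (hts.trans Ioo_subset_Ioc_self)

theorem IsTestFunction.sub_const_mul {ξ ρ : ℝ → ℝ} (hξ : IsTestFunction ξ) (hρ : IsTestFunction ρ)
    (c : ℝ) : IsTestFunction (fun x => ξ x - c * ρ x) := by
  have hs : tsupport (fun x => ξ x - c * ρ x) ⊆ tsupport ξ ∪ tsupport ρ := by
    refine closure_minimal (fun x hx => ?_) ((isClosed_tsupport _).union (isClosed_tsupport _))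
    by_contra h
    rw [mem_union, not_or] at h
    exact hx (by simp [image_eq_zero_of_notMem_tsupport h.1, image_eq_zero_of_notMem_tsupport h.2])
  refine ⟨hξ.1.sub (contDiff_const.mul hρ.1), ?_, hs.trans (union_subset hξ.2.2 hρ.2.2)⟩
  exact (hξ.2.1.isCompact.union hρ.2.1.isCompact).of_isClosed_subset (isClosed_tsupport _) hs

/-- If `∫ W η' = 0` for all test functions, then `∫ W ξ = c ∫ ξ` for all test functions. -/
theorem exists_const_of_integral_mul_deriv_eq_zero {L : (ℝ → ℝ) → ℝ}
    (hL : ∀ ξ ρ c, IsTestFunction ξ → IsTestFunction ρ → L (fun x => ξ x - c * ρ x) = L ξ - c * L ρ)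
    (h : ∀ η η', IsTestFunction η → (∀ x, HasDerivAt η (η' x) x) → L η' = 0) :
    ∃ c, ∀ ξ, IsTestFunction ξ → L ξ = c * ∫ x in (0 : ℝ)..π, ξ x := by
  obtain ⟨ρ, hρ, hρ1⟩ := exists_testFunction_integral_eq_one
  refine ⟨L ρ, fun ξ hξ => ?_⟩
  -- Subtracting the multiple of `ρ` with the same integral leaves a function of zero mean, which is
  -- the derivative of a test function.
  have hz : ∫ x in (0 : ℝ)..π, (ξ x - (∫ x in (0 : ℝ)..π, ξ x) * ρ x) = 0 := by
    rw [intervalIntegral.integral_sub (hξ.continuous.intervalIntegrable _ _)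
      ((hρ.continuous.const_mul _).intervalIntegrable _ _), intervalIntegral.integral_const_mul, hρ1]
    ring
  obtain ⟨η, hη, hd⟩ := (hξ.sub_const_mul hρ (∫ x in (0 : ℝ)..π, ξ x)).exists_primitive hz
  have := h η _ hη hd
  rw [hL _ _ _ hξ hρ] at this
  linarith

/-- A continuous function on `[0,π]` with vanishing second distributional derivative and zero
boundary values vanishes. -/
theorem eq_zero_of_integral_mul_iteratedDeriv_two {w : ℝ → ℝ} (hw : Continuous w) (h0 : w 0 = 0)
    (hpi : w π = 0)
    (h : ∀ η, IsTestFunction η → ∫ x in (0 : ℝ)..π, w x * iteratedDeriv 2 η x = 0) :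
    ∀ x ∈ Icc 0 π, w x = 0 := by
  have hlin : ∀ f : ℝ → ℝ, Continuous f → ∀ ξ ρ c, IsTestFunction ξ → IsTestFunction ρ →
      ∫ x in (0 : ℝ)..π, f x * (ξ x - c * ρ x)
        = (∫ x in (0 : ℝ)..π, f x * ξ x) - c * ∫ x in (0 : ℝ)..π, f x * ρ x := by
    intro f hf ξ ρ c hξ hρ
    have h1 := hξ.continuous
    have h2 := hρ.continuous
    rw [← intervalIntegral.integral_const_mul, ← intervalIntegral.integral_sub
      ((by fun_prop : Continuous fun x => f x * ξ x).intervalIntegrable _ _)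
      ((by fun_prop : Continuous fun x => c * (f x * ρ x)).intervalIntegrable _ _)]
    exact intervalIntegral.integral_congr fun x _ => by ring
  -- first integration
  obtain ⟨c, hc⟩ := exists_const_of_integral_mul_deriv_eq_zero
    (L := fun ξ => ∫ x in (0 : ℝ)..π, w x * _root_.deriv ξ x)
    (fun ξ ρ c hξ hρ => by
      have : _root_.deriv (fun x => ξ x - c * ρ x) = fun x => _root_.deriv ξ x - c * _root_.deriv ρ x :=
        funext fun x => ((hξ.hasDerivAt x).sub ((hρ.hasDerivAt x).const_mul c)).deriv
      simp only [this]
      exact hlin w hw _ _ c hξ.deriv hρ.deriv)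
    (fun η η' hη hd => by
      obtain rfl : _root_.deriv η = η' := funext fun x => (hd x).deriv
      have := h η hη
      rwa [iteratedDeriv_succ, iteratedDeriv_one] at this)
  -- second integration
  have hw2 : Continuous fun x => w x + c * x := by fun_prop
  obtain ⟨d, hd⟩ := exists_const_of_integral_mul_deriv_eq_zero
    (L := fun ξ => ∫ x in (0 : ℝ)..π, (w x + c * x) * ξ x)
    (fun ξ ρ c' hξ hρ => hlin _ hw2 _ _ c' hξ hρ)
    (fun η η' hη hd => by
      obtain rfl : _root_.deriv η = η' := funext fun x => (hd x).deriv
      have h1 := hc η hη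
      have h2 := intervalIntegral.integral_mul_deriv_eq_deriv_mul (a := 0) (b := π)
        (u := fun x => c * x) (v := η) (u' := fun _ => c) (v' := _root_.deriv η)
        (fun x _ => by simpa using (hasDerivAt_id x).const_mul c) (fun x _ => hη.hasDerivAt x)
        (continuous_const.intervalIntegrable _ _) (hη.deriv.continuous.intervalIntegrable _ _)
      rw [hη.apply_zero, hη.apply_pi, intervalIntegral.integral_const_mul] at h2
      simp only [add_mul]
      have h3 := hη.deriv.continuous
      rw [intervalIntegral.integral_add
        ((by fun_prop : Continuous fun x => w x * _root_.deriv η x).intervalIntegrable _ _)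
        ((by fun_prop : Continuous fun x => c * x * _root_.deriv η x).intervalIntegrable _ _)]
      linarith)
  -- Fundamental lemma of the calculus of variations: `w + c x - d` annihilates all test functions,
  -- so it vanishes almost everywhere and, by continuity, everywhere on the open interval.
  have haff : ∀ x ∈ Ioo 0 π, w x + c * x = d := by
    have hae := IsOpen.ae_eq_zero_of_integral_contDiff_smul_eq_zero (μ := MeasureTheory.volume)
      (f := fun x => w x + c * x - d) (isOpen_Ioo (a := (0 : ℝ)) (b := π))
      ((hw2.sub continuous_const).locallyIntegrable.locallyIntegrableOn _)
      (fun g hg hgc hgs => by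
        have hgt : IsTestFunction g := ⟨hg, hgc, hgs⟩
        have h1 := hd g hgt
        have h2 : ∫ x, g x • (w x + c * x - d) = ∫ x in (0 : ℝ)..π, g x • (w x + c * x - d) := by
          refine (intervalIntegral.integral_eq_integral_of_support_subset fun x hx => ?_).symm
          refine Ioo_subset_Ioc_self (hgs (subset_tsupport _ fun h => hx ?_))
          simp [h]
        have h3 : ∫ x in (0 : ℝ)..π, g x • (w x + c * x - d)
            = (∫ x in (0 : ℝ)..π, (w x + c * x) * g x) - d * ∫ x in (0 : ℝ)..π, g x := by
          have h4 := hgt.continuous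
          rw [← intervalIntegral.integral_const_mul, ← intervalIntegral.integral_sub
            ((by fun_prop : Continuous fun x => (w x + c * x) * g x).intervalIntegrable _ _)
            ((by fun_prop : Continuous fun x => d * g x).intervalIntegrable _ _)]
          exact intervalIntegral.integral_congr fun x _ => by simp only [smul_eq_mul]; ring
        rw [h2, h3, h1, sub_self])
    have h1 : ∀ᵐ x ∂MeasureTheory.volume.restrict (Ioo (0 : ℝ) π), w x + c * x - d = 0 :=
      (MeasureTheory.ae_restrict_iff' measurableSet_Ioo).2 hae
    have h2 := MeasureTheory.Measure.eqOn_open_of_ae_eq (f := fun x => w x + c * x - d) (g := fun _ => 0)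
      h1 isOpen_Ioo (by fun_prop) (by fun_prop)
    intro x hx
    have := h2 hx
    simp only at this
    linarith
  have hcl : ∀ x ∈ Icc 0 π, w x + c * x = d := by
    have : closure (Ioo 0 π) ⊆ {x | w x + c * x = d} :=
      closure_minimal haff (isClosed_eq hw2 continuous_const)
    rwa [closure_Ioo pi_pos.ne] at this
  -- The boundary values remove the two constants left by the double integration.
  have hd0 := hcl 0 ⟨le_rfl, pi_pos.le⟩
  have hdp := hcl π ⟨pi_pos.le, le_rfl⟩
  rw [h0] at hd0
  rw [hpi] at hdp
  have hc0 : c = 0 := by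
    have : c * π = 0 := by linarith
    exact (mul_eq_zero.1 this).resolve_right pi_ne_zero
  intro x hx
  have := hcl x hx
  rw [hc0] at this hd0
  linarith

/-- A sequence with `∑ |g_j| / j² < ∞` that annihilates the sine coefficients of all test functions
vanishes. -/
theorem eq_zero_of_hasSum_sineCoeff {g : ℕ+ → ℝ} (hg : Summable fun j : ℕ+ => |g j / (j : ℝ) ^ 2|)
    (h : ∀ η, IsTestFunction η → HasSum (fun j => g j * sineCoeff η j) 0) (j : ℕ+) : g j = 0 := by
  have hj : (j : ℝ) ^ 2 ≠ 0 := by have := pnat_cast_pos j; positivity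
  -- Division by `j²` inverts `-d²/dx²` with Dirichlet conditions. The resulting series is
  -- continuous, and its pairing with `η''` is minus the pairing of `g` with `η`.
  have hw := eq_zero_of_integral_mul_iteratedDeriv_two
    (w := sineSeries fun j => g j / (j : ℝ) ^ 2) (continuous_series continuous_phi abs_phi_le hg)
    (by simp [sineSeries, phi_zero]) (by simp [sineSeries, phi_pi]) (fun η hη => by
      have h1 := hasSum_integral_mul continuous_phi abs_phi_le hg hη.continuous_iteratedDeriv_two
        (fun x _ => hasSum_sineSeries hg x)
      refine h1.unique ?_
      have h2 := (h η hη).neg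
      rw [neg_zero] at h2
      suffices h3 : (fun k : ℕ+ => g k / (k : ℝ) ^ 2 * ∫ x in (0 : ℝ)..π, phi k x * iteratedDeriv 2 η x)
          = fun k => -(g k * sineCoeff η k) by rw [h3]; exact h2
      funext k
      have hk : (k : ℝ) ^ 2 ≠ 0 := by have := pnat_cast_pos k; positivity
      have h3 := hη.sineCoeff_iteratedDeriv_two k
      have h4 : ∫ x in (0 : ℝ)..π, phi k x * iteratedDeriv 2 η x = sineCoeff (iteratedDeriv 2 η) k := by
        simp only [sineCoeff, mul_comm]
      rw [h4, h3]
      field_simp)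
  have h2 := sineCoeff_sineSeries hg j
  have h3 : sineCoeff (sineSeries fun j => g j / (j : ℝ) ^ 2) j = 0 := by
    rw [sineCoeff, intervalIntegral.integral_congr (g := fun _ => 0)]
    · simp
    · intro x hx
      rw [uIcc_of_le pi_pos.le] at hx
      simp [hw x hx]
  rw [h3] at h2
  exact (div_eq_zero_iff.1 h2.symm).resolve_right hj

/-! ### Normal form: quartic corrections that remove the resonance-free terms. -/

/-- For the flow `u' = α p, p' = -α u` and a second oscillator `(v, q)` of frequency `β ≠ α`, the
polynomial with derivative `u p v²`. -/
def pairCorrection (α β u p v q : ℝ) : ℝ :=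
  ((v ^ 2 + q ^ 2) * (u ^ 2 - p ^ 2) * (1 / (2 * α))
    + (α * (u ^ 2 - p ^ 2) * (v ^ 2 - q ^ 2) + β * (2 * u * p) * (2 * v * q))
      * (1 / (2 * (α ^ 2 - β ^ 2)))) / 4

/-- For the flow `u' = α p, p' = -α u`, a polynomial with derivative `u³ p`. -/
def selfCorrection (α u p : ℝ) : ℝ :=
  ((u ^ 2 + p ^ 2) * (u ^ 2 - p ^ 2) * (1 / (2 * α)) + (u ^ 2 - p ^ 2) ^ 2 * (1 / (4 * α))) / 4

theorem abs_sq_sub_sq_le (u p : ℝ) : |u ^ 2 - p ^ 2| ≤ u ^ 2 + p ^ 2 := by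
  rw [abs_le]; constructor <;> nlinarith [sq_nonneg u, sq_nonneg p]

theorem abs_two_mul_mul_le (u p : ℝ) : |2 * u * p| ≤ u ^ 2 + p ^ 2 := by
  rw [abs_le]; constructor <;> nlinarith [sq_nonneg (u - p), sq_nonneg (u + p)]

/-- The divisor factors as `α² - β² = (α + β)(α - β)`. In `pairCorrection` the numerator carries a
factor `α` or `β`, which pays for `α + β`, so only the gap `|α - β|` matters and the bound is
uniform in large frequencies. -/
theorem abs_add_mul_sub_inv {α β μ : ℝ} (hα : 0 < α) (hβ : 0 < β) (hμ : 0 < μ)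
    (hgap : μ / 2 ≤ |α - β|) :
    α ^ 2 - β ^ 2 ≠ 0 ∧ (α + β) * |1 / (2 * (α ^ 2 - β ^ 2))| ≤ 1 / μ := by
  have h1 : 0 < |α - β| := by linarith
  have h2 : α ^ 2 - β ^ 2 = (α + β) * (α - β) := by ring
  have h3 : α - β ≠ 0 := abs_pos.1 h1
  have h4 : 0 < α + β := by linarith
  refine ⟨by rw [h2]; exact mul_ne_zero h4.ne' h3, ?_⟩
  rw [h2, abs_div, abs_mul, abs_mul, abs_one, abs_two, abs_of_pos h4]
  rw [show (α + β) * (1 / (2 * ((α + β) * |α - β|))) = 1 / (2 * |α - β|) by field_simp]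
  exact one_div_le_one_div_of_le hμ (by linarith)

theorem one_div_two_mul_le {α μ : ℝ} (hμ : 0 < μ) (hα : μ ≤ 2 * α) : 1 / (2 * α) ≤ 1 / μ :=
  one_div_le_one_div_of_le hμ hα

theorem abs_pairCorrection_le {α β μ : ℝ} (hμ : 0 < μ) (hα : μ ≤ 2 * α) (hβ : μ ≤ 2 * β)
    (hgap : μ / 2 ≤ |α - β|) (u p v q : ℝ) :
    |pairCorrection α β u p v q| ≤ (u ^ 2 + p ^ 2) * (v ^ 2 + q ^ 2) / (2 * μ) := by
  have hα0 : 0 < α := by linarith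
  have hβ0 : 0 < β := by linarith
  obtain ⟨-, hδ⟩ := abs_add_mul_sub_inv hα0 hβ0 hμ hgap
  have hκ := one_div_two_mul_le hμ hα
  have hκ0 : 0 < 1 / (2 * α) := by positivity
  set κ := 1 / (2 * α)
  set δ := 1 / (2 * (α ^ 2 - β ^ 2))
  set D := 1 / μ with hD
  have hX := abs_sq_sub_sq_le u p
  have hX' := abs_sq_sub_sq_le v q
  have hY := abs_two_mul_mul_le u p
  have hY' := abs_two_mul_mul_le v q
  rw [pairCorrection]
  set X := u ^ 2 - p ^ 2
  set X' := v ^ 2 - q ^ 2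
  set Y := 2 * u * p
  set Y' := 2 * v * q
  have hI : 0 ≤ u ^ 2 + p ^ 2 := by positivity
  have hI' : 0 ≤ v ^ 2 + q ^ 2 := by positivity
  set A := u ^ 2 + p ^ 2
  set B := v ^ 2 + q ^ 2
  have h1 : |B * X * κ| ≤ A * B * D := by
    rw [abs_mul, abs_mul, abs_of_nonneg hI', abs_of_pos hκ0]
    calc B * |X| * κ ≤ B * A * D := by gcongr
      _ = A * B * D := by ring
  have h2 : |α * X * X' + β * Y * Y'| ≤ (α + β) * (A * B) := by
    refine (abs_add_le _ _).trans ?_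
    rw [abs_mul, abs_mul, abs_mul, abs_mul, abs_of_pos hα0, abs_of_pos hβ0]
    calc α * |X| * |X'| + β * |Y| * |Y'| ≤ α * A * B + β * A * B := by gcongr
      _ = (α + β) * (A * B) := by ring
  have h3 : |(α * X * X' + β * Y * Y') * δ| ≤ A * B * D := by
    rw [abs_mul]
    calc |α * X * X' + β * Y * Y'| * |δ| ≤ (α + β) * (A * B) * |δ| := by gcongr
      _ = A * B * ((α + β) * |δ|) := by ring
      _ ≤ A * B * D := by gcongr
  rw [abs_div, abs_of_pos (by norm_num : (0 : ℝ) < 4)]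
  have h4 := (abs_add_le (B * X * κ) ((α * X * X' + β * Y * Y') * δ)).trans (add_le_add h1 h3)
  rw [show A * B / (2 * μ) = (A * B * D + A * B * D) / 4 by rw [hD]; field_simp; ring]
  gcongr

theorem abs_selfCorrection_le {α μ : ℝ} (hμ : 0 < μ) (hα : μ ≤ 2 * α) (u p : ℝ) :
    |selfCorrection α u p| ≤ (u ^ 2 + p ^ 2) * (u ^ 2 + p ^ 2) / (2 * μ) := by
  have hα0 : 0 < α := by linarith
  have hκ := one_div_two_mul_le hμ hα
  have hκ0 : 0 < 1 / (2 * α) := by positivity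
  have h4 : 1 / (4 * α) = 1 / (2 * α) / 2 := by field_simp; norm_num
  rw [selfCorrection, h4]
  set κ := 1 / (2 * α)
  set D := 1 / μ with hD
  have hX := abs_sq_sub_sq_le u p
  set X := u ^ 2 - p ^ 2
  have hI : 0 ≤ u ^ 2 + p ^ 2 := by positivity
  set A := u ^ 2 + p ^ 2
  have h1 : |A * X * κ| ≤ A * A * D := by
    rw [abs_mul, abs_mul, abs_of_nonneg hI, abs_of_pos hκ0]
    gcongr
  have h2 : |X ^ 2 * (κ / 2)| ≤ A * A * D := by
    rw [abs_mul, abs_pow, abs_of_pos (half_pos hκ0), pow_two]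
    calc |X| * |X| * (κ / 2) ≤ A * A * (D / 1) := by gcongr; norm_num
      _ = A * A * D := by ring
  rw [abs_div, abs_of_pos (by norm_num : (0 : ℝ) < 4)]
  have h3 := (abs_add_le (A * X * κ) (X ^ 2 * (κ / 2))).trans (add_le_add h1 h2)
  rw [show A * A / (2 * μ) = (A * A * D + A * A * D) / 4 by rw [hD]; field_simp; ring]
  gcongr

section Derivatives

variable {u p v q : ℝ → ℝ} {α β γ γ' μ t : ℝ}

/-- The double-angle quantities `u² - p²` and `2up` rotate with frequency `2α` and `u² + p²` is
conserved, up to terms with the factor `γ`; here `γ` stands for the extra stiffness due to the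
coupling. -/
theorem hasDerivAt_sq_sub_sq (hu : HasDerivAt u (α * p t) t)
    (hp : HasDerivAt p (-(α * u t) - γ * u t) t) :
    HasDerivAt (fun t => u t ^ 2 - p t ^ 2) (2 * α * (2 * u t * p t) + γ * (2 * u t * p t)) t :=
  ((hu.pow 2).sub (hp.pow 2)).congr_deriv (by push_cast; ring)

theorem hasDerivAt_sq_add_sq (hu : HasDerivAt u (α * p t) t)
    (hp : HasDerivAt p (-(α * u t) - γ * u t) t) :
    HasDerivAt (fun t => u t ^ 2 + p t ^ 2) (-γ * (2 * u t * p t)) t :=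
  ((hu.pow 2).add (hp.pow 2)).congr_deriv (by push_cast; ring)

theorem hasDerivAt_two_mul_mul (hu : HasDerivAt u (α * p t) t)
    (hp : HasDerivAt p (-(α * u t) - γ * u t) t) :
    HasDerivAt (fun t => 2 * u t * p t) (-2 * α * (u t ^ 2 - p t ^ 2) - γ * (2 * u t ^ 2)) t :=
  ((hu.const_mul 2).mul hp).congr_deriv (by ring)

/-- With `X = u² - p²`, `Y = 2up`, `B = v² + q²`, and `X'`, `Y'` the analogues of `X`, `Y` for `(v,
q)`, one has `u p v² = (B Y + X' Y)/4`. Along the linear flow `B Y` is the derivative of `B X /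
(2α)`, and `αXX' + βYY'` has derivative `2(α² - β²) X' Y`, its mixed terms cancelling. What remains
is linear in `γ` and `γ'`. -/
theorem hasDerivAt_pairCorrection (hμ : 0 < μ) (hα : μ ≤ 2 * α) (hβ : μ ≤ 2 * β)
    (hgap : μ / 2 ≤ |α - β|) (hγ : 0 ≤ γ) (hγ' : 0 ≤ γ')
    (hu : HasDerivAt u (α * p t) t) (hp : HasDerivAt p (-(α * u t) - γ * u t) t)
    (hv : HasDerivAt v (β * q t) t) (hq : HasDerivAt q (-(β * v t) - γ' * v t) t) :
    ∃ e, HasDerivAt (fun t => pairCorrection α β (u t) (p t) (v t) (q t))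
        (u t * p t * v t ^ 2 + e) t ∧
      |e| ≤ (γ + γ') * ((u t ^ 2 + p t ^ 2) * (v t ^ 2 + q t ^ 2)) / μ := by
  have hα0 : 0 < α := by linarith
  have hβ0 : 0 < β := by linarith
  obtain ⟨hne, hδ⟩ := abs_add_mul_sub_inv hα0 hβ0 hμ hgap
  have hκ := one_div_two_mul_le hμ hα
  have hκ0 : 0 < 1 / (2 * α) := by positivity
  have hX := hasDerivAt_sq_sub_sq hu hp
  have hY := hasDerivAt_two_mul_mul hu hp
  have hX' := hasDerivAt_sq_sub_sq hv hq
  have hY' := hasDerivAt_two_mul_mul hv hq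
  have hI' := hasDerivAt_sq_add_sq hv hq
  have hd := (((hI'.mul hX).mul_const (1 / (2 * α))).add
    ((((hX.const_mul α).mul hX').add ((hY.const_mul β).mul hY')).mul_const
      (1 / (2 * (α ^ 2 - β ^ 2))))).div_const 4
  refine ⟨((-γ' * (2 * v t * q t) * (u t ^ 2 - p t ^ 2)
      + (v t ^ 2 + q t ^ 2) * (γ * (2 * u t * p t))) * (1 / (2 * α))
    + (α * (γ * (2 * u t * p t)) * (v t ^ 2 - q t ^ 2) + α * (u t ^ 2 - p t ^ 2) * (γ' * (2 * v t * q t))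
      - β * (γ * (2 * u t ^ 2)) * (2 * v t * q t) - β * (2 * u t * p t) * (γ' * (2 * v t ^ 2)))
      * (1 / (2 * (α ^ 2 - β ^ 2)))) / 4, hd.congr_deriv ?_, ?_⟩
  · field_simp
    ring
  · set κ := 1 / (2 * α)
    set δ := 1 / (2 * (α ^ 2 - β ^ 2))
    set D := 1 / μ with hD
    have bX := abs_sq_sub_sq_le (u t) (p t)
    have bX' := abs_sq_sub_sq_le (v t) (q t)
    have bY := abs_two_mul_mul_le (u t) (p t)
    have bY' := abs_two_mul_mul_le (v t) (q t)
    have bZ : 2 * u t ^ 2 ≤ 2 * (u t ^ 2 + p t ^ 2) := by nlinarith [sq_nonneg (p t)]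
    have bZ' : 2 * v t ^ 2 ≤ 2 * (v t ^ 2 + q t ^ 2) := by nlinarith [sq_nonneg (q t)]
    have hZ : 0 ≤ 2 * u t ^ 2 := by positivity
    have hZ' : 0 ≤ 2 * v t ^ 2 := by positivity
    have hA : 0 ≤ u t ^ 2 + p t ^ 2 := by positivity
    have hB : 0 ≤ v t ^ 2 + q t ^ 2 := by positivity
    set X := u t ^ 2 - p t ^ 2
    set X' := v t ^ 2 - q t ^ 2
    set Y := 2 * u t * p t
    set Y' := 2 * v t * q t
    set A := u t ^ 2 + p t ^ 2
    set B := v t ^ 2 + q t ^ 2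
    set Z := 2 * u t ^ 2
    set Z' := 2 * v t ^ 2
    clear hd hX hY hX' hY' hI'
    clear_value X X' Y Y' Z Z' A B
    have h1 : |(-γ' * Y' * X + B * (γ * Y)) * κ| ≤ (γ + γ') * (A * B) * D := by
      rw [abs_mul, abs_of_pos hκ0]
      have : |-γ' * Y' * X + B * (γ * Y)| ≤ (γ + γ') * (A * B) := by
        refine (abs_add_le _ _).trans ?_
        rw [abs_mul, abs_mul, abs_neg, abs_mul, abs_mul, abs_of_nonneg hγ, abs_of_nonneg hγ',
          abs_of_nonneg hB]
        calc γ' * |Y'| * |X| + B * (γ * |Y|) ≤ γ' * B * A + B * (γ * A) := by gcongr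
          _ = (γ + γ') * (A * B) := by ring
      gcongr
    have h2 : |α * (γ * Y) * X' + α * X * (γ' * Y') - β * (γ * Z) * Y' - β * Y * (γ' * Z')|
        ≤ 2 * (α + β) * ((γ + γ') * (A * B)) := by
      have e1 : |α * (γ * Y) * X'| ≤ α * (γ * A) * B := by
        rw [abs_mul, abs_mul, abs_mul, abs_of_nonneg hγ, abs_of_pos hα0]; gcongr
      have e2 : |α * X * (γ' * Y')| ≤ α * A * (γ' * B) := by
        rw [abs_mul, abs_mul, abs_mul, abs_of_nonneg hγ', abs_of_pos hα0]; gcongr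
      have e3 : |β * (γ * Z) * Y'| ≤ β * (γ * (2 * A)) * B := by
        rw [abs_mul, abs_mul, abs_mul, abs_of_nonneg hγ, abs_of_pos hβ0, abs_of_nonneg hZ]; gcongr
      have e4 : |β * Y * (γ' * Z')| ≤ β * A * (γ' * (2 * B)) := by
        rw [abs_mul, abs_mul, abs_mul, abs_of_nonneg hγ', abs_of_pos hβ0, abs_of_nonneg hZ']; gcongr
      have e5 : 0 ≤ α * (γ + γ') * (A * B) := by positivity
      calc _ ≤ |α * (γ * Y) * X'| + |α * X * (γ' * Y')| + |β * (γ * Z) * Y'| + |β * Y * (γ' * Z')| := by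
            refine (abs_sub _ _).trans (add_le_add_left ((abs_sub _ _).trans (add_le_add_left (abs_add_le _ _) _)) _)
        _ ≤ α * (γ * A) * B + α * A * (γ' * B) + β * (γ * (2 * A)) * B + β * A * (γ' * (2 * B)) := by
            gcongr
        _ ≤ _ := by linarith
    have h3 : |(α * (γ * Y) * X' + α * X * (γ' * Y') - β * (γ * Z) * Y' - β * Y * (γ' * Z')) * δ|
        ≤ 2 * ((γ + γ') * (A * B)) * D := by
      rw [abs_mul]
      calc _ ≤ 2 * (α + β) * ((γ + γ') * (A * B)) * |δ| := by gcongr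
        _ = 2 * ((γ + γ') * (A * B)) * ((α + β) * |δ|) := by ring
        _ ≤ _ := by gcongr
    rw [abs_div, abs_of_pos (by norm_num : (0 : ℝ) < 4), div_le_iff₀ (by norm_num)]
    refine (abs_add_le _ _).trans ((add_le_add h1 h3).trans ?_)
    have h5 : 0 ≤ (γ + γ') * (A * B) * D := by positivity
    rw [div_eq_mul_one_div _ μ, ← hD]
    -- The two groups of terms contribute `1` and `2` units, and `(1 + 2)/4 ≤ 1`.
    linarith

/-- The pair formula degenerates at `α = β`, but here `u³ p = (A Y + X Y)/4` with `A = u² + p²`, and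
`X Y` is the derivative of `X²/(4α)` along the linear flow. There is no resonance. -/
theorem hasDerivAt_selfCorrection (hμ : 0 < μ) (hα : μ ≤ 2 * α) (hγ : 0 ≤ γ)
    (hu : HasDerivAt u (α * p t) t) (hp : HasDerivAt p (-(α * u t) - γ * u t) t) :
    ∃ e, HasDerivAt (fun t => selfCorrection α (u t) (p t)) (u t * p t * u t ^ 2 + e) t ∧
      |e| ≤ (γ + γ) * ((u t ^ 2 + p t ^ 2) * (u t ^ 2 + p t ^ 2)) / μ := by
  have hα0 : 0 < α := by linarith
  have hκ := one_div_two_mul_le hμ hα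
  have hκ0 : 0 < 1 / (2 * α) := by positivity
  have hX := hasDerivAt_sq_sub_sq hu hp
  have hI := hasDerivAt_sq_add_sq hu hp
  have hd := (((hI.mul hX).mul_const (1 / (2 * α))).add ((hX.pow 2).mul_const (1 / (4 * α)))).div_const 4
  refine ⟨((-γ * (2 * u t * p t)) * (u t ^ 2 - p t ^ 2) + (u t ^ 2 + p t ^ 2) * (γ * (2 * u t * p t))
    + (u t ^ 2 - p t ^ 2) * (γ * (2 * u t * p t))) * (1 / (2 * α)) / 4, hd.congr_deriv ?_, ?_⟩
  · push_cast
    field_simp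
    ring
  · set κ := 1 / (2 * α)
    set D := 1 / μ with hD
    have bX := abs_sq_sub_sq_le (u t) (p t)
    have bY := abs_two_mul_mul_le (u t) (p t)
    have hA : 0 ≤ u t ^ 2 + p t ^ 2 := by positivity
    set X := u t ^ 2 - p t ^ 2
    set Y := 2 * u t * p t
    set A := u t ^ 2 + p t ^ 2
    clear hd hX hI
    clear_value X Y A
    have h1 : |-γ * Y * X + A * (γ * Y) + X * (γ * Y)| ≤ 4 * ((γ + γ) * (A * A)) := by
      have e1 : |-γ * Y * X| ≤ γ * A * A := by
        rw [abs_mul, abs_mul, abs_neg, abs_of_nonneg hγ]; gcongr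
      have e2 : |A * (γ * Y)| ≤ A * (γ * A) := by
        rw [abs_mul, abs_mul, abs_of_nonneg hγ, abs_of_nonneg hA]; gcongr
      have e3 : |X * (γ * Y)| ≤ A * (γ * A) := by
        rw [abs_mul, abs_mul, abs_of_nonneg hγ]; gcongr
      have e4 : 0 ≤ γ * (A * A) := by positivity
      refine (abs_add_le _ _).trans ((add_le_add_left (abs_add_le _ _) _).trans ?_)
      linarith
    rw [abs_div, abs_of_pos (by norm_num : (0 : ℝ) < 4), div_le_iff₀ (by norm_num), abs_mul,
      abs_of_pos hκ0, div_eq_mul_one_div _ μ, ← hD]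
    calc _ ≤ 4 * ((γ + γ) * (A * A)) * D := by gcongr
      _ = _ := by ring

end Derivatives

/-! ### Energy growth of coupled oscillators over long times. -/

section Growth

/-- A family of oscillators coupled through the scalar `∑ b_k u_k²`, as long as the weighted energy
is at most `A`. -/
structure CoupledOscillators (u p : ℕ+ → ℝ → ℝ) (ω r b W : ℕ+ → ℝ) (σ ρ μ A T : ℝ) : Prop where
  sigma_nonneg : 0 ≤ σ
  mu_pos : 0 < μ
  b_nonneg : ∀ j, 0 ≤ b j
  b_le : ∀ j, b j ≤ W j
  r_nonneg : ∀ j, 0 ≤ r j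
  r_le : ∀ j, r j ≤ ρ
  freq : ∀ j, μ ≤ 2 * ω j
  gap : ∀ j k, j ≠ k → μ / 2 ≤ |ω j - ω k|
  tail : ∀ δ > 0, ∃ F : Finset ℕ+, ∀ k ∉ F, b k ≤ δ * W k
  summable : ∀ t ∈ Icc 0 T, Summable fun j => W j * (u j t ^ 2 + p j t ^ 2)
  deriv_u : ∀ t ∈ Icc 0 T, ∑' j, W j * (u j t ^ 2 + p j t ^ 2) ≤ A →
    ∀ j, HasDerivAt (u j) (ω j * p j t) t
  deriv_p : ∀ t ∈ Icc 0 T, ∑' j, W j * (u j t ^ 2 + p j t ^ 2) ≤ A →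
    ∀ j, HasDerivAt (p j) (-(ω j * u j t) - σ * r j * (∑' k, b k * u k t ^ 2) * u j t) t

variable {u p : ℕ+ → ℝ → ℝ} {ω r b W : ℕ+ → ℝ} {σ ρ μ A T : ℝ}

namespace CoupledOscillators

theorem W_nonneg (h : CoupledOscillators u p ω r b W σ ρ μ A T) (j : ℕ+) : 0 ≤ W j :=
  (h.b_nonneg j).trans (h.b_le j)

theorem mono_time (h : CoupledOscillators u p ω r b W σ ρ μ A T) {T' : ℝ} (hT : T' ≤ T) :
    CoupledOscillators u p ω r b W σ ρ μ A T' :=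
  { h with
    summable := fun t ht => h.summable t ⟨ht.1, ht.2.trans hT⟩
    deriv_u := fun t ht => h.deriv_u t ⟨ht.1, ht.2.trans hT⟩
    deriv_p := fun t ht => h.deriv_p t ⟨ht.1, ht.2.trans hT⟩ }

theorem summable_b (h : CoupledOscillators u p ω r b W σ ρ μ A T) {t : ℝ} (ht : t ∈ Icc 0 T) :
    Summable fun j => b j * u j t ^ 2 := by
  refine Summable.of_nonneg_of_le (fun j => mul_nonneg (h.b_nonneg j) (sq_nonneg _)) (fun j => ?_)
    (h.summable t ht)
  exact mul_le_mul (h.b_le j) (by nlinarith [sq_nonneg (p j t)]) (sq_nonneg _) (h.W_nonneg j)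

theorem sum_le (h : CoupledOscillators u p ω r b W σ ρ μ A T) {t : ℝ} (ht : t ∈ Icc 0 T)
    (F : Finset ℕ+) : ∑ j ∈ F, W j * (u j t ^ 2 + p j t ^ 2)
      ≤ ∑' j, W j * (u j t ^ 2 + p j t ^ 2) :=
  (h.summable t ht).sum_le_tsum F fun j _ => mul_nonneg (h.W_nonneg j) (by positivity)

/-- The quartic correction of one pair of modes. -/
def correction (u p : ℕ+ → ℝ → ℝ) (ω : ℕ+ → ℝ) (j k : ℕ+) (t : ℝ) : ℝ :=
  if j = k then selfCorrection (ω j) (u j t) (p j t)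
  else pairCorrection (ω j) (ω k) (u j t) (p j t) (u k t) (p k t)

theorem abs_correction_le (h : CoupledOscillators u p ω r b W σ ρ μ A T) (j k : ℕ+) (t : ℝ) :
    |correction u p ω j k t|
      ≤ (u j t ^ 2 + p j t ^ 2) * (u k t ^ 2 + p k t ^ 2) / (2 * μ) := by
  rw [correction]
  split_ifs with hjk
  · subst hjk; exact abs_selfCorrection_le h.mu_pos (h.freq j) _ _
  · exact abs_pairCorrection_le h.mu_pos (h.freq j) (h.freq k) (h.gap j k hjk) _ _ _ _

/-- Mode `j` feels the stiffness `γ_j = σ r_j ∑ b_k u_k²`, which lies between `0` and `σ ρ A`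
because `b ≤ W`. -/
theorem hasDerivAt_correction (h : CoupledOscillators u p ω r b W σ ρ μ A T) {t : ℝ}
    (ht : t ∈ Icc 0 T) (hA : ∑' j, W j * (u j t ^ 2 + p j t ^ 2) ≤ A) (j k : ℕ+) :
    ∃ e, HasDerivAt (correction u p ω j k) (u j t * p j t * u k t ^ 2 + e) t ∧
      |e| ≤ 2 * (σ * ρ * A) * ((u j t ^ 2 + p j t ^ 2) * (u k t ^ 2 + p k t ^ 2)) / μ := by
  have hS0 : 0 ≤ ∑' k, b k * u k t ^ 2 :=
    tsum_nonneg fun k => mul_nonneg (h.b_nonneg k) (sq_nonneg _)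
  have hSA : ∑' k, b k * u k t ^ 2 ≤ A := by
    refine (Summable.tsum_le_tsum (fun j => ?_) (h.summable_b ht) (h.summable t ht)).trans hA
    exact mul_le_mul (h.b_le j) (by nlinarith [sq_nonneg (p j t)]) (sq_nonneg _) (h.W_nonneg j)
  have hg0 : ∀ j, 0 ≤ σ * r j * ∑' k, b k * u k t ^ 2 := fun j =>
    mul_nonneg (mul_nonneg h.sigma_nonneg (h.r_nonneg j)) hS0
  have hg : ∀ j, σ * r j * ∑' k, b k * u k t ^ 2 ≤ σ * ρ * A := fun j => by
    have := h.sigma_nonneg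
    have := h.r_le j
    have := (h.r_nonneg j).trans this
    gcongr
  have key : ∃ e, HasDerivAt (correction u p ω j k) (u j t * p j t * u k t ^ 2 + e) t ∧
      |e| ≤ (σ * r j * (∑' k, b k * u k t ^ 2) + σ * r k * (∑' k, b k * u k t ^ 2))
        * ((u j t ^ 2 + p j t ^ 2) * (u k t ^ 2 + p k t ^ 2)) / μ := by
    unfold correction
    split_ifs with hjk
    · subst hjk
      exact hasDerivAt_selfCorrection h.mu_pos (h.freq j) (hg0 j) (h.deriv_u t ht hA j)
        (h.deriv_p t ht hA j)
    · exact hasDerivAt_pairCorrection h.mu_pos (h.freq j) (h.freq k) (h.gap j k hjk) (hg0 j) (hg0 k)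
        (h.deriv_u t ht hA j) (h.deriv_p t ht hA j) (h.deriv_u t ht hA k) (h.deriv_p t ht hA k)
  obtain ⟨e, he, hb⟩ := key
  refine ⟨e, he, hb.trans ?_⟩
  have := h.mu_pos
  gcongr
  linarith [hg j, hg k]

theorem sum_sum_le (h : CoupledOscillators u p ω r b W σ ρ μ A T) {t : ℝ}
    (ht : t ∈ Icc 0 T) (hA : ∑' j, W j * (u j t ^ 2 + p j t ^ 2) ≤ A) (F : Finset ℕ+) :
    ∑ j ∈ F, ∑ k ∈ F, W j * r j * b k * ((u j t ^ 2 + p j t ^ 2) * (u k t ^ 2 + p k t ^ 2))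
      ≤ ρ * A ^ 2 := by
  have h1 := (h.sum_le ht F).trans hA
  have h2 : 0 ≤ ∑ j ∈ F, W j * (u j t ^ 2 + p j t ^ 2) :=
    Finset.sum_nonneg fun j _ => mul_nonneg (h.W_nonneg j) (by positivity)
  have hρ : 0 ≤ ρ := (h.r_nonneg 1).trans (h.r_le 1)
  calc _ ≤ ∑ j ∈ F, ∑ k ∈ F, ρ * ((W j * (u j t ^ 2 + p j t ^ 2)) * (W k * (u k t ^ 2 + p k t ^ 2))) := by
        refine Finset.sum_le_sum fun j _ => Finset.sum_le_sum fun k _ => ?_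
        have a1 := h.r_le j
        have a2 := h.r_nonneg j
        have a3 := h.b_le k
        have a4 := h.b_nonneg k
        have a5 := h.W_nonneg j
        calc _ ≤ W j * ρ * W k * ((u j t ^ 2 + p j t ^ 2) * (u k t ^ 2 + p k t ^ 2)) := by gcongr
          _ = _ := by ring
    _ = ρ * ((∑ j ∈ F, W j * (u j t ^ 2 + p j t ^ 2)) * ∑ k ∈ F, W k * (u k t ^ 2 + p k t ^ 2)) := by
        simp_rw [← Finset.mul_sum, Finset.sum_mul_sum, Finset.mul_sum]
    _ ≤ ρ * (A * A) := by gcongr; exact h2.trans h1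
    _ = _ := by ring

/-- Only modes in `F` enter the energy, so all differentiations are of finite sums. The corrections
cancel the part of the derivative in which the coupling sum is restricted to `F`. Left over are
sextic terms, of size `4(σρ)²A³/μ`, and the coupling to modes outside `F`, of size `σρA²δ`. The
corrections at the two end times contribute `2σρA²/μ`. -/
theorem finite_energy_le (h : CoupledOscillators u p ω r b W σ ρ μ A T) (hT : 0 ≤ T)
    (hA : ∀ t ∈ Icc 0 T, ∑' j, W j * (u j t ^ 2 + p j t ^ 2) ≤ A) {F : Finset ℕ+} {δ : ℝ}
    (hδ : 0 ≤ δ) (hF : ∀ k ∉ F, b k ≤ δ * W k) :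
    ∑ j ∈ F, W j * (u j T ^ 2 + p j T ^ 2) ≤ ∑ j ∈ F, W j * (u j 0 ^ 2 + p j 0 ^ 2)
      + 2 * (σ * ρ * A ^ 2 / μ) + (4 * (σ * ρ) ^ 2 * A ^ 3 / μ + σ * ρ * A ^ 2 * δ) * T := by
  have hμ := h.mu_pos
  have hσ := h.sigma_nonneg
  have hρ : 0 ≤ ρ := (h.r_nonneg 1).trans (h.r_le 1)
  have h0 : (0 : ℝ) ∈ Icc 0 T := ⟨le_rfl, hT⟩
  have hA0 : 0 ≤ A := le_trans (tsum_nonneg fun j => mul_nonneg (h.W_nonneg j) (by positivity)) (hA 0 h0)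
  set S : ℝ → ℝ := fun t => ∑' k, b k * u k t ^ 2 with hS
  have hcor : ∀ t ∈ Icc 0 T, |2 * σ * ∑ j ∈ F, ∑ k ∈ F, W j * r j * b k * correction u p ω j k t|
      ≤ σ * ρ * A ^ 2 / μ := by
    intro t ht
    rw [abs_mul, abs_of_nonneg (by positivity)]
    have : |∑ j ∈ F, ∑ k ∈ F, W j * r j * b k * correction u p ω j k t| ≤ ρ * A ^ 2 / (2 * μ) := by
      calc _ ≤ ∑ j ∈ F, ∑ k ∈ F, |W j * r j * b k * correction u p ω j k t| :=
            (Finset.abs_sum_le_sum_abs _ _).trans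
              (Finset.sum_le_sum fun j _ => Finset.abs_sum_le_sum_abs _ _)
        _ ≤ ∑ j ∈ F, ∑ k ∈ F, W j * r j * b k *
            ((u j t ^ 2 + p j t ^ 2) * (u k t ^ 2 + p k t ^ 2)) / (2 * μ) := by
            refine Finset.sum_le_sum fun j _ => Finset.sum_le_sum fun k _ => ?_
            have a1 : 0 ≤ W j * r j * b k :=
              mul_nonneg (mul_nonneg (h.W_nonneg j) (h.r_nonneg j)) (h.b_nonneg k)
            rw [abs_mul, abs_of_nonneg a1, mul_div_assoc]
            exact mul_le_mul_of_nonneg_left (h.abs_correction_le j k t) a1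
        _ ≤ _ := by
            simp_rw [← Finset.sum_div]
            have := h.sum_sum_le ht (hA t ht) F
            gcongr
    calc _ ≤ 2 * σ * (ρ * A ^ 2 / (2 * μ)) := by gcongr
      _ = _ := by field_simp
  -- the corrected energy
  set Φ : ℝ → ℝ := fun t => ∑ j ∈ F, W j * (u j t ^ 2 + p j t ^ 2)
    + 2 * σ * ∑ j ∈ F, ∑ k ∈ F, W j * r j * b k * correction u p ω j k t with hΦ
  have hder : ∀ t ∈ Icc 0 T, ∃ d, HasDerivAt Φ d t ∧
      |d| ≤ 4 * (σ * ρ) ^ 2 * A ^ 3 / μ + σ * ρ * A ^ 2 * δ := by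
    intro t ht
    choose e he hb using h.hasDerivAt_correction ht (hA t ht)
    have hd1 : HasDerivAt (fun t => ∑ j ∈ F, W j * (u j t ^ 2 + p j t ^ 2))
        (∑ j ∈ F, W j * (-(σ * r j * S t) * (2 * u j t * p j t))) t :=
      HasDerivAt.fun_sum fun j _ => (hasDerivAt_sq_add_sq (h.deriv_u t ht (hA t ht) j)
        (h.deriv_p t ht (hA t ht) j)).const_mul (W j)
    have hd2 : HasDerivAt (fun t => ∑ j ∈ F, ∑ k ∈ F, W j * r j * b k * correction u p ω j k t)
        (∑ j ∈ F, ∑ k ∈ F, W j * r j * b k * (u j t * p j t * u k t ^ 2 + e j k)) t :=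
      HasDerivAt.fun_sum fun j _ => HasDerivAt.fun_sum fun k _ => (he j k).const_mul _
    refine ⟨_, hd1.add (hd2.const_mul (2 * σ)), ?_⟩
    set P := ∑ j ∈ F, W j * r j * (u j t * p j t) with hP
    set SF := ∑ k ∈ F, b k * u k t ^ 2 with hSF
    set Q := ∑ j ∈ F, ∑ k ∈ F, W j * r j * b k * e j k with hQ
    have e1 : ∑ j ∈ F, W j * (-(σ * r j * S t) * (2 * u j t * p j t)) = -(2 * σ * S t * P) := by
      rw [hP, Finset.mul_sum, ← Finset.sum_neg_distrib]
      exact Finset.sum_congr rfl fun j _ => by ring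
    have e2 : ∑ j ∈ F, ∑ k ∈ F, W j * r j * b k * (u j t * p j t * u k t ^ 2 + e j k) = P * SF + Q := by
      rw [hP, hSF, hQ, Finset.sum_mul_sum, ← Finset.sum_add_distrib]
      refine Finset.sum_congr rfl fun j _ => ?_
      rw [← Finset.sum_add_distrib]
      exact Finset.sum_congr rfl fun k _ => by ring
    rw [e1, e2]
    have hSsum := h.summable_b ht
    have htail0 : 0 ≤ S t - SF := sub_nonneg.2
      (hSsum.sum_le_tsum F fun j _ => mul_nonneg (h.b_nonneg j) (sq_nonneg _))
    -- Outside `F` one has `b_k ≤ δ W_k`, so the omitted part of the coupling sum is at most `δ`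
    -- times the energy.
    have htail : S t - SF ≤ δ * A := by
      have hsplit := hSsum.sum_add_tsum_subtype_compl F
      have hle : ∑' k : {k // k ∉ F}, b k * u k t ^ 2
          ≤ ∑' k : {k // k ∉ F}, δ * (W k * (u k t ^ 2 + p k t ^ 2)) := by
        refine Summable.tsum_le_tsum (fun k => ?_) (hSsum.subtype _)
          (((h.summable t ht).mul_left δ).subtype _)
        rw [← mul_assoc]
        exact mul_le_mul (hF k k.2) (by nlinarith [sq_nonneg (p k t)]) (sq_nonneg _)
          (mul_nonneg hδ (h.W_nonneg k))
      have hle2 : ∑' k : {k // k ∉ F}, δ * (W k * (u k t ^ 2 + p k t ^ 2)) ≤ δ * A := by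
        rw [tsum_mul_left]
        refine mul_le_mul_of_nonneg_left ((Summable.tsum_subtype_le _ {k | k ∉ F}
          (fun j => mul_nonneg (h.W_nonneg j) (by positivity)) (h.summable t ht)).trans (hA t ht)) hδ
      have : S t = SF + ∑' k : {k // k ∉ F}, b k * u k t ^ 2 := hsplit.symm
      linarith
    have hPb : |P| ≤ ρ * A / 2 := by
      calc |P| ≤ ∑ j ∈ F, |W j * r j * (u j t * p j t)| := Finset.abs_sum_le_sum_abs _ _
        _ ≤ ∑ j ∈ F, ρ / 2 * (W j * (u j t ^ 2 + p j t ^ 2)) := by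
            refine Finset.sum_le_sum fun j _ => ?_
            have a1 := h.W_nonneg j
            have a2 := h.r_nonneg j
            have a3 := h.r_le j
            have a4 := abs_two_mul_mul_le (u j t) (p j t)
            rw [mul_assoc 2, abs_mul, abs_two] at a4
            rw [abs_mul, abs_of_nonneg (mul_nonneg a1 a2)]
            have a5 : |u j t * p j t| ≤ (u j t ^ 2 + p j t ^ 2) / 2 := by linarith
            calc _ ≤ W j * ρ * ((u j t ^ 2 + p j t ^ 2) / 2) := by gcongr
              _ = _ := by ring
        _ ≤ ρ / 2 * A := by
            rw [← Finset.mul_sum]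
            exact mul_le_mul_of_nonneg_left ((h.sum_le ht F).trans (hA t ht)) (by positivity)
        _ = _ := by ring
    have hQb : |Q| ≤ 2 * (σ * ρ * A) * (ρ * A ^ 2) / μ := by
      calc |Q| ≤ ∑ j ∈ F, ∑ k ∈ F, |W j * r j * b k * e j k| :=
            (Finset.abs_sum_le_sum_abs _ _).trans
              (Finset.sum_le_sum fun j _ => Finset.abs_sum_le_sum_abs _ _)
        _ ≤ ∑ j ∈ F, ∑ k ∈ F, 2 * (σ * ρ * A) / μ * (W j * r j * b k *
            ((u j t ^ 2 + p j t ^ 2) * (u k t ^ 2 + p k t ^ 2))) := by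
            refine Finset.sum_le_sum fun j _ => Finset.sum_le_sum fun k _ => ?_
            have a1 : 0 ≤ W j * r j * b k :=
              mul_nonneg (mul_nonneg (h.W_nonneg j) (h.r_nonneg j)) (h.b_nonneg k)
            rw [abs_mul, abs_of_nonneg a1]
            calc _ ≤ W j * r j * b k * (2 * (σ * ρ * A)
                  * ((u j t ^ 2 + p j t ^ 2) * (u k t ^ 2 + p k t ^ 2)) / μ) :=
                  mul_le_mul_of_nonneg_left (hb j k) a1
              _ = _ := by ring
        _ ≤ 2 * (σ * ρ * A) / μ * (ρ * A ^ 2) := by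
            simp_rw [← Finset.mul_sum]
            exact mul_le_mul_of_nonneg_left (h.sum_sum_le ht (hA t ht) F) (by positivity)
        _ = _ := by ring
    -- The products `P * SF` cancel: this is the purpose of the corrections.
    have e3 : -(2 * σ * S t * P) + 2 * σ * (P * SF + Q)
        = 2 * σ * (-((S t - SF) * P)) + 2 * σ * Q := by ring
    rw [e3]
    refine (abs_add_le _ _).trans ?_
    rw [abs_mul (2 * σ), abs_mul (2 * σ), abs_neg, abs_mul (S t - SF),
      abs_of_nonneg (by positivity : 0 ≤ 2 * σ), abs_of_nonneg htail0]
    calc _ ≤ 2 * σ * (δ * A * (ρ * A / 2)) + 2 * σ * (2 * (σ * ρ * A) * (ρ * A ^ 2) / μ) := by gcongr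
      _ = _ := by ring
  choose! d hd hdb using hder
  have hmv := norm_image_sub_le_of_norm_deriv_le_segment' (f := Φ) (f' := d) (a := 0) (b := T)
    (fun t ht => (hd t ht).hasDerivWithinAt) (fun t ht => hdb t (Ico_subset_Icc_self ht)) T ⟨hT, le_rfl⟩
  rw [sub_zero, Real.norm_eq_abs] at hmv
  have h1 := (abs_le.1 hmv).2
  have h2 := (abs_le.1 (hcor 0 h0)).2
  have h3 := (abs_le.1 (hcor T ⟨hT, le_rfl⟩)).1
  simp only [hΦ] at h1
  linarith

/-- Any finite set of modes can be enlarged so that the truncation error up to time `T` is below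
`ε`; the truncated estimate then passes to the full sum. -/
theorem energy_le (h : CoupledOscillators u p ω r b W σ ρ μ A T) (hT : 0 ≤ T)
    (hA : ∀ t ∈ Icc 0 T, ∑' j, W j * (u j t ^ 2 + p j t ^ 2) ≤ A) :
    ∑' j, W j * (u j T ^ 2 + p j T ^ 2) ≤ ∑' j, W j * (u j 0 ^ 2 + p j 0 ^ 2)
      + 2 * (σ * ρ * A ^ 2 / μ) + 4 * (σ * ρ) ^ 2 * A ^ 3 / μ * T := by
  have h0 : (0 : ℝ) ∈ Icc 0 T := ⟨le_rfl, hT⟩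
  have hσ := h.sigma_nonneg
  have hρ : 0 ≤ ρ := (h.r_nonneg 1).trans (h.r_le 1)
  refine le_of_forall_pos_le_add fun ε hε => ?_
  -- The summand `1` in the denominator avoids a division by zero and makes the truncation error at
  -- most `ε`.
  obtain ⟨F, hF⟩ := h.tail (ε / (σ * ρ * A ^ 2 * T + 1)) (by positivity)
  have hδ : σ * ρ * A ^ 2 * (ε / (σ * ρ * A ^ 2 * T + 1)) * T ≤ ε := by
    rw [show σ * ρ * A ^ 2 * (ε / (σ * ρ * A ^ 2 * T + 1)) * T
      = ε * (σ * ρ * A ^ 2 * T) / (σ * ρ * A ^ 2 * T + 1) by ring, div_le_iff₀ (by positivity)]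
    linarith
  refine Real.tsum_le_of_sum_le (fun j => mul_nonneg (h.W_nonneg j) (by positivity)) fun G => ?_
  have h1 : ∑ j ∈ G, W j * (u j T ^ 2 + p j T ^ 2) ≤ ∑ j ∈ G ∪ F, W j * (u j T ^ 2 + p j T ^ 2) :=
    Finset.sum_le_sum_of_subset_of_nonneg Finset.subset_union_left
      fun j _ _ => mul_nonneg (h.W_nonneg j) (by positivity)
  have h2 := h.finite_energy_le hT hA (F := G ∪ F) (δ := ε / (σ * ρ * A ^ 2 * T + 1)) (by positivity)
    (fun k hk => hF k fun hk2 => hk (Finset.mem_union_right _ hk2))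
  have h3 := h.sum_le h0 (G ∪ F)
  linarith

/-- Continuity argument: the a priori bound `A` is never reached. -/
theorem energy_lt (h : CoupledOscillators u p ω r b W σ ρ μ A T) (hA0 : 0 < A)
    (hcont : ContinuousOn (fun t => ∑' j, W j * (u j t ^ 2 + p j t ^ 2)) (Icc 0 T))
    (hlt : ∑' j, W j * (u j 0 ^ 2 + p j 0 ^ 2)
      + 2 * (σ * ρ * A ^ 2 / μ) + 4 * (σ * ρ) ^ 2 * A ^ 3 / μ * T < A) :
    ∀ t ∈ Icc 0 T, ∑' j, W j * (u j t ^ 2 + p j t ^ 2) < A := by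
  by_contra! hcon
  obtain ⟨t₁, ht₁, hn₁⟩ := hcon
  have hμ := h.mu_pos
  have hσ := h.sigma_nonneg
  have hρ : 0 ≤ ρ := (h.r_nonneg 1).trans (h.r_le 1)
  have hT : 0 ≤ T := ht₁.1.trans ht₁.2
  set n : ℝ → ℝ := fun t => ∑' j, W j * (u j t ^ 2 + p j t ^ 2) with hn
  have hK : IsCompact (Icc 0 T ∩ n ⁻¹' Ici A) :=
    isCompact_Icc.of_isClosed_subset (hcont.preimage_isClosed_of_isClosed isClosed_Icc isClosed_Ici)
      inter_subset_left
  -- `τ` is the first time at which the energy reaches `A`. Before it the a priori estimate applies,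
  -- and by continuity the estimate holds at `τ` too, where it contradicts the strict bound.
  obtain ⟨τ, hτ, hmin⟩ := hK.exists_isLeast ⟨t₁, ht₁, hn₁⟩
  have hτA : A ≤ n τ := hτ.2
  have hpos : ∀ t : ℝ, 0 ≤ t → 0 ≤ 2 * (σ * ρ * A ^ 2 / μ) + 4 * (σ * ρ) ^ 2 * A ^ 3 / μ * t := by
    intro t ht; positivity
  have hτ0 : 0 < τ := by
    rcases hτ.1.1.lt_or_eq with h0 | h0
    · exact h0
    · rw [← h0] at hτA
      have := hpos T hT
      change n 0 + _ + _ < A at hlt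
      linarith
  have hbelow : ∀ t ∈ Ico 0 τ, n t < A := fun t ht => by
    by_contra hcon
    exact absurd (hmin ⟨⟨ht.1, ht.2.le.trans hτ.1.2⟩, not_lt.1 hcon⟩) (not_le.2 ht.2)
  have hbd : ∀ t ∈ Ico 0 τ, n t ≤ n 0 + 2 * (σ * ρ * A ^ 2 / μ) + 4 * (σ * ρ) ^ 2 * A ^ 3 / μ * T := by
    intro t ht
    have htT : t ≤ T := ht.2.le.trans hτ.1.2
    refine ((h.mono_time htT).energy_le ht.1 fun x hx =>
      (hbelow x ⟨hx.1, hx.2.trans_lt ht.2⟩).le).trans ?_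
    gcongr
  have hle := ContinuousWithinAt.closure_le (s := Ico 0 τ) (x := τ)
    (by rw [closure_Ico hτ0.ne]; exact ⟨hτ0.le, le_rfl⟩)
    ((hcont τ hτ.1).mono fun t ht => ⟨ht.1, ht.2.le.trans hτ.1.2⟩) continuousWithinAt_const hbd
  exact absurd (hτA.trans hle) (not_le.2 hlt)

end CoupledOscillators

end Growth
-- Radial cut-off and the truncated cubic vector field.
section RadialProjection

variable {E : Type*} [NormedAddCommGroup E] [NormedSpace ℝ E]

/-- The radial retraction of a normed space onto the closed ball of radius `R`. -/
def radialProj (R : ℝ) (x : E) : E := (R / max R ‖x‖) • x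

theorem radialProj_of_norm_le {R : ℝ} (hR : 0 < R) {x : E} (hx : ‖x‖ ≤ R) : radialProj R x = x := by
  rw [radialProj, max_eq_left hx, div_self hR.ne', one_smul]

theorem norm_radialProj_le {R : ℝ} (hR : 0 < R) (x : E) : ‖radialProj R x‖ ≤ R := by
  have hm : 0 < max R ‖x‖ := hR.trans_le (le_max_left _ _)
  rw [radialProj, norm_smul, Real.norm_eq_abs, abs_of_pos (by positivity), div_mul_eq_mul_div,
    div_le_iff₀ hm]
  exact mul_le_mul_of_nonneg_left (le_max_right _ _) hR.le

/-- One unit of `‖x - y‖` comes from the difference of the points and one from the difference of the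
scaling factors; no inner product is used, hence the constant `2`. -/
theorem norm_radialProj_sub_le {R : ℝ} (hR : 0 < R) (x y : E) :
    ‖radialProj R x - radialProj R y‖ ≤ 2 * ‖x - y‖ := by
  have hx : 0 < max R ‖x‖ := hR.trans_le (le_max_left _ _)
  have hy : 0 < max R ‖y‖ := hR.trans_le (le_max_left _ _)
  have hm : |max R ‖y‖ - max R ‖x‖| ≤ ‖x - y‖ := by
    rw [max_comm R, max_comm R]
    refine (abs_max_sub_max_le_abs _ _ _).trans ?_
    rw [norm_sub_rev]
    exact abs_norm_sub_norm_le _ _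
  have e : radialProj R x - radialProj R y = (R / max R ‖x‖) • (x - y)
      + ((R / max R ‖x‖) * ((max R ‖y‖ - max R ‖x‖) / max R ‖y‖)) • y := by
    rw [radialProj, radialProj, smul_sub, sub_add, ← sub_smul]
    congr 2
    field_simp
    ring
  have h1 : R / max R ‖x‖ ≤ 1 := (div_le_one hx).2 (le_max_left _ _)
  have h0 : 0 ≤ R / max R ‖x‖ := by positivity
  rw [e]
  refine (norm_add_le _ _).trans ?_
  rw [norm_smul, norm_smul, norm_mul, Real.norm_of_nonneg h0, Real.norm_eq_abs, abs_div,
    abs_of_pos hy]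
  have h2 : |max R ‖y‖ - max R ‖x‖| / max R ‖y‖ * ‖y‖ ≤ ‖x - y‖ := by
    rw [div_mul_eq_mul_div, div_le_iff₀ hy]
    exact mul_le_mul hm (le_max_right _ _) (norm_nonneg _) (norm_nonneg _)
  calc _ ≤ 1 * ‖x - y‖ + 1 * (|max R ‖y‖ - max R ‖x‖| / max R ‖y‖ * ‖y‖) := by
        rw [mul_assoc]; gcongr
    _ ≤ _ := by linarith

end RadialProjection

section CubicField

variable {E F : Type*} [NormedAddCommGroup E] [NormedSpace ℝ E] [NormedAddCommGroup F]
  [NormedSpace ℝ F]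

/-- The cubic map `z ↦ ‖B z‖² D z`. -/
def cubicMap (B : E →L[ℝ] F) (D : E →L[ℝ] E) (z : E) : E := ‖B z‖ ^ 2 • D z

theorem continuous_cubicMap (B : E →L[ℝ] F) (D : E →L[ℝ] E) : Continuous (cubicMap B D) := by
  unfold cubicMap; fun_prop

theorem norm_cubicMap_sub_le {B : E →L[ℝ] F} {D : E →L[ℝ] E} (hB : ∀ z, ‖B z‖ ≤ ‖z‖)
    (hD : ∀ z, ‖D z‖ ≤ ‖z‖) {R : ℝ} {x y : E} (hx : ‖x‖ ≤ R) (hy : ‖y‖ ≤ R) :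
    ‖cubicMap B D x - cubicMap B D y‖ ≤ 3 * R ^ 2 * ‖x - y‖ := by
  have hR : 0 ≤ R := (norm_nonneg _).trans hx
  have e : cubicMap B D x - cubicMap B D y = ‖B x‖ ^ 2 • D (x - y)
      + ((‖B x‖ + ‖B y‖) * (‖B x‖ - ‖B y‖)) • D y := by
    rw [cubicMap, cubicMap, map_sub, smul_sub, sub_add, ← sub_smul]
    congr 2
    ring
  rw [e]
  refine (norm_add_le _ _).trans ?_
  rw [norm_smul, norm_smul, norm_mul, norm_pow, norm_norm, Real.norm_eq_abs, Real.norm_eq_abs,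
    abs_of_nonneg (by positivity)]
  have h1 : |‖B x‖ - ‖B y‖| ≤ ‖x - y‖ := by
    refine (abs_norm_sub_norm_le _ _).trans ?_
    rw [← map_sub]; exact hB _
  have h2 := (hB x).trans hx
  have h3 := (hB y).trans hy
  have h4 := (hD y).trans hy
  have h5 := hD (x - y)
  calc _ ≤ R ^ 2 * ‖x - y‖ + (R + R) * ‖x - y‖ * R := by gcongr
    _ = _ := by ring

theorem norm_cubicMap_le {B : E →L[ℝ] F} {D : E →L[ℝ] E} (hB : ∀ z, ‖B z‖ ≤ ‖z‖)
    (hD : ∀ z, ‖D z‖ ≤ ‖z‖) {R : ℝ} {x : E} (hx : ‖x‖ ≤ R) : ‖cubicMap B D x‖ ≤ R ^ 3 := by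
  have hR : 0 ≤ R := (norm_nonneg _).trans hx
  rw [cubicMap, norm_smul, norm_pow, norm_norm]
  calc _ ≤ R ^ 2 * R := by
        have := (hB x).trans hx
        have := (hD x).trans hx
        gcongr
    _ = _ := by ring

theorem lipschitzWith_cubicMap_radialProj {B : E →L[ℝ] F} {D : E →L[ℝ] E} (hB : ∀ z, ‖B z‖ ≤ ‖z‖)
    (hD : ∀ z, ‖D z‖ ≤ ‖z‖) {R : ℝ} (hR : 0 < R) :
    LipschitzWith (6 * R ^ 2).toNNReal fun z => cubicMap B D (radialProj R z) := by
  refine LipschitzWith.of_dist_le_mul fun x y => ?_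
  rw [dist_eq_norm, dist_eq_norm, Real.coe_toNNReal _ (by positivity)]
  refine (norm_cubicMap_sub_le hB hD (norm_radialProj_le hR x) (norm_radialProj_le hR y)).trans ?_
  calc _ ≤ 3 * R ^ 2 * (2 * ‖x - y‖) := by gcongr; exact norm_radialProj_sub_le hR x y
    _ = _ := by ring

end CubicField

/-! ### The unitary group of the linear flow. -/

/-- The space `ℓ²(ℕ+, ℂ)` of mode amplitudes. -/
abbrev AmplitudeSpace : Type := lp (fun _ : ℕ+ => ℂ) 2

theorem norm_exp_mul_le (ω : ℕ+ → ℝ) (t : ℝ) (j : ℕ+) (x : ℂ) :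
    ‖LinearMap.mulLeft ℝ (Complex.exp ((ω j * t : ℝ) * Complex.I)) x‖ ≤ 1 * ‖x‖ := by
  rw [LinearMap.mulLeft_apply, norm_mul, Complex.norm_exp_ofReal_mul_I]

/-- Rotation of the `j`-th amplitude with frequency `ω_j`. -/
def modeRot (ω : ℕ+ → ℝ) (t : ℝ) : AmplitudeSpace →L[ℝ] AmplitudeSpace :=
  diagOp (fun j => LinearMap.mulLeft ℝ (Complex.exp ((ω j * t : ℝ) * Complex.I))) 1
    (norm_exp_mul_le ω t)

section Rotation

variable (ω : ℕ+ → ℝ)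

theorem modeRot_apply (t : ℝ) (a : AmplitudeSpace) (j : ℕ+) :
    modeRot ω t a j = Complex.exp ((ω j * t : ℝ) * Complex.I) * a j := by
  rw [modeRot, diagOp_apply, LinearMap.mulLeft_apply]

theorem norm_modeRot (t : ℝ) (a : AmplitudeSpace) : ‖modeRot ω t a‖ = ‖a‖ := by
  have : ‖modeRot ω t a‖ ^ 2 = ‖a‖ ^ 2 := by
    rw [lp_two_norm_sq, lp_two_norm_sq]
    exact tsum_congr fun j => by rw [modeRot_apply, norm_mul, Complex.norm_exp_ofReal_mul_I, one_mul]
  exact (pow_left_inj₀ (norm_nonneg _) (norm_nonneg _) two_ne_zero).1 this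

theorem modeRot_modeRot (s t : ℝ) (a : AmplitudeSpace) :
    modeRot ω s (modeRot ω t a) = modeRot ω (s + t) a := by
  ext j
  rw [modeRot_apply, modeRot_apply, modeRot_apply, ← mul_assoc, ← Complex.exp_add]
  congr 2
  push_cast
  ring

theorem modeRot_zero (a : AmplitudeSpace) : modeRot ω 0 a = a := by
  ext j
  simp [modeRot_apply]

/-- Continuity is strong only, since `ω` is allowed to be unbounded. The coordinates are continuous,
and the squared distance is a series dominated by `(2‖a_j‖)²`. -/
theorem continuous_modeRot (a : AmplitudeSpace) : Continuous fun t => modeRot ω t a := by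
  have h1 : ∀ t₀, Continuous fun t => ‖modeRot ω t a - modeRot ω t₀ a‖ ^ 2 := fun t₀ => by
    simp_rw [lp_two_norm_sq]
    refine continuous_tsum (u := fun j => (2 * ‖a j‖) ^ 2) (fun j => ?_) ?_ (fun j t => ?_)
    · simp only [lp.coeFn_sub, Pi.sub_apply, modeRot_apply]
      fun_prop
    · simp_rw [mul_pow]
      exact (lp_two_summable a).mul_left _
    · rw [norm_pow, norm_norm, lp.coeFn_sub, Pi.sub_apply, modeRot_apply, modeRot_apply]
      refine pow_le_pow_left₀ (norm_nonneg _) ((norm_sub_le _ _).trans ?_) 2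
      rw [norm_mul, norm_mul, Complex.norm_exp_ofReal_mul_I, Complex.norm_exp_ofReal_mul_I]
      linarith
  refine continuous_iff_continuousAt.2 fun t₀ => ?_
  rw [ContinuousAt, tendsto_iff_norm_sub_tendsto_zero]
  have h2 := (h1 t₀).tendsto t₀
  rw [sub_self, norm_zero, zero_pow two_ne_zero] at h2
  have h3 := h2.sqrt
  simpa [Real.sqrt_sq (norm_nonneg _)] using h3

/-- Strong continuity in `t` becomes joint continuity because the rotations are isometries, hence
Lipschitz in `a` uniformly in `t`. -/
theorem continuous_modeRot_uncurry :
    Continuous fun x : ℝ × AmplitudeSpace => modeRot ω x.1 x.2 := by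
  refine continuous_prod_of_continuous_lipschitzWith' _ 1 (fun t => ?_) (fun a => ?_)
  · refine LipschitzWith.of_dist_le_mul fun x y => ?_
    rw [dist_eq_norm, dist_eq_norm, ← map_sub, norm_modeRot]
    simp
  · exact continuous_modeRot ω a

theorem continuousOn_modeRot {f : ℝ → ℝ} {g : ℝ → AmplitudeSpace} {I : Set ℝ}
    (hf : ContinuousOn f I) (hg : ContinuousOn g I) :
    ContinuousOn (fun t => modeRot ω (f t) (g t)) I := by
  change ContinuousOn ((fun x : ℝ × AmplitudeSpace => modeRot ω x.1 x.2) ∘ fun t => (f t, g t)) I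
  exact (continuous_modeRot_uncurry ω).comp_continuousOn (hf.prodMk hg)

theorem hasDerivAt_exp_mul (w t : ℝ) :
    HasDerivAt (fun t : ℝ => Complex.exp ((w * t : ℝ) * Complex.I))
      (w * Complex.I * Complex.exp ((w * t : ℝ) * Complex.I)) t := by
  have h1 : HasDerivAt (fun t : ℝ => ((w * t : ℝ) : ℂ) * Complex.I) ((w : ℂ) * Complex.I) t := by
    have := (((hasDerivAt_id t).const_mul w).ofReal_comp).mul_const Complex.I
    simpa using this
  exact h1.cexp.congr_deriv (by ring)

end Rotation

/-! ### Existence and uniqueness for the amplitude equation in the rotating frame. -/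

section ModalODE

variable {F : Type*} [NormedAddCommGroup F] [NormedSpace ℝ F] {ω : ℕ+ → ℝ}

/-- Rotating frame: coordinatewise solutions of `z_j' = -i ω_j z_j + (G t)_j`. -/
theorem hasDerivAt_modeRot_of_coord {I : Set ℝ} (hI : IsOpen I) (hc : I.OrdConnected)
    {z G : ℝ → AmplitudeSpace} (hG : ContinuousOn G I)
    (hz : ∀ t ∈ I, ∀ j, HasDerivAt (fun τ => z τ j) (-(ω j * Complex.I * z t j) + G t j) t)
    {t : ℝ} (ht : t ∈ I) :
    HasDerivAt (fun τ => modeRot ω τ (z τ)) (modeRot ω t (G t)) t := by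
  refine hasDerivAt_lp_of_coord hI hc (V := fun τ => modeRot ω τ (G τ))
    (continuousOn_modeRot ω continuousOn_id hG) (fun τ hτ j => ?_) ht
  simp only [modeRot_apply]
  exact ((hasDerivAt_exp_mul (ω j) τ).mul (hz τ hτ j)).congr_deriv (by ring)

/-- The substitution `a = e^{iωt} z` removes the unbounded term. The remaining field is continuous
in time, globally Lipschitz and bounded by `R³`, so Picard–Lindelöf on the ball of radius `R³ T`
reaches all of `[-T, T]` at once. -/
theorem exists_truncated_solution {B : AmplitudeSpace →L[ℝ] F}
    {D : AmplitudeSpace →L[ℝ] AmplitudeSpace} (hB : ∀ z, ‖B z‖ ≤ ‖z‖) (hD : ∀ z, ‖D z‖ ≤ ‖z‖)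
    {R T : ℝ} (hR : 0 < R) (hT : 0 < T) (z₀ : AmplitudeSpace) :
    ∃ z : ℝ → AmplitudeSpace, ContinuousOn z (Icc (-T) T) ∧ z 0 = z₀ ∧
      ∀ t ∈ Ioo (-T) T, ∀ j, HasDerivAt (fun τ => z τ j)
        (-(ω j * Complex.I * z t j) + cubicMap B D (radialProj R (z t)) j) t := by
  set N : AmplitudeSpace → AmplitudeSpace := fun z => cubicMap B D (radialProj R z) with hN
  have hNl := lipschitzWith_cubicMap_radialProj hB hD hR
  have hpl : IsPicardLindelof (fun t a => modeRot ω t (N (modeRot ω (-t) a)))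
      (tmin := -T) (tmax := T) ⟨0, by linarith, hT.le⟩ z₀ ((R ^ 3).toNNReal * T.toNNReal) 0
      (R ^ 3).toNNReal (6 * R ^ 2).toNNReal := by
    refine ⟨fun t _ => LipschitzWith.lipschitzOnWith ?_, fun x _ => ?_, fun t _ x _ => ?_, ?_⟩
    · refine LipschitzWith.of_dist_le_mul fun x y => ?_
      have := hNl.dist_le_mul (modeRot ω (-t) x) (modeRot ω (-t) y)
      rw [dist_eq_norm, dist_eq_norm, ← map_sub, norm_modeRot] at this
      rwa [dist_eq_norm, dist_eq_norm, ← map_sub, norm_modeRot]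
    · refine continuousOn_modeRot ω continuousOn_id ?_
      exact hNl.continuous.comp_continuousOn
        (continuousOn_modeRot ω continuous_neg.continuousOn continuousOn_const)
    · rw [norm_modeRot, Real.coe_toNNReal _ (by positivity)]
      exact norm_cubicMap_le hB hD (norm_radialProj_le hR _)
    · simp [hT.le]
  obtain ⟨a, ha0, ha⟩ := hpl.exists_eq_forall_mem_Icc_hasDerivWithinAt₀
  simp only at ha0
  refine ⟨fun t => modeRot ω (-t) (a t), continuousOn_modeRot ω continuous_neg.continuousOn
    fun t ht => (ha t ht).continuousWithinAt, by simp [ha0, modeRot_zero], fun t ht j => ?_⟩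
  have h1 := hasDerivAt_coord ((ha t (Ioo_subset_Icc_self ht)).hasDerivAt (Icc_mem_nhds ht.1 ht.2)) j
  have h2 := (hasDerivAt_exp_mul (-ω j) t).mul h1
  have e : (fun τ : ℝ => modeRot ω (-τ) (a τ) j)
      = fun τ : ℝ => Complex.exp ((-ω j * τ : ℝ) * Complex.I) * a τ j := by
    funext τ
    rw [modeRot_apply]
    congr 3
    push_cast; ring
  rw [e]
  refine h2.congr_deriv ?_
  have e2 : Complex.exp ((-ω j * t : ℝ) * Complex.I) * modeRot ω t (N (modeRot ω (-t) (a t))) j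
      = N (modeRot ω (-t) (a t)) j := by
    rw [modeRot_apply, ← mul_assoc, ← Complex.exp_add]
    have : ((-ω j * t : ℝ) : ℂ) * Complex.I + ((ω j * t : ℝ) : ℂ) * Complex.I = 0 := by
      push_cast; ring
    rw [this, Complex.exp_zero, one_mul]
  rw [e2, modeRot_apply ω (-t)]
  have e3 : ((ω j * -t : ℝ) : ℂ) = ((-ω j * t : ℝ) : ℂ) := by push_cast; ring
  rw [e3]
  push_cast
  ring

theorem exists_Ioo_of_isOpen_ordConnected {I : Set ℝ} (hI : IsOpen I) (hc : I.OrdConnected)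
    {x y : ℝ} (hx : x ∈ I) (hy : y ∈ I) : ∃ a b, x ∈ Ioo a b ∧ y ∈ Ioo a b ∧ Icc a b ⊆ I := by
  have key : ∀ z ∈ I, ∃ δ > 0, z - δ ∈ I ∧ z + δ ∈ I := fun z hz => by
    obtain ⟨δ, hδ, h⟩ := Metric.isOpen_iff.1 hI z hz
    refine ⟨δ / 2, half_pos hδ, h ?_, h ?_⟩ <;>
    · simp [abs_of_pos hδ, hδ]
  obtain ⟨δ, hδ, h1, h2⟩ := key x hx
  obtain ⟨δ', hδ', h3, h4⟩ := key y hy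
  refine ⟨min (x - δ) (y - δ'), max (x + δ) (y + δ'), ⟨?_, ?_⟩, ⟨?_, ?_⟩, hc.out ?_ ?_⟩
  · exact min_lt_of_left_lt (by linarith)
  · exact lt_max_of_lt_left (by linarith)
  · exact min_lt_of_right_lt (by linarith)
  · exact lt_max_of_lt_right (by linarith)
  · rcases min_choice (x - δ) (y - δ') with h | h <;> rw [h] <;> assumption
  · rcases max_choice (x + δ) (y + δ') with h | h <;> rw [h] <;> assumption

/-- On a compact interval both curves stay in some ball of radius `R`, where the cut-off field
equals the cubic one. Both then solve the same Lipschitz equation in the rotating frame. -/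
theorem eqOn_of_modal_ode {B : AmplitudeSpace →L[ℝ] F}
    {D : AmplitudeSpace →L[ℝ] AmplitudeSpace} (hB : ∀ z, ‖B z‖ ≤ ‖z‖) (hD : ∀ z, ‖D z‖ ≤ ‖z‖)
    {I : Set ℝ} (hI : IsOpen I) (hc : I.OrdConnected) (h0 : (0 : ℝ) ∈ I) {z w : ℝ → AmplitudeSpace}
    (hz : ContinuousOn z I) (hw : ContinuousOn w I)
    (hz' : ∀ t ∈ I, ∀ j, HasDerivAt (fun τ => z τ j) (-(ω j * Complex.I * z t j) + cubicMap B D (z t) j) t)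
    (hw' : ∀ t ∈ I, ∀ j, HasDerivAt (fun τ => w τ j) (-(ω j * Complex.I * w t j) + cubicMap B D (w t) j) t)
    (h : z 0 = w 0) : EqOn z w I := by
  intro t ht
  obtain ⟨a, b, ha, hb, hab⟩ := exists_Ioo_of_isOpen_ordConnected hI hc h0 ht
  obtain ⟨R₁, hR₁⟩ := isCompact_Icc.exists_bound_of_continuousOn (hz.mono hab)
  obtain ⟨R₂, hR₂⟩ := isCompact_Icc.exists_bound_of_continuousOn (hw.mono hab)
  set R := max 1 (max R₁ R₂)
  have hR : 0 < R := lt_max_of_lt_left one_pos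
  have hNl := lipschitzWith_cubicMap_radialProj hB hD hR
  set N : AmplitudeSpace → AmplitudeSpace := fun z => cubicMap B D (radialProj R z) with hN
  have key : ∀ y : ℝ → AmplitudeSpace, ContinuousOn y I →
      (∀ t ∈ I, ∀ j, HasDerivAt (fun τ => y τ j) (-(ω j * Complex.I * y t j) + cubicMap B D (y t) j) t) →
      (∀ t ∈ Icc a b, ‖y t‖ ≤ R) → ∀ t ∈ Ioo a b, HasDerivAt (fun τ => modeRot ω τ (y τ))
        (modeRot ω t (N (modeRot ω (-t) (modeRot ω t (y t))))) t ∧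
        modeRot ω t (y t) ∈ (univ : Set AmplitudeSpace) := by
    intro y hy hy' hyR t ht
    refine ⟨?_, trivial⟩
    rw [modeRot_modeRot, neg_add_cancel, modeRot_zero, hN]
    simp only
    rw [radialProj_of_norm_le hR (hyR t (Ioo_subset_Icc_self ht))]
    exact hasDerivAt_modeRot_of_coord hI hc ((continuous_cubicMap B D).comp_continuousOn hy) hy'
      (hab (Ioo_subset_Icc_self ht))
  have hu := ODE_solution_unique_of_mem_Ioo
    (v := fun t a => modeRot ω t (N (modeRot ω (-t) a))) (s := fun _ => univ)
    (K := (6 * R ^ 2).toNNReal) (fun t _ => LipschitzWith.lipschitzOnWith (by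
      refine LipschitzWith.of_dist_le_mul fun x y => ?_
      have := hNl.dist_le_mul (modeRot ω (-t) x) (modeRot ω (-t) y)
      rw [dist_eq_norm, dist_eq_norm, ← map_sub, norm_modeRot] at this
      rwa [dist_eq_norm, dist_eq_norm, ← map_sub, norm_modeRot])) ha
    (key z hz hz' fun t ht => (hR₁ t ht).trans ((le_max_left _ _).trans (le_max_right _ _)))
    (key w hw hw' fun t ht => (hR₂ t ht).trans ((le_max_right _ _).trans (le_max_right _ _)))
    (by simp only [h])
  have := hu hb
  simp only at this
  have h2 := congrArg (modeRot ω (-t)) this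
  simpa only [modeRot_modeRot, neg_add_cancel, modeRot_zero] using h2

end ModalODE

/-! ### Frequencies, their gaps and the constant `μ`. -/

section Frequencies

variable {m : ℝ}

theorem sq_add_pos (hm : -1 / 2 ≤ m) (j : ℕ+) : 0 < (j : ℝ) ^ 2 + m := by
  nlinarith [one_le_pnat_cast j]

theorem omegaFreq_eq (m : ℝ) (j : ℕ+) : omegaFreq m j = j * √((j : ℝ) ^ 2 + m) := by
  rw [omegaFreq, show (j : ℝ) ^ 4 + m * (j : ℝ) ^ 2 = (j : ℝ) ^ 2 * ((j : ℝ) ^ 2 + m) by ring,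
    Real.sqrt_mul (by positivity), Real.sqrt_sq (pnat_cast_pos j).le]

theorem omegaFreq_pos (hm : -1 / 2 ≤ m) (j : ℕ+) : 0 < omegaFreq m j := by
  rw [omegaFreq_eq]
  exact mul_pos (pnat_cast_pos j) (Real.sqrt_pos.2 (sq_add_pos hm j))

theorem omegaFreq_sq (hm : -1 / 2 ≤ m) (j : ℕ+) :
    omegaFreq m j ^ 2 = (j : ℝ) ^ 4 + m * (j : ℝ) ^ 2 := by
  rw [omegaFreq_eq, mul_pow, Real.sq_sqrt (sq_add_pos hm j).le]
  ring

theorem mu_pos (hm : -1 / 2 ≤ m) : 0 < mu m := by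
  refine lt_min ?_ ?_
  · have := Real.sqrt_pos.2 (show 0 < 1 + m by linarith); positivity
  · have := Real.sqrt_pos.2 (show 0 < 4 + m by linarith); positivity

theorem mu_le_two_mul_omegaFreq (m : ℝ) (j : ℕ+) : mu m ≤ 2 * omegaFreq m j := by
  refine (min_le_left _ _).trans ?_
  have h1 := one_le_pnat_cast j
  rw [omegaFreq_eq]
  have h2 : √(1 + m) ≤ √((j : ℝ) ^ 2 + m) := Real.sqrt_le_sqrt (by nlinarith)
  nlinarith [Real.sqrt_nonneg (1 + m), Real.sqrt_nonneg ((j : ℝ) ^ 2 + m)]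

/-- Since `ω_j = j √(j² + m)`, the gap is at least `(k - j) √(k² + m) ≥ √(4 + m)`, because `k ≥ 2`.
-/
theorem mu_half_le_omegaFreq_sub {j k : ℕ+} (hjk : j < k) :
    mu m / 2 ≤ omegaFreq m k - omegaFreq m j := by
  have hj := one_le_pnat_cast j
  have hk : (j : ℝ) + 1 ≤ k := by exact_mod_cast (hjk : (j : ℕ) < k)
  have h1 : √((j : ℝ) ^ 2 + m) ≤ √((k : ℝ) ^ 2 + m) := Real.sqrt_le_sqrt (by nlinarith)
  have h2 : √(4 + m) ≤ √((k : ℝ) ^ 2 + m) := Real.sqrt_le_sqrt (by nlinarith)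
  have h3 : mu m ≤ 3 / 2 * √(4 + m) := min_le_right _ _
  rw [omegaFreq_eq, omegaFreq_eq]
  have h4 := Real.sqrt_nonneg (4 + m)
  have h5 := Real.sqrt_nonneg ((k : ℝ) ^ 2 + m)
  have h6 : (j : ℝ) * √((j : ℝ) ^ 2 + m) ≤ j * √((k : ℝ) ^ 2 + m) := by gcongr
  have h7 : ((j : ℝ) + 1) * √((k : ℝ) ^ 2 + m) ≤ k * √((k : ℝ) ^ 2 + m) := by gcongr
  linarith

theorem mu_half_le_abs_omegaFreq_sub {j k : ℕ+} (hjk : j ≠ k) :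
    mu m / 2 ≤ |omegaFreq m j - omegaFreq m k| := by
  rcases lt_or_gt_of_ne hjk with h | h
  · rw [abs_sub_comm]; exact (mu_half_le_omegaFreq_sub h).trans (le_abs_self _)
  · exact (mu_half_le_omegaFreq_sub h).trans (le_abs_self _)

/-- The square of the ratio is `j²/(j² + m)`, largest at `j = 1`, `m = -1/2` with value `2`, and `√2
< 3/2`. -/
theorem sq_div_omegaFreq_le (hm : -1 / 2 ≤ m) (j : ℕ+) :
    (j : ℝ) ^ 2 / omegaFreq m j ≤ 3 / 2 := by
  have h := omegaFreq_pos hm j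
  rw [div_le_iff₀ h]
  have h1 := omegaFreq_sq hm j
  have h2 := one_le_pnat_cast j
  refine (pow_le_pow_iff_left₀ (by positivity) (by positivity) two_ne_zero).1 ?_
  rw [mul_pow, h1]
  nlinarith [pow_le_pow_left₀ zero_le_one h2 2]

theorem sq_div_omegaFreq_nonneg (hm : -1 / 2 ≤ m) (j : ℕ+) : 0 ≤ (j : ℝ) ^ 2 / omegaFreq m j := by
  have := omegaFreq_pos hm j
  positivity

end Frequencies

/-! ### The weights of `H^r_N`: comparison with `j²` and with `j^{2r}`. -/

section Weights

/-- The weights of the norm of `H^r_N`. -/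
def weightN (r : ℝ) (N : ℕ) (j : ℕ+) : ℝ := if (j : ℕ) ≤ N then (j : ℝ) ^ 2 else (j : ℝ) ^ (2 * r)

variable {r : ℝ} {N : ℕ}

theorem sq_le_rpow_two_mul (hr : 1 ≤ r) (j : ℕ+) : (j : ℝ) ^ 2 ≤ (j : ℝ) ^ (2 * r) := by
  rw [← Real.rpow_natCast]
  exact Real.rpow_le_rpow_of_exponent_le (one_le_pnat_cast j) (by push_cast; linarith)

theorem sq_le_weightN (hr : 1 ≤ r) (N : ℕ) (j : ℕ+) : (j : ℝ) ^ 2 ≤ weightN r N j := by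
  rw [weightN]
  split_ifs
  · exact le_rfl
  · exact sq_le_rpow_two_mul hr j

theorem weightN_pos (r : ℝ) (N : ℕ) (j : ℕ+) : 0 < weightN r N j := by
  have := pnat_cast_pos j
  rw [weightN]
  split_ifs <;> positivity

theorem weightN_le (hr : 1 ≤ r) (N : ℕ) (j : ℕ+) : weightN r N j ≤ (j : ℝ) ^ (2 * r) := by
  rw [weightN]
  split_ifs
  · exact sq_le_rpow_two_mul hr j
  · exact le_rfl

theorem rpow_two_mul_eq_sq (r : ℝ) (j : ℕ+) : (j : ℝ) ^ (2 * r) = ((j : ℝ) ^ r) ^ 2 := by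
  rw [← Real.rpow_natCast, ← Real.rpow_mul (pnat_cast_pos j).le]
  push_cast
  ring_nf

theorem rpow_le_mul_weightN (hr : 1 ≤ r) (hN : 1 ≤ N) (j : ℕ+) :
    (j : ℝ) ^ (2 * r) ≤ (N : ℝ) ^ (2 * r) * weightN r N j := by
  have hj := one_le_pnat_cast j
  have hN' : (1 : ℝ) ≤ N := Nat.one_le_cast.2 hN
  rw [weightN]
  split_ifs with h
  · have : (j : ℝ) ^ (2 * r) ≤ (N : ℝ) ^ (2 * r) :=
      Real.rpow_le_rpow (by positivity) (by exact_mod_cast h) (by linarith)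
    have h1 : (1 : ℝ) ≤ (j : ℝ) ^ 2 := one_le_pow₀ hj
    have h2 : 0 ≤ (N : ℝ) ^ (2 * r) := by positivity
    nlinarith
  · have h1 : 1 ≤ (N : ℝ) ^ (2 * r) := Real.one_le_rpow hN' (by linarith)
    have h2 : 0 ≤ (j : ℝ) ^ (2 * r) := by positivity
    nlinarith

/-- This supplies the field `tail` of `CoupledOscillators`. Beyond `N` the weight is at least `k³`,
and `k² ≤ δ k³` once `k ≥ 1/δ`. -/
theorem exists_finset_sq_le_mul_weightN (hr : 2 ≤ r) (N : ℕ) {δ : ℝ} (hδ : 0 < δ) :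
    ∃ F : Finset ℕ+, ∀ k ∉ F, (k : ℝ) ^ 2 ≤ δ * weightN r N k := by
  obtain ⟨M, hM⟩ := exists_nat_gt (1 / δ)
  refine ⟨Finset.Icc 1 ⟨max M N + 1, Nat.succ_pos _⟩, fun k hk => ?_⟩
  have hk' : max M N + 1 < (k : ℕ) := by
    by_contra h
    exact hk (Finset.mem_Icc.2 ⟨one_le, (not_lt.1 h : (k : ℕ) ≤ max M N + 1)⟩)
  have hkN : ¬ (k : ℕ) ≤ N := by have := le_max_right M N; omega
  have hkM : (M : ℝ) ≤ k := by have := le_max_left M N; exact_mod_cast (by omega : M ≤ (k : ℕ))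
  have hk1 := one_le_pnat_cast k
  rw [weightN, if_neg hkN]
  have h1 : (k : ℝ) ^ 3 ≤ (k : ℝ) ^ (2 * r) := by
    rw [← Real.rpow_natCast]
    exact Real.rpow_le_rpow_of_exponent_le hk1 (by push_cast; linarith)
  have h2 : 1 ≤ δ * k := by
    rw [div_lt_iff₀ hδ] at hM
    nlinarith
  calc (k : ℝ) ^ 2 = 1 * (k : ℝ) ^ 2 := by ring
    _ ≤ δ * k * (k : ℝ) ^ 2 := by gcongr
    _ = δ * (k : ℝ) ^ 3 := by ring
    _ ≤ _ := by gcongr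

end Weights

/-! ### The modal energy and its bound on times of order `μ ε⁻⁴`. -/

/-- The energy `∑ w_j (c_j² + d_j² / ω_j²)` of positions `c` and velocities `d`. -/
def modalEnergy (m r : ℝ) (N : ℕ) (c d : ℕ+ → ℝ) : ℝ :=
  ∑' j, weightN r N j * (c j ^ 2 + (d j / omegaFreq m j) ^ 2)

section Energy

variable {m s : ℝ}

theorem weightN_mul_sq (r : ℝ) (N : ℕ) (j : ℕ+) (x : ℝ) :
    weightN r N j * x ^ 2 = (√(weightN r N j) / (j : ℝ) ^ r * ((j : ℝ) ^ r * x)) ^ 2 := by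
  have h := rpow_pos_of_pos (pnat_cast_pos j) r
  rw [show √(weightN r N j) / (j : ℝ) ^ r * ((j : ℝ) ^ r * x) = √(weightN r N j) * x by field_simp,
    mul_pow, Real.sq_sqrt (weightN_pos r N j).le]

theorem abs_sqrt_weightN_div_le {r : ℝ} (hr : 1 ≤ r) (N : ℕ) (j : ℕ+) :
    |√(weightN r N j) / (j : ℝ) ^ r| ≤ 1 := by
  have h := rpow_pos_of_pos (pnat_cast_pos j) r
  rw [abs_of_nonneg (by positivity), div_le_one h]
  refine Real.sqrt_le_iff.2 ⟨h.le, ?_⟩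
  rw [← rpow_two_mul_eq_sq]
  exact weightN_le hr N j

theorem rpow_mul_div_omegaFreq (j : ℕ+) (x : ℝ) :
    (j : ℝ) ^ (s + 2) * (x / omegaFreq m j) = (j : ℝ) ^ 2 / omegaFreq m j * ((j : ℝ) ^ s * x) := by
  rw [Real.rpow_add (pnat_cast_pos j), Real.rpow_two]
  ring

/-- The multiplier relating the velocity part of `modalEnergy` to the norm of `H^s`. -/
theorem weightN_mul_div_sq (N : ℕ) (j : ℕ+) (x : ℝ) :
    weightN (s + 2) N j * (x / omegaFreq m j) ^ 2
      = (√(weightN (s + 2) N j) / (j : ℝ) ^ (s + 2) * ((j : ℝ) ^ 2 / omegaFreq m j)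
          * ((j : ℝ) ^ s * x)) ^ 2 := by
  rw [weightN_mul_sq, rpow_mul_div_omegaFreq]
  ring

theorem abs_velocity_multiplier_le (hm : -1 / 2 ≤ m) (hs : 1 / 2 < s) (N : ℕ) (j : ℕ+) :
    |√(weightN (s + 2) N j) / (j : ℝ) ^ (s + 2) * ((j : ℝ) ^ 2 / omegaFreq m j)| ≤ 3 / 2 := by
  rw [abs_mul, abs_of_nonneg (sq_div_omegaFreq_nonneg hm j)]
  calc _ ≤ 1 * (3 / 2) := mul_le_mul (abs_sqrt_weightN_div_le (by linarith) N j)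
        (sq_div_omegaFreq_le hm j) (sq_div_omegaFreq_nonneg hm j) zero_le_one
    _ = _ := by norm_num

theorem summable_mul_sq_of_abs_le {k : ℕ+ → ℝ} {C : ℝ} (hk : ∀ j, |k j| ≤ C) {x : ℕ+ → ℝ}
    (hx : Summable fun j => x j ^ 2) : Summable fun j => (k j * x j) ^ 2 := by
  refine Summable.of_nonneg_of_le (fun j => sq_nonneg _) (fun j => ?_) (hx.mul_left (C ^ 2))
  rw [mul_pow]
  have := sq_le_sq' (by linarith [neg_abs_le (k j), hk j]) ((le_abs_self _).trans (hk j))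
  gcongr

theorem summable_position_energy (hs : 1 / 2 < s) (N : ℕ) {c : ℕ+ → ℝ}
    (hc : Summable fun j : ℕ+ => ((j : ℝ) ^ (s + 2) * c j) ^ 2) :
    Summable fun j => weightN (s + 2) N j * c j ^ 2 := by
  simp_rw [weightN_mul_sq]
  exact summable_mul_sq_of_abs_le (abs_sqrt_weightN_div_le (by linarith) N) hc

theorem summable_velocity_energy (hm : -1 / 2 ≤ m) (hs : 1 / 2 < s) (N : ℕ) {d : ℕ+ → ℝ}
    (hd : Summable fun j : ℕ+ => ((j : ℝ) ^ s * d j) ^ 2) :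
    Summable fun j => weightN (s + 2) N j * (d j / omegaFreq m j) ^ 2 := by
  simp_rw [weightN_mul_div_sq]
  exact summable_mul_sq_of_abs_le (abs_velocity_multiplier_le hm hs N) hd

theorem summable_modalEnergy (hm : -1 / 2 ≤ m) (hs : 1 / 2 < s) (N : ℕ) {c d : ℕ+ → ℝ}
    (hc : Summable fun j : ℕ+ => ((j : ℝ) ^ (s + 2) * c j) ^ 2)
    (hd : Summable fun j : ℕ+ => ((j : ℝ) ^ s * d j) ^ 2) :
    Summable fun j => weightN (s + 2) N j * (c j ^ 2 + (d j / omegaFreq m j) ^ 2) := by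
  simp_rw [mul_add]
  exact (summable_position_energy hs N hc).add (summable_velocity_energy hm hs N hd)

theorem continuousOn_modalEnergy (hm : -1 / 2 ≤ m) (hs : 1 / 2 < s) (N : ℕ) {c d : ℝ → ℕ+ → ℝ}
    {I : Set ℝ} {U V : ℝ → lp (fun _ : ℕ+ => ℝ) 2} (hU : ContinuousOn U I) (hV : ContinuousOn V I)
    (hUc : ∀ t ∈ I, ∀ j, U t j = (j : ℝ) ^ (s + 2) * c t j)
    (hVd : ∀ t ∈ I, ∀ j, V t j = (j : ℝ) ^ s * d t j) :
    ContinuousOn (fun t => modalEnergy m (s + 2) N (c t) (d t)) I := by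
  refine ((continuousOn_tsum_sq hU (abs_sqrt_weightN_div_le (r := s + 2) (by linarith) N)).add
    (continuousOn_tsum_sq hV (abs_velocity_multiplier_le hm hs N))).congr fun t ht => ?_
  have h1 : Summable fun j : ℕ+ => ((j : ℝ) ^ (s + 2) * c t j) ^ 2 :=
    (lp_real_summable_sq (U t)).congr fun j => by rw [hUc t ht]
  have h2 : Summable fun j : ℕ+ => ((j : ℝ) ^ s * d t j) ^ 2 :=
    (lp_real_summable_sq (V t)).congr fun j => by rw [hVd t ht]
  simp only [modalEnergy, mul_add]
  rw [(summable_position_energy hs N h1).tsum_add (summable_velocity_energy hm hs N h2)]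
  refine congrArg₂ _ (tsum_congr fun j => ?_) (tsum_congr fun j => ?_)
  · rw [hUc t ht, weightN_mul_sq]
  · rw [hVd t ht, weightN_mul_div_sq]

/-- Long time bound for the modal system, for positive times. -/
theorem modalEnergy_lt_of_nonneg (hm : -1 / 2 ≤ m) (hs : 1 / 2 < s) {N : ℕ} {c d : ℝ → ℕ+ → ℝ}
    {ε T : ℝ} {U V : ℝ → lp (fun _ : ℕ+ => ℝ) 2}
    (hU : ContinuousOn U (Icc 0 T)) (hV : ContinuousOn V (Icc 0 T))
    (hUc : ∀ t ∈ Icc 0 T, ∀ j, U t j = (j : ℝ) ^ (s + 2) * c t j)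
    (hVd : ∀ t ∈ Icc 0 T, ∀ j, V t j = (j : ℝ) ^ s * d t j)
    (hode : ∀ t ∈ Icc 0 T, modalEnergy m (s + 2) N (c t) (d t) ≤ 3 * ε ^ 2 → ∀ j,
      HasDerivAt (fun τ => c τ j) (d t j) t ∧ HasDerivAt (fun τ => d τ j)
        (-(omegaFreq m j ^ 2 + 1 / (2 * π) * (∑' k : ℕ+, (k : ℝ) ^ 2 * c t k ^ 2) * (j : ℝ) ^ 2) * c t j) t)
    (hε : 0 < ε) (hεμ : ε ≤ 0.08 * √(mu m)) (hT : T * ε ^ 4 ≤ 0.02 * mu m)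
    (h0 : modalEnergy m (s + 2) N (c 0) (d 0) ≤ 2.1 * ε ^ 2) :
    ∀ t ∈ Icc 0 T, modalEnergy m (s + 2) N (c t) (d t) < 3 * ε ^ 2 := by
  have hμ := mu_pos hm
  have hosc : CoupledOscillators (fun j t => c t j) (fun j t => d t j / omegaFreq m j) (omegaFreq m)
      (fun j => (j : ℝ) ^ 2 / omegaFreq m j) (fun j => (j : ℝ) ^ 2) (weightN (s + 2) N)
      (1 / (2 * π)) (3 / 2) (mu m) (3 * ε ^ 2) T :=
    { sigma_nonneg := by positivity
      mu_pos := hμ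
      b_nonneg := fun j => by positivity
      b_le := sq_le_weightN (by linarith) N
      r_nonneg := sq_div_omegaFreq_nonneg hm
      r_le := sq_div_omegaFreq_le hm
      freq := mu_le_two_mul_omegaFreq m
      gap := fun j k => mu_half_le_abs_omegaFreq_sub
      tail := fun δ hδ => exists_finset_sq_le_mul_weightN (by linarith) N hδ
      summable := fun t ht => summable_modalEnergy hm hs N
        ((lp_real_summable_sq (U t)).congr fun j => by rw [hUc t ht])
        ((lp_real_summable_sq (V t)).congr fun j => by rw [hVd t ht])
      deriv_u := fun t ht hA j => (hode t ht hA j).1.congr_deriv (by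
        have := (omegaFreq_pos hm j).ne'
        field_simp)
      deriv_p := fun t ht hA j => ((hode t ht hA j).2.div_const _).congr_deriv (by
        have := (omegaFreq_pos hm j).ne'
        field_simp
        ring) }
  -- The constant is `0.0064 = 0.08²`.
  have hε2 : ε ^ 2 ≤ 0.0064 * mu m := by
    have := pow_le_pow_left₀ hε.le hεμ 2
    rw [mul_pow, Real.sq_sqrt hμ.le] at this
    linarith
  -- Here `σρ = 3/(4π)` and `π > 3`.
  have hσρ : 1 / (2 * π) * (3 / 2) ≤ 1 / 4 := by
    rw [div_mul_div_comm, div_le_div_iff₀ (by positivity) (by norm_num)]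
    linarith [pi_gt_three]
  refine hosc.energy_lt (by positivity)
    (continuousOn_modalEnergy hm hs N hU hV hUc hVd) ?_
  have hσρ0 : 0 ≤ 1 / (2 * π) * (3 / 2) := by positivity
  set q := 1 / (2 * π) * (3 / 2)
  change modalEnergy m (s + 2) N (c 0) (d 0) + _ + _ < _
  -- With `A = 3ε²` the budget is `2.1 + 2 · 0.0144 + 0.135 < 3` in units of `ε²`, where `0.0144 =
  -- (1/4) · 9 · 0.0064` and `0.135 = 108 · (1/16) · 0.02`.
  have e1 : q * (3 * ε ^ 2) ^ 2 / mu m ≤ 0.0144 * ε ^ 2 := by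
    rw [div_le_iff₀ hμ]
    have : (3 * ε ^ 2) ^ 2 ≤ 9 * ε ^ 2 * (0.0064 * mu m) := by nlinarith [sq_nonneg ε]
    calc q * (3 * ε ^ 2) ^ 2 ≤ 1 / 4 * (9 * ε ^ 2 * (0.0064 * mu m)) := by gcongr
      _ = _ := by ring
  have e2 : 4 * q ^ 2 * (3 * ε ^ 2) ^ 3 / mu m * T ≤ 0.135 * ε ^ 2 := by
    have hq2 : q ^ 2 ≤ 1 / 16 := by nlinarith
    rw [show 4 * q ^ 2 * (3 * ε ^ 2) ^ 3 / mu m * T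
      = 108 * q ^ 2 * ε ^ 2 * (T * ε ^ 4 / mu m) by ring]
    have : T * ε ^ 4 / mu m ≤ 0.02 := by rw [div_le_iff₀ hμ]; exact hT
    calc _ ≤ 108 * q ^ 2 * ε ^ 2 * 0.02 := by gcongr
      _ ≤ 108 * (1 / 16) * ε ^ 2 * 0.02 := by gcongr
      _ = _ := by ring
  nlinarith [pow_pos hε 2]

/-- Long time bound for the modal system. -/
theorem modalEnergy_lt (hm : -1 / 2 ≤ m) (hs : 1 / 2 < s) {N : ℕ} {c d : ℝ → ℕ+ → ℝ}
    {ε T : ℝ} {U V : ℝ → lp (fun _ : ℕ+ => ℝ) 2}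
    (hU : ContinuousOn U (Icc (-T) T)) (hV : ContinuousOn V (Icc (-T) T))
    (hUc : ∀ t ∈ Icc (-T) T, ∀ j, U t j = (j : ℝ) ^ (s + 2) * c t j)
    (hVd : ∀ t ∈ Icc (-T) T, ∀ j, V t j = (j : ℝ) ^ s * d t j)
    (hode : ∀ t ∈ Icc (-T) T, modalEnergy m (s + 2) N (c t) (d t) ≤ 3 * ε ^ 2 → ∀ j,
      HasDerivAt (fun τ => c τ j) (d t j) t ∧ HasDerivAt (fun τ => d τ j)
        (-(omegaFreq m j ^ 2 + 1 / (2 * π) * (∑' k : ℕ+, (k : ℝ) ^ 2 * c t k ^ 2) * (j : ℝ) ^ 2) * c t j) t)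
    (hε : 0 < ε) (hεμ : ε ≤ 0.08 * √(mu m)) (hT : T * ε ^ 4 ≤ 0.02 * mu m)
    (h0 : modalEnergy m (s + 2) N (c 0) (d 0) ≤ 2.1 * ε ^ 2) :
    ∀ t ∈ Icc (-T) T, modalEnergy m (s + 2) N (c t) (d t) < 3 * ε ^ 2 := by
  intro t ht
  have hT0 : 0 ≤ T := by linarith [ht.1, ht.2]
  have hsub : Icc 0 T ⊆ Icc (-T) T := Icc_subset_Icc_left (by linarith)
  have hneg : ∀ x ∈ Icc 0 T, -x ∈ Icc (-T) T := fun x hx => ⟨by linarith [hx.2], by linarith [hx.1]⟩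
  have hE : ∀ x, modalEnergy m (s + 2) N (c (-x)) (-d (-x)) = modalEnergy m (s + 2) N (c (-x)) (d (-x)) := by
    intro x
    unfold modalEnergy
    exact tsum_congr fun j => by rw [Pi.neg_apply, neg_div, neg_sq]
  rcases le_total 0 t with h | h
  · exact modalEnergy_lt_of_nonneg hm hs (hU.mono hsub) (hV.mono hsub)
      (fun x hx => hUc x (hsub hx)) (fun x hx => hVd x (hsub hx)) (fun x hx => hode x (hsub hx))
      hε hεμ hT h0 t ⟨h, ht.2⟩
  -- Negative times follow from reversibility: `(c(-t), -d(-t))` solves the same system.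
  · have := modalEnergy_lt_of_nonneg hm hs (c := fun x => c (-x)) (d := fun x => -d (-x))
      (U := fun x => U (-x)) (V := fun x => -V (-x))
      (hU.comp continuous_neg.continuousOn hneg) (hV.comp continuous_neg.continuousOn hneg).neg
      (fun x hx => hUc (-x) (hneg x hx))
      (fun x hx j => by
        rw [lp.coeFn_neg, Pi.neg_apply, hVd (-x) (hneg x hx), Pi.neg_apply]; ring)
      (fun x hx hA j => by
        rw [hE] at hA
        obtain ⟨h1, h2⟩ := hode (-x) (hneg x hx) hA j
        have h3 := h1.scomp x (hasDerivAt_neg x)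
        have h4 := (h2.scomp x (hasDerivAt_neg x)).neg
        exact ⟨h3.congr_deriv (by simp), h4.congr_deriv (by simp)⟩)
      hε hεμ hT (by rw [hE]; simpa using h0) (-t) ⟨by linarith, by linarith [ht.1]⟩
    rw [hE, neg_neg] at this
    exact this

end Energy

/-! ### The modal system and its complex amplitudes. -/

/-- `S = ∑ k² c_k²`, the squared `H¹` norm. -/
def modalStretch (c : ℕ+ → ℝ) : ℝ := ∑' k : ℕ+, (k : ℝ) ^ 2 * c k ^ 2

/-- Acceleration of the `j`-th mode. -/
def modalAccel (m : ℝ) (c : ℕ+ → ℝ) (j : ℕ+) : ℝ :=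
  -(omegaFreq m j ^ 2 + 1 / (2 * π) * modalStretch c * (j : ℝ) ^ 2) * c j

/-- Positions `c` and velocities `d` of the modes solve the modal system on `I`, with values in
`H^{s+2} × H^s`. -/
structure IsModalSolution (m s : ℝ) (I : Set ℝ) (c d : ℝ → ℕ+ → ℝ) : Prop where
  pos : ∃ U : ℝ → lp (fun _ : ℕ+ => ℝ) 2, ContinuousOn U I ∧
    ∀ t ∈ I, ∀ j, U t j = (j : ℝ) ^ (s + 2) * c t j
  vel : ∃ V : ℝ → lp (fun _ : ℕ+ => ℝ) 2, ContinuousOn V I ∧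
    ∀ t ∈ I, ∀ j, V t j = (j : ℝ) ^ s * d t j
  deriv_pos : ∀ t ∈ I, ∀ j, HasDerivAt (fun τ => c τ j) (d t j) t
  deriv_vel : ∀ t ∈ I, ∀ j, HasDerivAt (fun τ => d τ j) (modalAccel m (c t) j) t

section Amplitudes

variable {m s : ℝ}

theorem stretch_multiplier_bound (hs : 1 / 2 < s) (j : ℕ+) (x : ℂ) :
    ‖((j : ℝ) ^ (-(s + 1)) • Complex.reLm) x‖ ≤ 1 * ‖x‖ := by
  have h : (j : ℝ) ^ (-(s + 1)) ≤ 1 :=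
    Real.rpow_le_one_of_one_le_of_nonpos (one_le_pnat_cast j) (by linarith)
  have h0 : 0 ≤ (j : ℝ) ^ (-(s + 1)) := by positivity
  simp only [LinearMap.smul_apply, Complex.reLm_coe, smul_eq_mul, norm_mul, Real.norm_eq_abs,
    abs_of_nonneg h0]
  exact mul_le_mul h (Complex.abs_re_le_norm x) (abs_nonneg _) zero_le_one

/-- `z ↦ (j c_j)_j`, where `z_j = j^{s+2} (c_j + i d_j / ω_j)`. -/
def stretchOp (hs : 1 / 2 < s) : AmplitudeSpace →L[ℝ] lp (fun _ : ℕ+ => ℝ) 2 :=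
  diagOp (fun j => (j : ℝ) ^ (-(s + 1)) • Complex.reLm) 1 (stretch_multiplier_bound hs)

theorem forcing_multiplier_bound (hm : -1 / 2 ≤ m) (j : ℕ+) (x : ℂ) :
    ‖(LinearMap.mulLeft ℝ (((-(1 / (2 * π) * ((j : ℝ) ^ 2 / omegaFreq m j)) : ℝ) : ℂ) * Complex.I)
      ∘ₗ Complex.ofRealLI.toLinearMap ∘ₗ Complex.reLm) x‖ ≤ 1 * ‖x‖ := by
  have h0 := sq_div_omegaFreq_nonneg hm j
  have h1 := sq_div_omegaFreq_le hm j
  have h2 : 1 / (2 * π) ≤ 1 / 6 := one_div_le_one_div_of_le (by norm_num) (by linarith [pi_gt_three])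
  have h3 : 0 ≤ 1 / (2 * π) := by positivity
  have h4 : 1 / (2 * π) * ((j : ℝ) ^ 2 / omegaFreq m j) ≤ 1 := by nlinarith
  simp only [LinearMap.comp_apply, LinearMap.mulLeft_apply, Complex.reLm_coe, norm_mul,
    Complex.norm_I, mul_one, Complex.norm_real, Real.norm_eq_abs, abs_neg, abs_of_nonneg (mul_nonneg h3 h0),
    LinearIsometry.coe_toLinearMap, Complex.ofRealLI_apply]
  exact mul_le_mul h4 (Complex.abs_re_le_norm x) (abs_nonneg _) zero_le_one

/-- `z ↦ -(i / 2π) (j² / ω_j) Re z_j`. -/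
def forcingOp (hm : -1 / 2 ≤ m) : AmplitudeSpace →L[ℝ] AmplitudeSpace :=
  diagOp (fun j =>
    LinearMap.mulLeft ℝ (((-(1 / (2 * π) * ((j : ℝ) ^ 2 / omegaFreq m j)) : ℝ) : ℂ) * Complex.I)
      ∘ₗ Complex.ofRealLI.toLinearMap ∘ₗ Complex.reLm) 1 (forcing_multiplier_bound hm)

theorem norm_stretchOp_le (hs : 1 / 2 < s) (z : AmplitudeSpace) : ‖stretchOp hs z‖ ≤ ‖z‖ :=
  (diagOp_norm_le _ 1 zero_le_one (stretch_multiplier_bound hs) z).trans_eq (one_mul _)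

theorem norm_forcingOp_le (hm : -1 / 2 ≤ m) (z : AmplitudeSpace) : ‖forcingOp hm z‖ ≤ ‖z‖ :=
  (diagOp_norm_le _ 1 zero_le_one (forcing_multiplier_bound hm) z).trans_eq (one_mul _)

/-- `z_j = j^{s+2} (c_j + i d_j / ω_j)`. -/
def IsAmplitude (m s : ℝ) (z : AmplitudeSpace) (c d : ℕ+ → ℝ) : Prop :=
  ∀ j : ℕ+, z j = (((j : ℝ) ^ (s + 2) * c j : ℝ) : ℂ)
    + (((j : ℝ) ^ (s + 2) * (d j / omegaFreq m j) : ℝ) : ℂ) * Complex.I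

namespace IsAmplitude

variable {z : AmplitudeSpace} {c d : ℕ+ → ℝ}

theorem re_eq (h : IsAmplitude m s z c d) (j : ℕ+) : (z j).re = (j : ℝ) ^ (s + 2) * c j := by
  rw [h j]; simp

theorem im_eq (h : IsAmplitude m s z c d) (j : ℕ+) :
    (z j).im = (j : ℝ) ^ (s + 2) * (d j / omegaFreq m j) := by
  rw [h j]; simp

theorem norm_sq_apply (h : IsAmplitude m s z c d) (j : ℕ+) :
    ‖z j‖ ^ 2 = (j : ℝ) ^ (2 * (s + 2)) * (c j ^ 2 + (d j / omegaFreq m j) ^ 2) := by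
  rw [Complex.sq_norm, Complex.normSq_apply, h.re_eq, h.im_eq, rpow_two_mul_eq_sq]
  ring

theorem norm_stretchOp_sq (hs : 1 / 2 < s) (h : IsAmplitude m s z c d) :
    ‖stretchOp hs z‖ ^ 2 = modalStretch c := by
  rw [lp_two_norm_sq]
  refine tsum_congr fun j => ?_
  have hj := pnat_cast_pos j
  rw [stretchOp, diagOp_apply, LinearMap.smul_apply, Complex.reLm_coe, h.re_eq, smul_eq_mul, ← mul_assoc,
    ← Real.rpow_add hj, show -(s + 1) + (s + 2) = 1 by ring, Real.rpow_one, Real.norm_eq_abs, sq_abs,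
    mul_pow]

theorem cubicMap_apply (hs : 1 / 2 < s) (hm : -1 / 2 ≤ m) (h : IsAmplitude m s z c d) (j : ℕ+) :
    cubicMap (stretchOp hs) (forcingOp hm) z j
      = ((-(1 / (2 * π) * modalStretch c * ((j : ℝ) ^ 2 / omegaFreq m j)
          * ((j : ℝ) ^ (s + 2) * c j)) : ℝ) : ℂ) * Complex.I := by
  rw [cubicMap, h.norm_stretchOp_sq, lp.coeFn_smul, Pi.smul_apply, forcingOp, diagOp_apply]
  simp only [LinearMap.comp_apply, LinearMap.mulLeft_apply, Complex.reLm_coe,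
    LinearIsometry.coe_toLinearMap, Complex.ofRealLI_apply, h.re_eq, Complex.real_smul]
  push_cast
  ring

end IsAmplitude

/-- This converts the energy bound into a bound for `‖z‖`, and so determines a cut-off radius that
is never exceeded. -/
theorem norm_sq_le_mul_modalEnergy (hs : 1 / 2 < s) {N : ℕ} (hN : 1 ≤ N)
    {z : AmplitudeSpace} {c d : ℕ+ → ℝ} (h : IsAmplitude m s z c d) :
    ‖z‖ ^ 2 ≤ (N : ℝ) ^ (2 * (s + 2)) * modalEnergy m (s + 2) N c d := by
  have h1 : ∀ j, weightN (s + 2) N j * (c j ^ 2 + (d j / omegaFreq m j) ^ 2) ≤ ‖z j‖ ^ 2 := fun j => by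
    rw [h.norm_sq_apply]
    exact mul_le_mul_of_nonneg_right (weightN_le (by linarith) N j) (by positivity)
  have h2 : Summable fun j => weightN (s + 2) N j * (c j ^ 2 + (d j / omegaFreq m j) ^ 2) :=
    Summable.of_nonneg_of_le (fun j => mul_nonneg (weightN_pos _ _ _).le (by positivity)) h1
      (lp_two_summable z)
  rw [lp_two_norm_sq, modalEnergy, ← tsum_mul_left]
  refine Summable.tsum_le_tsum (fun j => ?_) (lp_two_summable z) (h2.mul_left _)
  rw [h.norm_sq_apply, ← mul_assoc]
  exact mul_le_mul_of_nonneg_right (rpow_le_mul_weightN (by linarith) hN j) (by positivity)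

theorem real_to_amplitude_bound (hm : -1 / 2 ≤ m) (j : ℕ+) (x : ℝ) :
    ‖(LinearMap.mulLeft ℝ ((((j : ℝ) ^ 2 / omegaFreq m j : ℝ) : ℂ) * Complex.I)
      ∘ₗ Complex.ofRealLI.toLinearMap) x‖ ≤ 3 / 2 * ‖x‖ := by
  simp only [LinearMap.comp_apply, LinearMap.mulLeft_apply, norm_mul, Complex.norm_I, mul_one,
    Complex.norm_real, LinearIsometry.coe_toLinearMap, Complex.ofRealLI_apply,
    Real.norm_of_nonneg (sq_div_omegaFreq_nonneg hm j)]
  exact mul_le_mul_of_nonneg_right (sq_div_omegaFreq_le hm j) (norm_nonneg _)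

/-- The amplitudes as a continuous linear function of the weighted positions and velocities. -/
def amplitudeOp (hm : -1 / 2 ≤ m) (U V : lp (fun _ : ℕ+ => ℝ) 2) : AmplitudeSpace :=
  diagOp (fun _ => Complex.ofRealLI.toLinearMap) 1 (fun _ x => by simp) U
    + diagOp (fun j => LinearMap.mulLeft ℝ ((((j : ℝ) ^ 2 / omegaFreq m j : ℝ) : ℂ) * Complex.I)
      ∘ₗ Complex.ofRealLI.toLinearMap) (3 / 2) (real_to_amplitude_bound hm) V

theorem isAmplitude_amplitudeOp (hm : -1 / 2 ≤ m) {U V : lp (fun _ : ℕ+ => ℝ) 2} {c d : ℕ+ → ℝ}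
    (hU : ∀ j, U j = (j : ℝ) ^ (s + 2) * c j) (hV : ∀ j, V j = (j : ℝ) ^ s * d j) :
    IsAmplitude m s (amplitudeOp hm U V) c d := by
  intro j
  rw [amplitudeOp, lp.coeFn_add, Pi.add_apply, diagOp_apply, diagOp_apply, rpow_mul_div_omegaFreq]
  simp only [LinearMap.comp_apply, LinearMap.mulLeft_apply,
    LinearIsometry.coe_toLinearMap, Complex.ofRealLI_apply, hU, hV]
  push_cast
  ring

theorem continuousOn_amplitudeOp (hm : -1 / 2 ≤ m) {U V : ℝ → lp (fun _ : ℕ+ => ℝ) 2} {I : Set ℝ}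
    (hU : ContinuousOn U I) (hV : ContinuousOn V I) :
    ContinuousOn (fun t => amplitudeOp hm (U t) (V t)) I :=
  ((diagOp _ 1 _).continuous.comp_continuousOn hU).add
    ((diagOp _ (3 / 2) _).continuous.comp_continuousOn hV)

theorem IsModalSolution.exists_amplitude (hm : -1 / 2 ≤ m) (hs : 1 / 2 < s) {I : Set ℝ}
    {c d : ℝ → ℕ+ → ℝ} (h : IsModalSolution m s I c d) :
    ∃ z : ℝ → AmplitudeSpace, ContinuousOn z I ∧ (∀ t ∈ I, IsAmplitude m s (z t) (c t) (d t)) ∧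
      (IsOpen I → ∀ t ∈ I, ∀ j, HasDerivAt (fun τ => z τ j)
        (-(omegaFreq m j * Complex.I * z t j) + cubicMap (stretchOp hs) (forcingOp hm) (z t) j) t) := by
  obtain ⟨U, hU, hUc⟩ := h.pos
  obtain ⟨V, hV, hVd⟩ := h.vel
  have hamp : ∀ t ∈ I, IsAmplitude m s (amplitudeOp hm (U t) (V t)) (c t) (d t) := fun t ht =>
    isAmplitude_amplitudeOp hm (hUc t ht) (hVd t ht)
  refine ⟨fun t => amplitudeOp hm (U t) (V t), continuousOn_amplitudeOp hm hU hV, hamp,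
    fun hI t ht j => ?_⟩
  have h1 := ((h.deriv_pos t ht j).const_mul ((j : ℝ) ^ (s + 2))).ofReal_comp
  have h2 := ((((h.deriv_vel t ht j).div_const (omegaFreq m j)).const_mul
    ((j : ℝ) ^ (s + 2))).ofReal_comp).mul_const Complex.I
  have h3 : HasDerivAt (fun τ => amplitudeOp hm (U τ) (V τ) j) _ t :=
    (h1.fun_add h2).congr_of_eventuallyEq (by
      filter_upwards [hI.mem_nhds ht] with τ hτ
      exact hamp τ hτ j)
  refine h3.congr_deriv ?_
  rw [(hamp t ht).cubicMap_apply hs hm, hamp t ht j, modalAccel]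
  have hω : (omegaFreq m j : ℂ) ≠ 0 := by exact_mod_cast (omegaFreq_pos hm j).ne'
  push_cast
  field_simp
  ring_nf
  simp only [Complex.I_sq]
  ring

theorem IsModalSolution.unique (hm : -1 / 2 ≤ m) (hs : 1 / 2 < s) {I : Set ℝ} (hI : IsTimeInterval I)
    {c d c' d' : ℝ → ℕ+ → ℝ} (h : IsModalSolution m s I c d) (h' : IsModalSolution m s I c' d')
    (hc : c 0 = c' 0) (hd : d 0 = d' 0) {t : ℝ} (ht : t ∈ I) : c t = c' t := by
  obtain ⟨z, hz, hza, hzd⟩ := h.exists_amplitude hm hs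
  obtain ⟨w, hw, hwa, hwd⟩ := h'.exists_amplitude hm hs
  have h0 : z 0 = w 0 := by
    ext j
    rw [hza 0 hI.2.2 j, hwa 0 hI.2.2 j, hc, hd]
  have := eqOn_of_modal_ode (norm_stretchOp_le hs) (norm_forcingOp_le hm) hI.1 hI.2.1 hI.2.2 hz hw
    (hzd hI.1) (hwd hI.1) h0 ht
  funext j
  have h1 := (hza t ht).re_eq j
  rw [this, (hwa t ht).re_eq j] at h1
  exact (mul_left_cancel₀ (rpow_pos_of_pos (pnat_cast_pos j) _).ne' h1).symm

end Amplitudes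

/-! ### Existence for the modal system by removing the cut-off. -/

section Existence

variable {m s : ℝ}

theorem summable_weighted_of_memHstar {r : ℝ} {c : ℕ+ → ℝ}
    (hc : Summable fun j : ℕ+ => (j : ℝ) ^ (2 * r) * c j ^ 2) :
    Summable fun j : ℕ+ => ((j : ℝ) ^ r * c j) ^ 2 :=
  hc.congr fun j => by rw [rpow_two_mul_eq_sq, mul_pow]

theorem re_part_bound (x : ℂ) : ‖Complex.reLm x‖ ≤ 1 * ‖x‖ := by
  simpa using Complex.abs_re_le_norm x

theorem im_part_bound (hm : -1 / 2 ≤ m) (j : ℕ+) (x : ℂ) :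
    ‖(omegaFreq m j / (j : ℝ) ^ 2) • Complex.imLm x‖ ≤ (1 + |m|) * ‖x‖ := by
  have h0 := omegaFreq_pos hm j
  have hj := one_le_pnat_cast j
  have hb : omegaFreq m j / (j : ℝ) ^ 2 ≤ 1 + |m| := by
    rw [div_le_iff₀ (by positivity)]
    refine (pow_le_pow_iff_left₀ h0.le (by positivity) two_ne_zero).1 ?_
    rw [omegaFreq_sq hm, mul_pow]
    have h1 : (1 : ℝ) ≤ (j : ℝ) ^ 2 := one_le_pow₀ hj
    have h2 := le_abs_self m
    have h3 := abs_nonneg m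
    have h4 : m * (j : ℝ) ^ 2 ≤ |m| * ((j : ℝ) ^ 2) ^ 2 := by
      calc m * (j : ℝ) ^ 2 ≤ |m| * ((j : ℝ) ^ 2 * 1) := by rw [mul_one]; gcongr
        _ ≤ |m| * ((j : ℝ) ^ 2 * (j : ℝ) ^ 2) := by gcongr
        _ = _ := by ring
    have h5 : 0 ≤ (|m| + |m| ^ 2) * ((j : ℝ) ^ 2) ^ 2 := by positivity
    nlinarith
  rw [norm_smul, Real.norm_of_nonneg (by positivity)]
  exact mul_le_mul hb (by simpa using Complex.abs_im_le_norm x) (norm_nonneg _) (by positivity)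

/-- Existence for the modal system on a long time interval, for small data. -/
theorem exists_modal_solution (hm : -1 / 2 ≤ m) (hs : 1 / 2 < s) {N : ℕ} (hN : 1 ≤ N) {ε T : ℝ}
    (hT0 : 0 < T) (hε : 0 < ε) (hεμ : ε ≤ 0.08 * √(mu m)) (hT : T * ε ^ 4 ≤ 0.02 * mu m)
    {c₀ d₀ : ℕ+ → ℝ} (hc₀ : Summable fun j : ℕ+ => ((j : ℝ) ^ (s + 2) * c₀ j) ^ 2)
    (hd₀ : Summable fun j : ℕ+ => ((j : ℝ) ^ s * d₀ j) ^ 2)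
    (h0 : modalEnergy m (s + 2) N c₀ d₀ ≤ 2.1 * ε ^ 2) :
    ∃ c d : ℝ → ℕ+ → ℝ, IsModalSolution m s (Ioo (-T) T) c d ∧ c 0 = c₀ ∧ d 0 = d₀ := by
  -- With this radius, energy at most `3ε²` forces `‖z‖ ≤ R`, where the truncated field is the true
  -- one.
  set R := √((N : ℝ) ^ (2 * (s + 2)) * (3 * ε ^ 2)) with hRdef
  have hNpos : (0 : ℝ) < N := by exact_mod_cast hN
  have hR : 0 < R := Real.sqrt_pos.2 (by positivity)
  set z₀ := amplitudeOp hm (lpOfSummable (fun j => (j : ℝ) ^ (s + 2) * c₀ j) (by simpa only [Real.norm_eq_abs, sq_abs] using hc₀))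
    (lpOfSummable (fun j => (j : ℝ) ^ s * d₀ j) (by simpa only [Real.norm_eq_abs, sq_abs] using hd₀)) with hz₀
  have hz₀a : IsAmplitude m s z₀ c₀ d₀ := isAmplitude_amplitudeOp hm (fun j => rfl) (fun j => rfl)
  -- Solving up to `2T` makes the two-sided derivatives available at the endpoints `±T` of the
  -- interval on which the energy is estimated.
  obtain ⟨z, hz, hz0, hzd⟩ := exists_truncated_solution (ω := omegaFreq m) (norm_stretchOp_le hs)
    (norm_forcingOp_le hm) hR (show 0 < 2 * T by linarith) z₀
  set c : ℝ → ℕ+ → ℝ := fun t j => (z t j).re / (j : ℝ) ^ (s + 2) with hc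
  set d : ℝ → ℕ+ → ℝ := fun t j => omegaFreq m j * (z t j).im / (j : ℝ) ^ (s + 2) with hd
  have hw : ∀ j : ℕ+, (j : ℝ) ^ (s + 2) ≠ 0 := fun j => (rpow_pos_of_pos (pnat_cast_pos j) _).ne'
  have hω : ∀ j : ℕ+, omegaFreq m j ≠ 0 := fun j => (omegaFreq_pos hm j).ne'
  have hamp : ∀ t, IsAmplitude m s (z t) (c t) (d t) := fun t j => by
    have e1 : (j : ℝ) ^ (s + 2) * c t j = (z t j).re := by
      simp only [hc]; field_simp [hw j]
    have e2 : (j : ℝ) ^ (s + 2) * (d t j / omegaFreq m j) = (z t j).im := by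
      simp only [hd]; field_simp [hw j, hω j]
    rw [e1, e2, Complex.re_add_im]
  -- The modal equations are known only while the energy is at most `3ε²`; this conditional form is
  -- what the energy estimate accepts, and its conclusion removes the condition.
  have hode : ∀ t ∈ Icc (-T) T, modalEnergy m (s + 2) N (c t) (d t) ≤ 3 * ε ^ 2 → ∀ j,
      HasDerivAt (fun τ => c τ j) (d t j) t ∧ HasDerivAt (fun τ => d τ j) (modalAccel m (c t) j) t := by
    intro t ht hA j
    have hzR : ‖z t‖ ≤ R := by
      refine Real.le_sqrt_of_sq_le ((norm_sq_le_mul_modalEnergy hs hN (hamp t)).trans ?_)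
      gcongr
    have h1 := hzd t ⟨by linarith [ht.1], by linarith [ht.2]⟩ j
    rw [radialProj_of_norm_le hR hzR, (hamp t).cubicMap_apply hs hm] at h1
    have hre := (Complex.reCLM.hasFDerivAt.comp_hasDerivAt t h1).div_const ((j : ℝ) ^ (s + 2))
    have him := ((Complex.imCLM.hasFDerivAt.comp_hasDerivAt t h1).const_mul
      (omegaFreq m j)).div_const ((j : ℝ) ^ (s + 2))
    refine ⟨hre.congr_deriv ?_, him.congr_deriv ?_⟩
    · simp only [Complex.reCLM_apply, Complex.add_re, Complex.neg_re, Complex.mul_im, Complex.mul_re,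
        Complex.ofReal_re, Complex.ofReal_im, Complex.I_re, Complex.I_im, hd]
      ring
    · have e1 : (z t j).re = (j : ℝ) ^ (s + 2) * c t j := (hamp t).re_eq j
      have h2 := hw j
      have h3 := hω j
      simp only [Complex.imCLM_apply, Complex.add_im, Complex.neg_im, Complex.mul_im, Complex.mul_re,
        Complex.ofReal_re, Complex.ofReal_im, Complex.I_re, Complex.I_im, e1, modalAccel]
      field_simp
      ring
  set U : ℝ → lp (fun _ : ℕ+ => ℝ) 2 := fun t => diagOp (fun _ => Complex.reLm) 1
    (fun _ => re_part_bound) (z t) with hU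
  set V : ℝ → lp (fun _ : ℕ+ => ℝ) 2 := fun t => diagOp
    (fun j => (omegaFreq m j / (j : ℝ) ^ 2) • Complex.imLm) (1 + |m|) (im_part_bound hm) (z t) with hV
  have hsub : Icc (-T) T ⊆ Icc (-(2 * T)) (2 * T) := Icc_subset_Icc (by linarith) (by linarith)
  have hUc : ContinuousOn U (Icc (-T) T) :=
    (diagOp _ 1 _).continuous.comp_continuousOn (hz.mono hsub)
  have hVc : ContinuousOn V (Icc (-T) T) :=
    (diagOp _ (1 + |m|) _).continuous.comp_continuousOn (hz.mono hsub)
  have hUv : ∀ t ∈ Icc (-T) T, ∀ j, U t j = (j : ℝ) ^ (s + 2) * c t j := fun t _ j =>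
    (hamp t).re_eq j
  have hVv : ∀ t ∈ Icc (-T) T, ∀ j, V t j = (j : ℝ) ^ s * d t j := fun t _ j => by
    have h1 : V t j = omegaFreq m j / (j : ℝ) ^ 2 * (z t j).im := rfl
    have h2 : (j : ℝ) ^ (s + 2) = (j : ℝ) ^ s * (j : ℝ) ^ 2 := by
      rw [Real.rpow_add (pnat_cast_pos j), Real.rpow_two]
    have h3 := (rpow_pos_of_pos (pnat_cast_pos j) s).ne'
    rw [h1, hd]
    simp only [h2]
    field_simp
  have hc0 : c 0 = c₀ := by
    funext j
    simp only [hc, hz0, hz₀a.re_eq]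
    field_simp [hw j]
  have hd0 : d 0 = d₀ := by
    funext j
    simp only [hd, hz0, hz₀a.im_eq]
    field_simp [hw j, hω j]
  have hlt := modalEnergy_lt hm hs hUc hVc hUv hVv hode hε hεμ hT (by rw [hc0, hd0]; exact h0)
  have hsub2 : Ioo (-T) T ⊆ Icc (-T) T := Ioo_subset_Icc_self
  exact ⟨c, d, ⟨⟨U, hUc.mono hsub2, fun t ht => hUv t (hsub2 ht)⟩,
    ⟨V, hVc.mono hsub2, fun t ht => hVv t (hsub2 ht)⟩,
    fun t ht j => (hode t (hsub2 ht) (hlt t (hsub2 ht)).le j).1,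
    fun t ht j => (hode t (hsub2 ht) (hlt t (hsub2 ht)).le j).2⟩, hc0, hd0⟩

end Existence
-- Point evaluation and test functions as functionals on weighted sequences.
section Pairings

variable {s : ℝ}

theorem summable_rpow_mul_sq_of_bounded (hs : 1 / 2 < s) {x : ℕ+ → ℝ} {C : ℝ} (hx : ∀ j, |x j| ≤ C) :
    Summable fun j : ℕ+ => ((j : ℝ) ^ (-s) * x j) ^ 2 := by
  have h : Summable fun j : ℕ+ => ((j : ℝ) ^ (-s)) ^ 2 := by
    simp_rw [← rpow_two_mul_eq_sq]
    exact summable_pnat_rpow (by linarith)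
  simpa only [mul_comm] using summable_mul_sq_of_abs_le hx h

/-- Evaluation at `x` as a functional of the coefficients weighted with `j^s`. -/
theorem exists_eval_functional (hs : 1 / 2 < s) (x : ℝ) :
    ∃ L : lp (fun _ : ℕ+ => ℝ) 2 →L[ℝ] ℝ, ∀ (U : lp (fun _ : ℕ+ => ℝ) 2) (c : ℕ+ → ℝ),
      (∀ j, U j = (j : ℝ) ^ s * c j) → HasSum (fun j => c j * phi j x) (L U) := by
  obtain ⟨L, hL⟩ := lp_pairing (summable_rpow_mul_sq_of_bounded hs fun j => abs_phi_le j x)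
  refine ⟨L, fun U c hc => ?_⟩
  convert hL U using 2 with j
  have := (rpow_pos_of_pos (pnat_cast_pos j) s).ne'
  rw [hc, Real.rpow_neg (pnat_cast_pos j).le]
  field_simp

theorem summable_abs_of_weighted (hs : 1 / 2 < s) {U : lp (fun _ : ℕ+ => ℝ) 2} {c : ℕ+ → ℝ}
    (hc : ∀ j, U j = (j : ℝ) ^ s * c j) : Summable fun j => |c j| := by
  have h := lp_pairing_summable_abs
    (summable_rpow_mul_sq_of_bounded hs (x := fun _ => 1) (C := 1) fun j => by simp) U
  refine h.congr fun j => ?_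
  have := (rpow_pos_of_pos (pnat_cast_pos j) s).ne'
  rw [hc, Real.rpow_neg (pnat_cast_pos j).le]
  congr 1
  field_simp

/-- Pairing with a test function as a functional of the coefficients weighted with `j^{s-2}`. -/
theorem IsTestFunction.exists_functional {η : ℝ → ℝ} (hη : IsTestFunction η) (hs : 1 / 2 < s) :
    ∃ L : lp (fun _ : ℕ+ => ℝ) 2 →L[ℝ] ℝ, ∀ (U : lp (fun _ : ℕ+ => ℝ) 2) (c : ℕ+ → ℝ),
      (∀ j, U j = (j : ℝ) ^ (s - 2) * c j) → HasSum (fun j => c j * sineCoeff η j) (L U) := by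
  obtain ⟨C, hC⟩ := hη.exists_sq_mul_abs_sineCoeff_le
  obtain ⟨L, hL⟩ := lp_pairing (summable_rpow_mul_sq_of_bounded hs
    (x := fun j => (j : ℝ) ^ 2 * sineCoeff η j) (C := C) fun j => by
      rw [abs_mul, abs_of_nonneg (by positivity)]; exact hC j)
  refine ⟨L, fun U c hc => ?_⟩
  convert hL U using 2 with j
  have hj := pnat_cast_pos j
  have := (rpow_pos_of_pos hj s).ne'
  rw [hc, Real.rpow_neg hj.le, Real.rpow_sub hj, Real.rpow_two]
  field_simp

end Pairings

/-! ### From weak solutions to the modal system. -/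

section WeakForm

variable {m s : ℝ}

/-- The spatial part of the weak formulation in terms of the coefficients. -/
theorem IsSineRegular.hasSum_weak_form (hm : -1 / 2 ≤ m) {f η : ℝ → ℝ} (hf : IsSineRegular f)
    (hη : IsTestFunction η) :
    HasSum (fun j => -modalAccel m (sineCoeff f) j * sineCoeff η j)
      ((∫ x in (0 : ℝ)..π, iteratedDeriv 2 f x * iteratedDeriv 2 η x)
      + (m + 1 / (2 * π) * ∫ x in (0 : ℝ)..π, deriv f x ^ 2)
          * (∫ x in (0 : ℝ)..π, deriv f x * deriv η x)) := by
  have h1 := hf.hasSum_integral_iteratedDeriv_two_mul hη.continuous_iteratedDeriv_two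
  have h2 := hf.hasSum_integral_deriv_mul hη.deriv.continuous
  simp_rw [hη.sineCoeff_iteratedDeriv_two] at h1
  simp_rw [integral_psi_mul_deriv hη.hasDerivAt hη.deriv.continuous hη.apply_zero hη.apply_pi] at h2
  rw [← hf.hasSum_integral_deriv_sq.tsum_eq]
  have h3 := h1.add (h2.mul_left (m + 1 / (2 * π) * modalStretch (sineCoeff f)))
  convert h3 using 2 with j
  · rw [modalAccel, omegaFreq_sq hm]
    ring
  · rfl

/-- The second time derivative of the pairing with a test function. -/
theorem IsTestFunction.hasSum_iteratedDeriv_two {η : ℝ → ℝ} (hη : IsTestFunction η) (hs : 1 / 2 < s)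
    {I : Set ℝ} (hI : IsOpen I) {u : ℝ → ℝ → ℝ} (hu : ∀ t ∈ I, IsSineRegular (u t))
    {U V A : ℝ → lp (fun _ : ℕ+ => ℝ) 2} (hUV : ∀ t ∈ I, HasDerivAt U (V t) t)
    (hVA : ∀ t ∈ I, HasDerivAt V (A t) t)
    (hU : ∀ t ∈ I, ∀ j, U t j = (j : ℝ) ^ (s - 2) * sineCoeff (u t) j) {t : ℝ} (ht : t ∈ I)
    {a : ℕ+ → ℝ} (ha : ∀ j, A t j = (j : ℝ) ^ (s - 2) * a j) :
    HasSum (fun j => a j * sineCoeff η j)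
      (iteratedDeriv 2 (fun τ => ∫ x in (0 : ℝ)..π, u τ x * η x) t) := by
  obtain ⟨L, hL⟩ := hη.exists_functional hs
  have h1 : ∀ τ ∈ I, ∫ x in (0 : ℝ)..π, u τ x * η x = L (U τ) := fun τ hτ =>
    ((hu τ hτ).hasSum_integral_mul hη.continuous).unique (hL _ _ (hU τ hτ))
  have h2 : ∀ τ ∈ I, _root_.deriv (fun τ => ∫ x in (0 : ℝ)..π, u τ x * η x) τ = L (V τ) := fun τ hτ => by
    have : (fun τ => ∫ x in (0 : ℝ)..π, u τ x * η x) =ᶠ[𝓝 τ] fun τ => L (U τ) := by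
      filter_upwards [hI.mem_nhds hτ] with x hx using h1 x hx
    rw [this.deriv_eq]
    exact (L.hasFDerivAt.comp_hasDerivAt τ (hUV τ hτ)).deriv
  have h3 : iteratedDeriv 2 (fun τ => ∫ x in (0 : ℝ)..π, u τ x * η x) t = L (A t) := by
    rw [iteratedDeriv_succ, iteratedDeriv_one]
    have : _root_.deriv (fun τ => ∫ x in (0 : ℝ)..π, u τ x * η x) =ᶠ[𝓝 t] fun τ => L (V τ) := by
      filter_upwards [hI.mem_nhds ht] with x hx using h2 x hx
    rw [this.deriv_eq]
    exact (L.hasFDerivAt.comp_hasDerivAt t (hVA t ht)).deriv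
  rw [h3]
  exact hL _ _ ha

theorem MemHstar.sineCoeff_congr {f g : ℝ → ℝ} (h : ∀ x ∈ Icc 0 π, f x = g x) :
    sineCoeff f = sineCoeff g := by
  funext j
  refine intervalIntegral.integral_congr fun x hx => ?_
  rw [uIcc_of_le pi_pos.le] at hx
  simp only [h x hx]

/-- The coefficients of a weak solution solve the modal system. -/
theorem IsWeakSolution.exists_isModalSolution (hm : -1 / 2 ≤ m) (hs : 1 / 2 < s) {I : Set ℝ}
    (hI : IsTimeInterval I) {u₀ v₀ : ℝ → ℝ} {u : ℝ → ℝ → ℝ} (h : IsWeakSolution m s I u₀ v₀ u) :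
    ∃ d : ℝ → ℕ+ → ℝ, IsModalSolution m s I (fun t => sineCoeff (u t)) d ∧
      sineCoeff (u 0) = sineCoeff u₀ ∧ d 0 = sineCoeff v₀ := by
  obtain ⟨hIo, hIc, hI0⟩ := hI
  obtain ⟨U₀, hU₀, hU₀c⟩ := h.continuous
  obtain ⟨U₁, hU₁, hU₁c⟩ := h.contDiff_one
  obtain ⟨U₂, hU₂, hU₂c⟩ := h.contDiff_two
  have hreg : ∀ t ∈ I, IsSineRegular (u t) := fun t ht => (h.mem t ht).isSineRegular hs
  have hw : ∀ (r : ℝ) (j : ℕ+), (j : ℝ) ^ r ≠ 0 := fun r j => (rpow_pos_of_pos (pnat_cast_pos j) r).ne'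
  have hU₁' : ∀ t ∈ I, HasDerivAt U₁ (deriv U₁ t) t := fun t ht =>
    ((hU₁.differentiableOn (by simp)).differentiableAt (hIo.mem_nhds ht)).hasDerivAt
  have hV₁ : ContinuousOn (deriv U₁) I := hU₁.continuousOn_deriv_of_isOpen hIo (by simp)
  have hU₂' : ∀ t ∈ I, HasDerivAt U₂ (deriv U₂ t) t := fun t ht =>
    ((hU₂.differentiableOn (by simp)).differentiableAt (hIo.mem_nhds ht)).hasDerivAt
  have hV₂ : ContDiffOn ℝ 1 (deriv U₂) I := hU₂.deriv_of_isOpen hIo (by norm_num)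
  have hV₂' : ∀ t ∈ I, HasDerivAt (deriv U₂) (deriv (deriv U₂) t) t := fun t ht =>
    ((hV₂.differentiableOn (by simp)).differentiableAt (hIo.mem_nhds ht)).hasDerivAt
  -- Velocities are read off in `H^s` and accelerations in `H^{s-2}`. Uniqueness of derivatives,
  -- mode by mode, shows that the velocities of the two curves agree.
  set d : ℝ → ℕ+ → ℝ := fun t j => deriv U₁ t j / (j : ℝ) ^ s with hd
  set a : ℝ → ℕ+ → ℝ := fun t j => deriv (deriv U₂) t j / (j : ℝ) ^ (s - 2) with ha
  have hdV : ∀ t, ∀ j, deriv U₁ t j = (j : ℝ) ^ s * d t j := fun t j => by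
    simp only [hd]; field_simp [hw s j]
  have haA : ∀ t, ∀ j, deriv (deriv U₂) t j = (j : ℝ) ^ (s - 2) * a t j := fun t j => by
    simp only [ha]; field_simp [hw (s - 2) j]
  have hcd : ∀ t ∈ I, ∀ j, HasDerivAt (fun τ => sineCoeff (u τ) j) (d t j) t := fun t ht j => by
    refine ((hasDerivAt_coord (hU₁' t ht) j).div_const ((j : ℝ) ^ s)).congr_of_eventuallyEq ?_
    filter_upwards [hIo.mem_nhds ht] with τ hτ
    rw [hU₁c τ hτ]; field_simp [hw s j]
  have hda : ∀ t ∈ I, ∀ j, HasDerivAt (fun τ => d τ j) (a t j) t := fun t ht j => by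
    refine ((hasDerivAt_coord (hV₂' t ht) j).div_const ((j : ℝ) ^ (s - 2))).congr_of_eventuallyEq ?_
    filter_upwards [hIo.mem_nhds ht] with τ hτ
    have h1 := (hasDerivAt_coord (hU₂' τ hτ) j).div_const ((j : ℝ) ^ (s - 2))
    have h2 : HasDerivAt (fun τ => sineCoeff (u τ) j) (deriv U₂ τ j / (j : ℝ) ^ (s - 2)) τ := by
      refine h1.congr_of_eventuallyEq ?_
      filter_upwards [hIo.mem_nhds hτ] with x hx
      rw [hU₂c x hx]; field_simp [hw (s - 2) j]
    exact (hcd τ hτ j).unique h2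
  -- The weak equation says that the defect `a - modalAccel` annihilates the coefficients of all
  -- test functions. Divided by `j²` it is absolutely summable: the first part because `a_j/j²` is a
  -- sequence of `H^s` type with `s > 1/2`, the second by `∑ j² |c_j| < ∞`.
  have hsum : ∀ t ∈ I, ∀ j, a t j - modalAccel m (sineCoeff (u t)) j = 0 := by
    intro t ht
    have hr := hreg t ht
    refine eq_zero_of_hasSum_sineCoeff ?_ fun η hη => ?_
    · have h1 : Summable fun j : ℕ+ => |a t j / (j : ℝ) ^ 2| :=
        summable_abs_of_weighted hs (U := deriv (deriv U₂) t) fun j => by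
          have hj := pnat_cast_pos j
          rw [haA, Real.rpow_sub hj, Real.rpow_two]
          ring
      have h2 : Summable fun j : ℕ+ => |modalAccel m (sineCoeff (u t)) j / (j : ℝ) ^ 2| := by
        refine Summable.of_nonneg_of_le (fun _ => abs_nonneg _) (fun j => ?_)
          (hr.summable_two.add (hr.summable_zero.mul_left
            |m + 1 / (2 * π) * modalStretch (sineCoeff (u t))|))
        have hj := pnat_cast_pos j
        have e : modalAccel m (sineCoeff (u t)) j / (j : ℝ) ^ 2 = -((j : ℝ) ^ 2 * sineCoeff (u t) j)
            - (m + 1 / (2 * π) * modalStretch (sineCoeff (u t))) * sineCoeff (u t) j := by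
          rw [modalAccel, omegaFreq_sq hm]
          field_simp
          ring
        rw [e]
        refine (abs_sub _ _).trans_eq ?_
        rw [abs_neg, abs_mul, abs_mul, abs_of_pos (by positivity : (0 : ℝ) < (j : ℝ) ^ 2)]
      refine Summable.of_nonneg_of_le (fun _ => abs_nonneg _) (fun j => ?_) (h1.add h2)
      rw [sub_div]
      exact abs_sub _ _
    · have h1 := (hη.hasSum_iteratedDeriv_two hs hIo hreg hU₂' hV₂' hU₂c ht (haA t)).add
        (hr.hasSum_weak_form hm hη)
      have h2 := h.weak_eq t ht η hη
      rw [← add_assoc, h2] at h1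
      convert h1 using 2 with j
      ring
  refine ⟨d, ⟨⟨U₀, hU₀.continuousOn, hU₀c⟩, ⟨deriv U₁, hV₁, fun t _ => hdV t⟩, hcd,
    fun t ht j => (hda t ht j).congr_deriv (sub_eq_zero.1 (hsum t ht j))⟩,
    MemHstar.sineCoeff_congr h.init_pos, ?_⟩
  -- The initial velocity is prescribed pointwise. Evaluation at `x` is continuous on `H^s`, so `v₀`
  -- is the sine series of `d 0` on `(0, π)`.
  have habs : Summable fun j => |d 0 j| := summable_abs_of_weighted hs (hdV 0)
  funext j
  refine (sineCoeff_of_hasSum habs (fun x hx => ?_) j).symm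
  obtain ⟨L, hL⟩ := exists_eval_functional hs x
  have h1 : HasDerivAt (fun t => u t x) (L (deriv U₁ 0)) 0 := by
    refine (L.hasFDerivAt.comp_hasDerivAt (0 : ℝ) (hU₁' 0 hI0)).congr_of_eventuallyEq ?_
    filter_upwards [hIo.mem_nhds hI0] with τ hτ
    exact ((h.mem τ hτ).2 x (Ioo_subset_Icc_self hx)).unique (hL _ _ (hU₁c τ hτ))
  rw [(h.init_vel x (Ioo_subset_Icc_self hx)).unique h1]
  exact hL _ _ (hdV 0)

end WeakForm

/-! ### From modal solutions back to weak solutions. -/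

section Curves

theorem contDiffOn_succ_of_hasDerivAt {E : Type*} [NormedAddCommGroup E] [NormedSpace ℝ E]
    {I : Set ℝ} (hI : IsOpen I) {n : ℕ} {U V : ℝ → E} (h : ∀ t ∈ I, HasDerivAt U (V t) t)
    (hV : ContDiffOn ℝ n V I) : ContDiffOn ℝ ((n + 1 : ℕ) : WithTop ℕ∞) U I := by
  push_cast
  exact (contDiffOn_succ_iff_deriv_of_isOpen hI).2
    ⟨fun t ht => (h t ht).differentiableAt.differentiableWithinAt, by simp,
      hV.congr fun t ht => (h t ht).deriv⟩

theorem exists_multiplier {k : ℕ+ → ℝ} {C : ℝ} (hk : ∀ j, |k j| ≤ C) :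
    ∃ L : lp (fun _ : ℕ+ => ℝ) 2 →L[ℝ] lp (fun _ : ℕ+ => ℝ) 2, ∀ f j, L f j = k j * f j :=
  ⟨diagOp (fun j => LinearMap.mulLeft ℝ (k j)) C fun j x => by
    simp only [LinearMap.mulLeft_apply, norm_mul, Real.norm_eq_abs]
    exact mul_le_mul_of_nonneg_right (hk j) (abs_nonneg _), fun _ _ => rfl⟩

theorem abs_inv_pow_le_one (n : ℕ) (j : ℕ+) : |((j : ℝ) ^ n)⁻¹| ≤ 1 := by
  have := pnat_cast_pos j
  rw [abs_of_pos (by positivity)]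
  exact inv_le_one_of_one_le₀ (one_le_pow₀ (one_le_pnat_cast j))

theorem abs_omegaFreq_sq_div_le {m : ℝ} (hm : -1 / 2 ≤ m) (j : ℕ+) :
    |omegaFreq m j ^ 2 / (j : ℝ) ^ 4| ≤ 1 + |m| := by
  have hj := one_le_pnat_cast j
  have h1 : (1 : ℝ) ≤ (j : ℝ) ^ 2 := one_le_pow₀ hj
  rw [abs_of_nonneg (by positivity), div_le_iff₀ (by positivity), omegaFreq_sq hm]
  have h4 : m * (j : ℝ) ^ 2 ≤ |m| * (j : ℝ) ^ 4 := by
    calc m * (j : ℝ) ^ 2 ≤ |m| * ((j : ℝ) ^ 2 * 1) := by rw [mul_one]; gcongr; exact le_abs_self m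
      _ ≤ |m| * ((j : ℝ) ^ 2 * (j : ℝ) ^ 2) := by gcongr
      _ = _ := by ring
  linarith

end Curves

section Synthesis

variable {m s : ℝ}

theorem continuousOn_modalStretch (hs : 1 / 2 < s) {I : Set ℝ} {c : ℝ → ℕ+ → ℝ}
    {U : ℝ → lp (fun _ : ℕ+ => ℝ) 2} (hU : ContinuousOn U I)
    (hUc : ∀ t ∈ I, ∀ j, U t j = (j : ℝ) ^ (s + 2) * c t j) :
    ContinuousOn (fun t => modalStretch (c t)) I := by
  have hb : ∀ j : ℕ+, |(j : ℝ) ^ (-(s + 1))| ≤ 1 := fun j => by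
    rw [abs_of_nonneg (by positivity)]
    exact Real.rpow_le_one_of_one_le_of_nonpos (one_le_pnat_cast j) (by linarith)
  refine (continuousOn_tsum_sq hU hb).congr fun t ht => tsum_congr fun j => ?_
  rw [hUc t ht, ← mul_assoc, ← Real.rpow_add (pnat_cast_pos j), show -(s + 1) + (s + 2) = 1 by ring,
    Real.rpow_one, mul_pow]

/-- The sine series with coefficients solving the modal system is a weak solution. -/
theorem IsModalSolution.isWeakSolution (hm : -1 / 2 ≤ m) (hs : 1 / 2 < s) {I : Set ℝ}
    (hI : IsTimeInterval I) {u₀ v₀ : ℝ → ℝ} (hu₀ : MemHstar (s + 2) u₀) (hv₀ : MemHstar s v₀)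
    {c d : ℝ → ℕ+ → ℝ} (h : IsModalSolution m s I c d) (hc : c 0 = sineCoeff u₀)
    (hd : d 0 = sineCoeff v₀) : IsWeakSolution m s I u₀ v₀ fun t => sineSeries (c t) := by
  obtain ⟨hIo, hIc, hI0⟩ := hI
  obtain ⟨U, hU, hUc⟩ := h.pos
  obtain ⟨V, hV, hVd⟩ := h.vel
  have habs : ∀ t ∈ I, Summable fun j => |c t j| := fun t ht =>
    summable_abs_of_weighted (by linarith) (hUc t ht)
  have hcoeff : ∀ t ∈ I, ∀ j, sineCoeff (sineSeries (c t)) j = c t j := fun t ht j =>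
    sineCoeff_sineSeries (habs t ht) j
  have hmem : ∀ t ∈ I, MemHstar (s + 2) (sineSeries (c t)) := fun t ht => by
    refine ⟨(lp_real_summable_sq (U t)).congr fun j => ?_, fun x _ => ?_⟩
    · rw [hcoeff t ht, hUc t ht, rpow_two_mul_eq_sq, mul_pow]
    · simp_rw [hcoeff t ht]
      exact hasSum_sineSeries (habs t ht) x
  -- Division by `j²` and `j⁴` passes from the weight `j^{s+2}` to `j^s` and `j^{s-2}`; `D`
  -- multiplies by `ω_j²/j⁴`, so that the acceleration is a continuous curve with weight `j^{s-2}`.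
  obtain ⟨D₂, hD₂⟩ := exists_multiplier (abs_inv_pow_le_one 2)
  obtain ⟨D₄, hD₄⟩ := exists_multiplier (abs_inv_pow_le_one 4)
  obtain ⟨D, hD⟩ := exists_multiplier (abs_omegaFreq_sq_div_le hm)
  have hw : ∀ j : ℕ+, (j : ℝ) ^ (s + 2) = (j : ℝ) ^ s * (j : ℝ) ^ 2 := fun j => by
    rw [Real.rpow_add (pnat_cast_pos j), Real.rpow_two]
  have hw' : ∀ j : ℕ+, (j : ℝ) ^ (s - 2) = (j : ℝ) ^ s / (j : ℝ) ^ 2 := fun j => by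
    rw [Real.rpow_sub (pnat_cast_pos j), Real.rpow_two]
  have hU₁c : ∀ t ∈ I, ∀ j, D₂ (U t) j = (j : ℝ) ^ s * c t j := fun t ht j => by
    have := pnat_cast_pos j
    rw [hD₂, hUc t ht, hw]; field_simp
  have hU₂c : ∀ t ∈ I, ∀ j, D₄ (U t) j = (j : ℝ) ^ (s - 2) * c t j := fun t ht j => by
    have := pnat_cast_pos j
    rw [hD₄, hUc t ht, hw, hw']; field_simp
  have hV₂d : ∀ t ∈ I, ∀ j, D₂ (V t) j = (j : ℝ) ^ (s - 2) * d t j := fun t ht j => by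
    have := pnat_cast_pos j
    rw [hD₂, hVd t ht, hw']; field_simp
  set A : ℝ → lp (fun _ : ℕ+ => ℝ) 2 := fun t =>
    -D (U t) - (1 / (2 * π) * modalStretch (c t)) • D₂ (U t) with hAdef
  have hAa : ∀ t ∈ I, ∀ j, A t j = (j : ℝ) ^ (s - 2) * modalAccel m (c t) j := fun t ht j => by
    have := pnat_cast_pos j
    simp only [hAdef, lp.coeFn_sub, lp.coeFn_neg, lp.coeFn_smul, Pi.sub_apply, Pi.neg_apply,
      Pi.smul_apply, smul_eq_mul]
    rw [hD, hD₂, hUc t ht, hw, hw', modalAccel]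
    field_simp
    ring
  have hA : ContinuousOn A I :=
    (D.continuous.comp_continuousOn hU).neg.sub
      ((continuousOn_const.mul (continuousOn_modalStretch hs hU hUc)).smul
        (D₂.continuous.comp_continuousOn hU))
  have hder : ∀ t ∈ I, HasDerivAt (fun t => D₂ (U t)) (V t) t := fun t ht => by
    refine hasDerivAt_lp_of_coord hIo hIc hV (fun τ hτ j => ?_) ht
    rw [hVd τ hτ]
    refine ((h.deriv_pos τ hτ j).const_mul _).congr_of_eventuallyEq ?_
    filter_upwards [hIo.mem_nhds hτ] with x hx using hU₁c x hx j
  have hder₂ : ∀ t ∈ I, HasDerivAt (fun t => D₄ (U t)) (D₂ (V t)) t := fun t ht => by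
    refine hasDerivAt_lp_of_coord hIo hIc (V := fun t => D₂ (V t)) (D₂.continuous.comp_continuousOn hV)
      (fun τ hτ j => ?_) ht
    rw [hV₂d τ hτ]
    refine ((h.deriv_pos τ hτ j).const_mul _).congr_of_eventuallyEq ?_
    filter_upwards [hIo.mem_nhds hτ] with x hx using hU₂c x hx j
  have hder₃ : ∀ t ∈ I, HasDerivAt (fun t => D₂ (V t)) (A t) t := fun t ht => by
    refine hasDerivAt_lp_of_coord hIo hIc hA (fun τ hτ j => ?_) ht
    rw [hAa τ hτ]
    refine ((h.deriv_vel τ hτ j).const_mul _).congr_of_eventuallyEq ?_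
    filter_upwards [hIo.mem_nhds hτ] with x hx using hV₂d x hx j
  refine ⟨hmem, ⟨U, ?_, fun t ht j => ?_⟩, ⟨fun t => D₂ (U t), ?_, fun t ht j => ?_⟩,
    ⟨fun t => D₄ (U t), ?_, fun t ht j => ?_⟩, fun x hx => ?_, fun x hx => ?_, fun t ht η hη => ?_⟩
  · exact_mod_cast contDiffOn_zero.2 hU
  · rw [hcoeff t ht, hUc t ht]
  · exact contDiffOn_succ_of_hasDerivAt hIo hder (n := 0) (by exact_mod_cast contDiffOn_zero.2 hV)
  · rw [hcoeff t ht, hU₁c t ht]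
  · exact contDiffOn_succ_of_hasDerivAt hIo hder₂ (n := 1)
      (contDiffOn_succ_of_hasDerivAt hIo hder₃ (n := 0) (by exact_mod_cast contDiffOn_zero.2 hA))
  · rw [hcoeff t ht, hU₂c t ht]
  · simp only [hc, hu₀.eq_sineSeries hx]
  · obtain ⟨L, hL⟩ := exists_eval_functional hs x
    have h1 : v₀ x = L (V 0) := by
      have := hL (V 0) (d 0) (hVd 0 hI0)
      rw [hd] at this
      exact (hv₀.2 x hx).unique this
    rw [h1]
    refine (L.hasFDerivAt.comp_hasDerivAt (0 : ℝ) (hder 0 hI0)).congr_of_eventuallyEq ?_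
    filter_upwards [hIo.mem_nhds hI0] with τ hτ
    exact (hasSum_sineSeries (habs τ hτ) x).unique (hL _ _ (hU₁c τ hτ))
  · have hreg : ∀ t ∈ I, IsSineRegular (sineSeries (c t)) := fun t ht => (hmem t ht).isSineRegular hs
    have h1 := hη.hasSum_iteratedDeriv_two hs hIo hreg hder₂ hder₃
      (fun t ht j => by rw [hcoeff t ht, hU₂c t ht]) ht (hAa t ht)
    have h2 := (hreg t ht).hasSum_weak_form hm hη
    rw [show sineCoeff (sineSeries (c t)) = c t from funext (hcoeff t ht)] at h2
    have h3 := h1.add h2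
    rw [← add_assoc] at h3
    refine h3.unique ?_
    convert hasSum_zero (α := ℝ) (β := ℕ+) using 2 with j
    ring

end Synthesis

/-! ### Numerical bounds for `c_*`, `c_†` and `T₀`. -/

section Constants

theorem inv_exp_bounds : 0 < 1 / (80 * Real.exp 1) ∧ 1 / (80 * Real.exp 1) ≤ 0.0046 := by
  have := Real.exp_one_gt_d9
  refine ⟨by positivity, ?_⟩
  rw [div_le_iff₀ (by positivity)]
  linarith

theorem cStar_bounds : 1.7 ≤ cStar ∧ cStar ≤ 1.762 := by
  obtain ⟨h1, h2⟩ := inv_exp_bounds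
  set a := 5 / 6 - 1 / (80 * Real.exp 1) with ha
  have ha0 : 0.8287 ≤ a := by rw [ha]; linarith
  have ha1 : a ≤ 0.8334 := by rw [ha]; linarith
  have hpos : 0 < a ^ 2 := by positivity
  rw [cStar, ← ha, ← div_eq_mul_inv]
  constructor
  · rw [le_div_iff₀ hpos]
    nlinarith
  · rw [div_le_iff₀ hpos]
    nlinarith

theorem cDagger_bounds : 37 ≤ cDagger ∧ cDagger ≤ 38.08 := by
  have h1 := Real.exp_one_gt_d9
  have h2 := Real.exp_one_lt_d9
  have h3 := pi_gt_d4
  have h4 := pi_lt_d4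
  rw [cDagger, le_div_iff₀ pi_pos, div_le_iff₀ pi_pos]
  constructor <;> linarith

theorem cDagger_mul_cStar_le : cDagger * cStar ≤ 68 := by
  obtain ⟨h1, h2⟩ := cStar_bounds
  obtain ⟨h3, h4⟩ := cDagger_bounds
  nlinarith

theorem cDagger_mul_cStar_sq_bounds :
    94.8 ≤ cDagger * cStar ^ 2 ∧ cDagger * cStar ^ 2 ≤ 118.5 := by
  obtain ⟨h1, h2⟩ := cStar_bounds
  obtain ⟨h3, h4⟩ := cDagger_bounds
  have h5 := pow_le_pow_left₀ (by norm_num) h1 2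
  have h6 := pow_le_pow_left₀ (by linarith) h2 2
  constructor <;> nlinarith

variable {m ε : ℝ}

theorem sq_div_mu_le (hm : -1 / 2 ≤ m) (hε : 0 ≤ ε) (hεμ : ε ≤ 0.08 * √(mu m)) :
    ε ^ 2 / mu m ≤ 0.0064 := by
  have h := pow_le_pow_left₀ hε hεμ 2
  rw [mul_pow, Real.sq_sqrt (mu_pos hm).le] at h
  rw [div_le_iff₀ (mu_pos hm)]
  linarith

/-- The value is `0.948/94.8`. It is half of the `0.02` allowed by the energy estimate, which leaves
room for an open interval of existence around the closed set of times. -/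
theorem T0_le (hm : -1 / 2 ≤ m) : T0 m ε ≤ 0.01 := by
  obtain ⟨h1, -⟩ := cDagger_mul_cStar_sq_bounds
  have h2 : 0 ≤ cDagger * cStar * ε ^ 2 / mu m := by
    have := mu_pos hm
    have := cStar_bounds.1
    have := cDagger_bounds.1
    positivity
  rw [T0, div_le_iff₀ (by linarith)]
  linarith

/-- Here `0.008 = 0.948/118.5`, and `68` bounds `c_† c_*`. Smallness of `ε` makes `1 - 68 ε²/μ`
positive, so that the upper bound for the denominator may be used. -/
theorem le_T0 (hm : -1 / 2 ≤ m) (hε : 0 ≤ ε) (hεμ : ε ≤ 0.08 * √(mu m)) :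
    0.008 * (1 - 68 * ε ^ 2 / mu m) ≤ T0 m ε := by
  have h0 := sq_div_mu_le hm hε hεμ
  have h1 : 0 ≤ ε ^ 2 / mu m := div_nonneg (sq_nonneg _) (mu_pos hm).le
  obtain ⟨h2, h3⟩ := cDagger_mul_cStar_sq_bounds
  have h4 := cDagger_mul_cStar_le
  rw [T0, mul_div_assoc, mul_div_assoc (cDagger * cStar), le_div_iff₀ (by linarith)]
  nlinarith

theorem const_le (hm : -1 / 2 ≤ m) (hε : 0 ≤ ε) (hεμ : ε ≤ 0.08 * √(mu m)) :
    0.0045 ≤ 0.008 * (1 - 68 * ε ^ 2 / mu m) := by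
  have h0 := sq_div_mu_le hm hε hεμ
  rw [mul_div_assoc]
  linarith

end Constants

/-! ### From `H¹` to the supremum norm. -/

section SupBound

/-- Sup norm bound from the `H¹` norm. -/
theorem abs_le_of_hasSum_phi {c : ℕ+ → ℝ} {ε x y : ℝ} (hε : 0 < ε)
    (h : HasSum (fun j => c j * phi j x) y) (hc : Summable fun j : ℕ+ => (j : ℝ) ^ 2 * c j ^ 2)
    (hcε : ∑' j : ℕ+, (j : ℝ) ^ 2 * c j ^ 2 ≤ 3 * ε ^ 2) : |y| ≤ 2 * ε := by
  have hz : Summable fun j : ℕ+ => 1 / (j : ℝ) ^ 2 :=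
    hasSum_zeta_two.summable.comp_injective PNat.coe_injective
  have hz2 : ∑' j : ℕ+, 1 / (j : ℝ) ^ 2 ≤ π ^ 2 / 6 := by
    rw [← hasSum_zeta_two.tsum_eq]
    exact tsum_comp_le_tsum_of_inj hasSum_zeta_two.summable (fun n => by positivity)
      PNat.coe_injective
  have hs : √(2 / π) ≤ 0.8 := by
    refine Real.sqrt_le_iff.2 ⟨by norm_num, ?_⟩
    rw [div_le_iff₀ pi_pos]
    linarith [pi_gt_d2]
  have hb : ∀ j : ℕ+, ‖c j * phi j x‖
      ≤ 0.8 * (3 / (8 * ε) * ((j : ℝ) ^ 2 * c j ^ 2) + 2 * ε / 3 * (1 / (j : ℝ) ^ 2)) := fun j => by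
    have hj := pnat_cast_pos j
    -- Weighted AM-GM for `j |c_j|` and `1/j`, with the weights balanced for a squared `H¹` norm of
    -- `3ε²`. Altogether the bound is `0.8 (9/8 + 1.2) ε = 1.86 ε`.
    have h1 : |c j| ≤ 3 / (8 * ε) * ((j : ℝ) ^ 2 * c j ^ 2) + 2 * ε / 3 * (1 / (j : ℝ) ^ 2) := by
      have h2 : 3 / (8 * ε) * ((j : ℝ) ^ 2 * c j ^ 2) + 2 * ε / 3 * (1 / (j : ℝ) ^ 2) - |c j|
          = 3 / (8 * ε) * ((j : ℝ) * |c j| - 4 * ε / 3 / j) ^ 2 := by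
        rw [← sq_abs (c j)]
        field_simp
        ring
      have h3 : 0 ≤ 3 / (8 * ε) * ((j : ℝ) * |c j| - 4 * ε / 3 / j) ^ 2 := by positivity
      linarith
    rw [norm_mul, Real.norm_eq_abs, Real.norm_eq_abs, mul_comm]
    exact mul_le_mul ((abs_phi_le' j x).trans hs) h1 (abs_nonneg _) (by norm_num)
  have hsum := ((hc.hasSum.mul_left (3 / (8 * ε))).add (hz.hasSum.mul_left (2 * ε / 3))).mul_left 0.8
  have h1 := tsum_of_norm_bounded hsum hb
  rw [h.tsum_eq, Real.norm_eq_abs] at h1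
  have h2 : 3 / (8 * ε) * ∑' j : ℕ+, (j : ℝ) ^ 2 * c j ^ 2 ≤ 9 / 8 * ε := by
    calc _ ≤ 3 / (8 * ε) * (3 * ε ^ 2) := by gcongr
      _ = _ := by field_simp; ring
  have h3 : 2 * ε / 3 * ∑' j : ℕ+, 1 / (j : ℝ) ^ 2 ≤ 1.2 * ε := by
    have hpi : π ^ 2 / 6 ≤ 1.8 := by nlinarith [pi_lt_d2, pi_pos]
    calc _ ≤ 2 * ε / 3 * 1.8 := by gcongr; exact hz2.trans hpi
      _ = _ := by ring
  linarith

end SupBound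

/-! ### Energy bounds along any modal solution, in both time directions. -/

section LongTime

variable {m s : ℝ} {I : Set ℝ} {c d : ℝ → ℕ+ → ℝ}

theorem IsModalSolution.comp_neg (h : IsModalSolution m s I c d) :
    IsModalSolution m s (Neg.neg ⁻¹' I) (fun t => c (-t)) (fun t => -d (-t)) := by
  obtain ⟨U, hU, hUc⟩ := h.pos
  obtain ⟨V, hV, hVd⟩ := h.vel
  refine ⟨⟨fun t => U (-t), hU.comp continuous_neg.continuousOn fun t ht => ht,
    fun t ht => hUc (-t) ht⟩, ⟨fun t => -V (-t),
    (hV.comp continuous_neg.continuousOn fun t ht => ht).neg, fun t ht j => ?_⟩,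
    fun t ht j => ?_, fun t ht j => ?_⟩
  · rw [lp.coeFn_neg, Pi.neg_apply, hVd (-t) ht, Pi.neg_apply]
    ring
  · exact ((h.deriv_pos (-t) ht j).scomp t (hasDerivAt_neg t)).congr_deriv (by simp)
  · exact ((h.deriv_vel (-t) ht j).scomp t (hasDerivAt_neg t)).neg.congr_deriv (by simp)

theorem modalEnergy_neg (m r : ℝ) (N : ℕ) (c d : ℕ+ → ℝ) :
    modalEnergy m r N c (-d) = modalEnergy m r N c d :=
  tsum_congr fun j => by rw [Pi.neg_apply, neg_div, neg_sq]

theorem IsModalSolution.modalEnergy_lt_of_nonneg (hm : -1 / 2 ≤ m) (hs : 1 / 2 < s)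
    (hI : I.OrdConnected) (hI0 : 0 ∈ I) (h : IsModalSolution m s I c d) {N : ℕ} {ε : ℝ} (hε : 0 < ε)
    (hεμ : ε ≤ 0.08 * √(mu m)) (h0 : modalEnergy m (s + 2) N (c 0) (d 0) ≤ 2.1 * ε ^ 2) {t : ℝ}
    (ht : t ∈ I) (ht0 : 0 ≤ t) (htε : t * ε ^ 4 ≤ 0.02 * mu m) :
    modalEnergy m (s + 2) N (c t) (d t) < 3 * ε ^ 2 := by
  obtain ⟨U, hU, hUc⟩ := h.pos
  obtain ⟨V, hV, hVd⟩ := h.vel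
  have hsub : Icc 0 t ⊆ I := hI.out hI0 ht
  exact _root_.modalEnergy_lt_of_nonneg hm hs (hU.mono hsub) (hV.mono hsub)
    (fun x hx => hUc x (hsub hx)) (fun x hx => hVd x (hsub hx))
    (fun x hx _ j => ⟨h.deriv_pos x (hsub hx) j, h.deriv_vel x (hsub hx) j⟩) hε hεμ htε h0 t
    ⟨ht0, le_rfl⟩

theorem IsModalSolution.modalEnergy_lt (hm : -1 / 2 ≤ m) (hs : 1 / 2 < s) (hI : IsTimeInterval I)
    (h : IsModalSolution m s I c d) {N : ℕ} {ε : ℝ} (hε : 0 < ε) (hεμ : ε ≤ 0.08 * √(mu m))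
    (h0 : modalEnergy m (s + 2) N (c 0) (d 0) ≤ 2.1 * ε ^ 2) {t : ℝ} (ht : t ∈ I)
    (htε : |t| * ε ^ 4 ≤ 0.02 * mu m) : modalEnergy m (s + 2) N (c t) (d t) < 3 * ε ^ 2 := by
  rcases le_total 0 t with h1 | h1
  · rw [abs_of_nonneg h1] at htε
    exact h.modalEnergy_lt_of_nonneg hm hs hI.2.1 hI.2.2 hε hεμ h0 ht h1 htε
  · rw [abs_of_nonpos h1] at htε
    have hI' : (Neg.neg ⁻¹' I).OrdConnected :=
      ⟨fun x hx y hy z hz => hI.2.1.out hy hx ⟨neg_le_neg hz.2, neg_le_neg hz.1⟩⟩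
    have := h.comp_neg.modalEnergy_lt_of_nonneg hm hs hI' (by simpa using hI.2.2) hε hεμ
      (by rw [modalEnergy_neg, neg_zero]; exact h0) (t := -t) (by simpa using ht) (by linarith) htε
    rwa [modalEnergy_neg, neg_neg] at this

end LongTime

/-! ### Initial data: norms and the choice of `N`. -/

section Data

variable {m s : ℝ} {u₀ v₀ : ℝ → ℝ}

theorem hNorm_one_sq (f : ℝ → ℝ) : hNorm 1 f ^ 2 = ∑' j : ℕ+, (j : ℝ) ^ 2 * sineCoeff f j ^ 2 := by
  rw [hNorm, Real.sq_sqrt (tsum_nonneg fun j => by positivity)]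
  simp only [mul_one, Real.rpow_two]

theorem hTildeNegOneNorm_sq (m : ℝ) (f : ℝ → ℝ) : hTildeNegOneNorm m f ^ 2
    = ∑' j : ℕ+, (j : ℝ) ^ 2 * (sineCoeff f j / omegaFreq m j) ^ 2 := by
  rw [hTildeNegOneNorm, Real.sq_sqrt (tsum_nonneg fun j => by positivity)]
  exact tsum_congr fun j => by rw [div_pow]; ring

theorem summable_sq_mul_of_weightN {r : ℝ} (hr : 1 ≤ r) {N : ℕ} {x : ℕ+ → ℝ}
    (h : Summable fun j => weightN r N j * x j ^ 2) : Summable fun j : ℕ+ => (j : ℝ) ^ 2 * x j ^ 2 :=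
  Summable.of_nonneg_of_le (fun j => by positivity)
    (fun j => mul_le_mul_of_nonneg_right (sq_le_weightN hr N j) (sq_nonneg _)) h

theorem MemHstar.summable_sq_mul (hs : 1 / 2 < s) (hu₀ : MemHstar (s + 2) u₀) :
    Summable fun j : ℕ+ => (j : ℝ) ^ 2 * sineCoeff u₀ j ^ 2 :=
  summable_sq_mul_of_weightN (r := s + 2) (by linarith) (N := 0)
    (summable_position_energy hs 0 (summable_weighted_of_memHstar hu₀.1))

theorem MemHstar.summable_sq_mul_div (hm : -1 / 2 ≤ m) (hs : 1 / 2 < s) (hv₀ : MemHstar s v₀) :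
    Summable fun j : ℕ+ => (j : ℝ) ^ 2 * (sineCoeff v₀ j / omegaFreq m j) ^ 2 :=
  summable_sq_mul_of_weightN (r := s + 2) (by linarith) (N := 0)
    (summable_velocity_energy hm hs 0 (summable_weighted_of_memHstar hv₀.1))

/-- As `N → ∞` the weights decrease to `j²`, so by dominated convergence the energy tends to
`|u₀|_1² + |v₀|²_{H̃⁻¹} ≤ 2ε²`, which is strictly below `2.1ε²` because `ε > 0`. -/
theorem exists_modalEnergy_le (hm : -1 / 2 ≤ m) (hs : 1 / 2 < s) (hu₀ : MemHstar (s + 2) u₀)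
    (hv₀ : MemHstar s v₀) {ε : ℝ} (hε : 0 < ε) (h1 : hNorm 1 u₀ ≤ ε)
    (h2 : hTildeNegOneNorm m v₀ ≤ ε) :
    ∃ N : ℕ, 1 ≤ N ∧ modalEnergy m (s + 2) N (sineCoeff u₀) (sineCoeff v₀) ≤ 2.1 * ε ^ 2 := by
  have hlim : Tendsto (fun N => modalEnergy m (s + 2) N (sineCoeff u₀) (sineCoeff v₀)) atTop
      (𝓝 (∑' j : ℕ+, (j : ℝ) ^ 2 * (sineCoeff u₀ j ^ 2 + (sineCoeff v₀ j / omegaFreq m j) ^ 2))) := by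
    refine tendsto_tsum_of_dominated_convergence (summable_modalEnergy hm hs 0
      (summable_weighted_of_memHstar hu₀.1) (summable_weighted_of_memHstar hv₀.1)) (fun j => ?_)
      (Eventually.of_forall fun N j => ?_)
    · refine tendsto_const_nhds.congr' ?_
      filter_upwards [eventually_ge_atTop (j : ℕ)] with N hN
      rw [weightN, if_pos hN]
    · have := weightN_pos (s + 2) N j
      rw [Real.norm_of_nonneg (by positivity)]
      refine mul_le_mul_of_nonneg_right ?_ (by positivity)
      refine (weightN_le (by linarith) N j).trans_eq ?_
      -- The dominating series is the energy with `N = 0`, where every weight is `j^{2(s+2)}`.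
      rw [weightN, if_neg (by have := j.pos; omega)]
  have hval : ∑' j : ℕ+, (j : ℝ) ^ 2 * (sineCoeff u₀ j ^ 2 + (sineCoeff v₀ j / omegaFreq m j) ^ 2)
      < 2.1 * ε ^ 2 := by
    simp_rw [mul_add]
    rw [(hu₀.summable_sq_mul hs).tsum_add (hv₀.summable_sq_mul_div hm hs), ← hNorm_one_sq,
      ← hTildeNegOneNorm_sq]
    have e1 := pow_le_pow_left₀ (Real.sqrt_nonneg _) h1 2
    have e2 := pow_le_pow_left₀ (Real.sqrt_nonneg _) h2 2
    have e3 := pow_pos hε 2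
    change hNorm 1 u₀ ^ 2 ≤ _ at e1
    change hTildeNegOneNorm m v₀ ^ 2 ≤ _ at e2
    linarith
  obtain ⟨N, hN, hN1⟩ := ((hlim.eventually_lt_const hval).and (eventually_ge_atTop 1)).exists
  exact ⟨N, hN1, hN.le⟩

theorem sineCoeff_eq_zero_of_hNorm (hs : 1 / 2 < s) (hu₀ : MemHstar (s + 2) u₀)
    (h : hNorm 1 u₀ = 0) : sineCoeff u₀ = 0 := by
  funext j
  have h1 := (hu₀.summable_sq_mul hs).le_tsum j fun k _ => by positivity
  rw [← hNorm_one_sq, h, zero_pow two_ne_zero] at h1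
  have hj := pnat_cast_pos j
  have h2 : (j : ℝ) ^ 2 * sineCoeff u₀ j ^ 2 = 0 := le_antisymm h1 (by positivity)
  simpa [hj.ne'] using h2

theorem sineCoeff_eq_zero_of_hTildeNegOneNorm (hm : -1 / 2 ≤ m) (hs : 1 / 2 < s)
    (hv₀ : MemHstar s v₀) (h : hTildeNegOneNorm m v₀ = 0) : sineCoeff v₀ = 0 := by
  funext j
  have h1 := (hv₀.summable_sq_mul_div hm hs).le_tsum j fun k _ => by positivity
  rw [← hTildeNegOneNorm_sq, h, zero_pow two_ne_zero] at h1
  have hj := pnat_cast_pos j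
  have h2 : (j : ℝ) ^ 2 * (sineCoeff v₀ j / omegaFreq m j) ^ 2 = 0 := le_antisymm h1 (by positivity)
  simpa [hj.ne', (omegaFreq_pos hm j).ne'] using h2

/-- Here `j²/ω_j² = 1/(j² + m) ≤ 1/(1 + m)`. It reduces the `H¹ × L²` statement to the sharper one.
-/
theorem hTildeNegOneNorm_le (hm : -1 / 2 ≤ m) (hs : 1 / 2 < s) (hv₀ : MemHstar s v₀) :
    hTildeNegOneNorm m v₀ ≤ hNorm 0 v₀ / √(1 + m) := by
  have hm' : 0 < 1 + m := by linarith
  have hsum : Summable fun j : ℕ+ => (j : ℝ) ^ (2 * (0 : ℝ)) * sineCoeff v₀ j ^ 2 := by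
    refine Summable.of_nonneg_of_le (fun j => by positivity) (fun j => ?_) hv₀.1
    exact mul_le_mul_of_nonneg_right (Real.rpow_le_rpow_of_exponent_le (one_le_pnat_cast j)
      (by linarith)) (sq_nonneg _)
  rw [hTildeNegOneNorm, hNorm, ← Real.sqrt_div' _ hm'.le]
  refine Real.sqrt_le_sqrt ?_
  rw [← tsum_div_const]
  have hle : ∀ j : ℕ+, (j : ℝ) ^ 2 / omegaFreq m j ^ 2 * sineCoeff v₀ j ^ 2
      ≤ (j : ℝ) ^ (2 * (0 : ℝ)) * sineCoeff v₀ j ^ 2 / (1 + m) := fun j => by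
    have hj := one_le_pnat_cast j
    rw [mul_zero, Real.rpow_zero, one_mul, div_eq_inv_mul (_ ^ 2) (1 + m)]
    refine mul_le_mul_of_nonneg_right ?_ (sq_nonneg _)
    rw [div_le_iff₀ (pow_pos (omegaFreq_pos hm j) 2), ← div_eq_inv_mul, le_div_iff₀ hm', omegaFreq_sq hm]
    have : (1 : ℝ) ≤ (j : ℝ) ^ 2 := one_le_pow₀ hj
    nlinarith
  exact Summable.tsum_le_tsum hle
    (Summable.of_nonneg_of_le (fun j => by positivity) hle (hsum.div_const _)) (hsum.div_const _)

end Data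

/-! ### Uniqueness, existence and uniform bounds for weak solutions. -/

section Stability

variable {m s : ℝ} {u₀ v₀ : ℝ → ℝ}

theorem IsWeakSolution.eq_of_mem (hm : -1 / 2 ≤ m) (hs : 1 / 2 < s) {I : Set ℝ}
    {u w : ℝ → ℝ → ℝ} (hI : IsTimeInterval I) (hu : IsWeakSolution m s I u₀ v₀ u)
    (hw : IsWeakSolution m s I u₀ v₀ w) {t : ℝ} (ht : t ∈ I) {x : ℝ} (hx : x ∈ Icc 0 π) :
    u t x = w t x := by
  obtain ⟨d, h, h0, hd⟩ := hu.exists_isModalSolution hm hs hI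
  obtain ⟨d', h', h0', hd'⟩ := hw.exists_isModalSolution hm hs hI
  have := h.unique hm hs hI h' (h0.trans h0'.symm) (hd.trans hd'.symm) ht
  rw [(hu.mem t ht).eq_sineSeries hx, (hw.mem t ht).eq_sineSeries hx, this]

theorem isModalSolution_zero (m s : ℝ) (I : Set ℝ) : IsModalSolution m s I 0 0 :=
  ⟨⟨0, continuousOn_const, fun _ _ _ => by simp⟩, ⟨0, continuousOn_const, fun _ _ _ => by simp⟩,
    fun t _ j => hasDerivAt_const t 0, fun t _ j => by
      simpa [modalAccel] using hasDerivAt_const t (0 : ℝ)⟩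

theorem exists_weakSolution_of_small (hm : -1 / 2 ≤ m) (hs : 1 / 2 < s) (hu₀ : MemHstar (s + 2) u₀)
    (hv₀ : MemHstar s v₀) {ε : ℝ} (h1 : hNorm 1 u₀ ≤ ε) (h2 : hTildeNegOneNorm m v₀ ≤ ε)
    (hεμ : ε ≤ 0.08 * √(mu m)) :
    ∃ (I : Set ℝ) (u : ℝ → ℝ → ℝ), IsTimeInterval I ∧
      {t : ℝ | |t| * ε ^ 4 ≤ 0.01 * mu m} ⊆ I ∧ IsWeakSolution m s I u₀ v₀ u := by
  have hμ := mu_pos hm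
  -- For `ε = 0` the data vanish and the zero curve is a solution for all time.
  rcases ((Real.sqrt_nonneg _).trans h1 : 0 ≤ ε).eq_or_lt' with rfl | hε
  · have hI : IsTimeInterval univ := ⟨isOpen_univ, ordConnected_univ, mem_univ _⟩
    exact ⟨univ, _, hI, subset_univ _, (isModalSolution_zero m s univ).isWeakSolution hm hs hI hu₀ hv₀
      (sineCoeff_eq_zero_of_hNorm hs hu₀ (h1.antisymm (Real.sqrt_nonneg _))).symm
      (sineCoeff_eq_zero_of_hTildeNegOneNorm hm hs hv₀ (h2.antisymm (Real.sqrt_nonneg _))).symm⟩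
  · obtain ⟨N, hN, hE⟩ := exists_modalEnergy_le hm hs hu₀ hv₀ hε h1 h2
    -- Twice the required time, so the closed set of times lies inside the open interval.
    set T := 0.02 * mu m / ε ^ 4 with hT
    have hT0 : 0 < T := by positivity
    have hTε : T * ε ^ 4 = 0.02 * mu m := by rw [hT]; field_simp
    obtain ⟨c, d, hcd, hc, hd⟩ := exists_modal_solution hm hs hN hT0 hε hεμ hTε.le
      (summable_weighted_of_memHstar hu₀.1) (summable_weighted_of_memHstar hv₀.1) hE
    have hI : IsTimeInterval (Ioo (-T) T) := ⟨isOpen_Ioo, ordConnected_Ioo, by linarith, hT0⟩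
    refine ⟨_, _, hI, fun t ht => abs_lt.1 ?_, hcd.isWeakSolution hm hs hI hu₀ hv₀ hc hd⟩
    refine lt_of_mul_lt_mul_right (a := ε ^ 4) ?_ (by positivity)
    rw [hTε]
    exact lt_of_le_of_lt ht (by linarith)

theorem hNormN_sq (r : ℝ) (N : ℕ) (f : ℝ → ℝ) :
    hNormN r N f ^ 2 = ∑' j, weightN r N j * sineCoeff f j ^ 2 :=
  Real.sq_sqrt (tsum_nonneg fun j => mul_nonneg (weightN_pos r N j).le (sq_nonneg _))

theorem exists_uniform_bound_of_small (hm : -1 / 2 ≤ m) (hs : 1 / 2 < s)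
    (hu₀ : MemHstar (s + 2) u₀) (hv₀ : MemHstar s v₀) {ε : ℝ} (h1 : hNorm 1 u₀ ≤ ε)
    (h2 : hTildeNegOneNorm m v₀ ≤ ε) (hεμ : ε ≤ 0.08 * √(mu m)) :
    ∃ N : ℕ, 1 ≤ N ∧ ∀ (I : Set ℝ) (u : ℝ → ℝ → ℝ), IsTimeInterval I →
      IsWeakSolution m s I u₀ v₀ u → ∀ t ∈ I, |t| * ε ^ 4 ≤ 0.01 * mu m →
        MemHstar (s + 2) (u t) ∧ hNormN (s + 2) N (u t) ≤ 1.9 * ε ∧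
          ∀ x ∈ Icc (0 : ℝ) π, |u t x| ≤ 2 * ε := by
  have hμ := mu_pos hm
  rcases ((Real.sqrt_nonneg _).trans h1 : 0 ≤ ε).eq_or_lt' with rfl | hε
  · refine ⟨1, le_rfl, fun I u hI hu t ht _ => ⟨hu.mem t ht, ?_, fun x hx => ?_⟩⟩
    all_goals
      obtain ⟨d, h, h0, hd⟩ := hu.exists_isModalSolution hm hs hI
      have hz : sineCoeff (u t) = 0 := h.unique hm hs hI (isModalSolution_zero m s I)
        (h0.trans (sineCoeff_eq_zero_of_hNorm hs hu₀ (h1.antisymm (Real.sqrt_nonneg _))))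
        (hd.trans (sineCoeff_eq_zero_of_hTildeNegOneNorm hm hs hv₀
          (h2.antisymm (Real.sqrt_nonneg _)))) ht
    · simp [hNormN, hz]
    · rw [(hu.mem t ht).eq_sineSeries hx, hz]
      simp [sineSeries]
  -- `N` is fixed by the data alone, before any solution is considered.
  · obtain ⟨N, hN, hE⟩ := exists_modalEnergy_le hm hs hu₀ hv₀ hε h1 h2
    refine ⟨N, hN, fun I u hI hu t ht htε => ?_⟩
    obtain ⟨d, h, h0, hd⟩ := hu.exists_isModalSolution hm hs hI
    have hlt := h.modalEnergy_lt hm hs hI hε hεμ (by rw [h0, hd]; exact hE) ht (by linarith)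
    have hmem := hu.mem t ht
    have hsum := summable_position_energy hs N (summable_weighted_of_memHstar hmem.1)
    obtain ⟨V, -, hVd⟩ := h.vel
    have hle : hNormN (s + 2) N (u t) ^ 2 ≤ 3 * ε ^ 2 := by
      rw [hNormN_sq]
      refine le_trans ?_ hlt.le
      refine Summable.tsum_le_tsum (fun j => ?_) hsum (summable_modalEnergy hm hs N
        (summable_weighted_of_memHstar hmem.1)
        ((lp_real_summable_sq (V t)).congr fun j => by rw [hVd t ht]))
      exact mul_le_mul_of_nonneg_left (le_add_of_nonneg_right (sq_nonneg _)) (weightN_pos _ _ _).le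
    refine ⟨hmem, ?_, fun x hx => abs_le_of_hasSum_phi hε (hmem.2 x hx) (hmem.summable_sq_mul hs) ?_⟩
    · refine (pow_le_pow_iff_left₀ (Real.sqrt_nonneg _) (by positivity) two_ne_zero).1 (hle.trans ?_)
      -- The margin is `3 ≤ 1.9² = 3.61`.
      nlinarith [sq_nonneg ε]
    · refine le_trans ?_ hle
      rw [hNormN_sq]
      exact Summable.tsum_le_tsum (fun j => mul_le_mul_of_nonneg_right
        (sq_le_weightN (by linarith) N j) (sq_nonneg _)) (hmem.summable_sq_mul hs) hsum

end Stability

end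

theorem theorem1 (m s : ℝ) (hm : -1 / 2 ≤ m) (hs : 1 / 2 < s) (u₀ v₀ : ℝ → ℝ)
    (hu₀ : MemHstar (s + 2) u₀) (hv₀ : MemHstar s v₀) :
    -- uniqueness of the weak solution
    (∀ (I : Set ℝ) (u w : ℝ → ℝ → ℝ), IsTimeInterval I →
      IsWeakSolution m s I u₀ v₀ u → IsWeakSolution m s I u₀ v₀ w →
        ∀ t ∈ I, ∀ x ∈ Icc (0 : ℝ) π, u t x = w t x) ∧
    -- stability for data small in `H¹ × L²`
    (∀ ε : ℝ, ε = max (hNorm 1 u₀) (hNorm 0 v₀ / √(1 + m)) → ε ≤ 0.08 * √(mu m) →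
      0.008 * (1 - 68 * ε ^ 2 / mu m) ≤ T0 m ε ∧
      0.0045 ≤ 0.008 * (1 - 68 * ε ^ 2 / mu m) ∧
      (∃ (I : Set ℝ) (u : ℝ → ℝ → ℝ), IsTimeInterval I ∧
        {t : ℝ | |t| * ε ^ 4 ≤ T0 m ε * mu m} ⊆ I ∧ IsWeakSolution m s I u₀ v₀ u) ∧
      (∀ (I : Set ℝ) (u : ℝ → ℝ → ℝ), IsTimeInterval I → IsWeakSolution m s I u₀ v₀ u →
        ∀ t ∈ I, |t| * ε ^ 4 ≤ T0 m ε * mu m →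
          ∀ x ∈ Icc (0 : ℝ) π, |u t x| ≤ 2 * ε)) ∧
    -- sharper form, for data small in `H¹` and in the weighted `H⁻¹`
    (∀ ε : ℝ, ε = max (hNorm 1 u₀) (hTildeNegOneNorm m v₀) → ε ≤ 0.08 * √(mu m) →
      (∃ (I : Set ℝ) (u : ℝ → ℝ → ℝ), IsTimeInterval I ∧
        {t : ℝ | |t| * ε ^ 4 ≤ T0 m ε * mu m} ⊆ I ∧ IsWeakSolution m s I u₀ v₀ u) ∧
      ∃ N : ℕ, 1 ≤ N ∧
        ∀ (I : Set ℝ) (u : ℝ → ℝ → ℝ), IsTimeInterval I → IsWeakSolution m s I u₀ v₀ u →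
          ∀ t ∈ I, |t| * ε ^ 4 ≤ T0 m ε * mu m →
            MemHstar (s + 2) (u t) ∧ hNormN (s + 2) N (u t) ≤ 1.9 * ε ∧
              ∀ x ∈ Icc (0 : ℝ) π, |u t x| ≤ 2 * ε) := by
  have hμ := mu_pos hm
  -- The dynamics only uses `T₀ ≤ 0.01`; the exact form of `T₀` matters for its numerical lower
  -- bounds alone.
  have hsmall : ∀ {ε t : ℝ}, |t| * ε ^ 4 ≤ T0 m ε * mu m → |t| * ε ^ 4 ≤ 0.01 * mu m :=
    fun ht => ht.trans (mul_le_mul_of_nonneg_right (T0_le hm) hμ.le)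
  refine ⟨fun I u w hI hu hw t ht x hx => hu.eq_of_mem hm hs hI hw ht hx, fun ε hε hεμ => ?_,
    fun ε hε hεμ => ?_⟩
  · have h1 : hNorm 1 u₀ ≤ ε := hε ▸ le_max_left _ _
    have h2 : hTildeNegOneNorm m v₀ ≤ ε :=
      (hTildeNegOneNorm_le hm hs hv₀).trans (hε ▸ le_max_right _ _)
    have hε0 : 0 ≤ ε := (Real.sqrt_nonneg _).trans h1
    obtain ⟨I, u, hI, hsub, hu⟩ := exists_weakSolution_of_small hm hs hu₀ hv₀ h1 h2 hεμ
    obtain ⟨N, -, hN⟩ := exists_uniform_bound_of_small hm hs hu₀ hv₀ h1 h2 hεμ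
    exact ⟨le_T0 hm hε0 hεμ, const_le hm hε0 hεμ, ⟨I, u, hI, fun t ht => hsub (hsmall ht), hu⟩,
      fun I u hI hu t ht htε => (hN I u hI hu t ht (hsmall htε)).2.2⟩
  · have h1 : hNorm 1 u₀ ≤ ε := hε ▸ le_max_left _ _
    have h2 : hTildeNegOneNorm m v₀ ≤ ε := hε ▸ le_max_right _ _
    obtain ⟨I, u, hI, hsub, hu⟩ := exists_weakSolution_of_small hm hs hu₀ hv₀ h1 h2 hεμ
    obtain ⟨N, hN1, hN⟩ := exists_uniform_bound_of_small hm hs hu₀ hv₀ h1 h2 hεμ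
    exact ⟨⟨I, u, hI, fun t ht => hsub (hsmall ht), hu⟩, N, hN1,
      fun I u hI hu t ht htε => hN I u hI hu t ht (hsmall htε)⟩
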